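/- All groupoids below are small (objects and arrows in a fixed universe). Let $\mathbb B$ be the groupoid with objects the natural numbers and arrows $m\to n$ the bijections $\{0,\dots,m-1\}\simeq\{0,\dots,n-1\}$. For a groupoid $I$, let $\mathrm{Fam}(I)$ be the groupoid of finite families of objects of $I$: an object is a finite set $N$ with a map $N\to I$, and an arrow is a bijection of index sets together with an arrow of $I$ between the objects at each pair of corresponding indices. Let $\mathrm{Exp}\,I=\Sigma_{b:\mathbb B}(\mathrm{Fin}(b)\to I)$ be the small groupoid of pairs $(n,\ \{0,\dots,n-1\}\to I)$, an arrow being an arrow of $\mathbb B$ together with arrows of $I$ between corresponding objects. A finitary polynomial $P:I\rightsquigarrow J$ is a groupoid $\mathrm{Op}\,P$ of operations with a functor $\mathrm{tgt}:\mathrm{Op}\,P\to J$ (output colour) and a functor $\mathrm{pm}:\mathrm{Op}\,P\to\mathrm{Fam}(I)$ (the finite family of input colours of the parameters); equivalently, a diagram $I\leftarrow E\to\mathrm{Op}\,P\to J$ of groupoids in which $E\to \mathrm{Op}\,P$ has finite (discrete) homotopy fibres. An equivalence $P\simeq Q$ of polynomials is an equivalence of groupoids $\mathrm{Op}\,P\to\mathrm{Op}\,Q$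 with natural isomorphisms making it compatible with $\mathrm{pm}$ and $\mathrm{tgt}$; an identification of two such equivalences is a natural isomorphism between the underlying functors that is compatible with these data. This gives a groupoid $\mathrm{Eq}(P,Q)$ of equivalences and identifications. The bicategory of finitary polynomials has groupoids as objects, finitary polynomials as 1-cells, and equivalences of polynomials up to identification as 2-cells; an operation of the composite of $P:I\rightsquigarrow J$ and $Q:J\rightsquigarrow K$ is an operation of $Q$ with, for each of its parameters, an operation of $P$ of the corresponding output colour (up to a given isomorphism), its parameters being those of the operations of $P$; the identity of $I$ has $\mathrm{Op}=I$, each $i$ having output colour $i$ and one parameter, of colour $i$. Write $\mathrm{Hom}(I,J)$ for the category of 1-cells $I\rightsquigarrow J$, and $I\sqcup J$ for the disjoint union. Given $P:(I\sqcup J)\rightsquigarrow K$, let $\mathrm{curry}\,P:I\rightsquigarrow \mathrm{Exp}\,J\times K$ have the same operations as $P$; an operation $c$ keeps its parameters coloured in $I$, and has as output colour the pair of the element of $\mathrm{Exp}\,J$ obtained by enumerating its parameters coloured in $J$ and the output colour of $c$ in $P$. Given $P:I\rightsquigarrow\mathrm{Exp}\,J\times K$, let $\mathrm{uncurry}\,P:(I\sqcup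 J)\rightsquigarrow K$ have the same operations; to the parameters of an operation with output colour $(X,k)$ one adds the members of $X$, and its new output colour is $k$. Both constructions extend to functors between $\mathrm{Hom}(I\sqcup J,K)$ and $\mathrm{Hom}(I,\mathrm{Exp}\,J\times K)$. Let $\mathrm{ev}:(\mathrm{Exp}\,J\times K)\sqcup J\rightsquigarrow K$ be $\mathrm{uncurry}$ of the identity. **Theorem.** The bicategory of finitary polynomials in groupoids is a cartesian $(2,1)$-category, with the disjoint union as product, and it is closed, with $\mathrm{Exp}\,J\times K$ as internal hom from $J$ to $K$. That is, for all groupoids $I,I',J,J',K,K'$: 1. Every 2-cell is invertible. 2. The category $\mathrm{Hom}(I,\varnothing)$ is equivalent to the terminal category. Postcomposition with the two projection polynomials $J\sqcup K\rightsquigarrow J$ and $J\sqcup K\rightsquigarrow K$ (those with exactly one operation for each output colour, which has one parameter, of the same colour) is an equivalence of categories $\mathrm{Hom}(I,J\sqcup K)\to\mathrm{Hom}(I,J)\times\mathrm{Hom}(I,K)$, for which the pairing functor (disjoint union of the operations) is a section up to natural isomorphism. 3. The functor $\mathrm{Hom}(I,\mathrm{Exp}\,J\times K)\to\mathrm{Hom}(I\sqcup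 J,K)$, $P\mapsto (P\times J)\cdot\mathrm{ev}$, where $P\times J$ is the action of the cartesian product on 1-cells, is an equivalence of categories, and it is naturally isomorphic to $\mathrm{uncurry}$. 4. $\mathrm{curry}$ and $\mathrm{uncurry}$ are mutually inverse up to natural isomorphism: $\mathrm{uncurry}\circ\mathrm{curry}\cong\mathrm{id}$ and $\mathrm{curry}\circ\mathrm{uncurry}\cong\mathrm{id}$. Moreover, for all $P,Q:(I\sqcup J)\rightsquigarrow K$, currying induces an equivalence of groupoids $\mathrm{Eq}(P,Q)\to\mathrm{Eq}(\mathrm{curry}\,P,\mathrm{curry}\,Q)$. 5. $\mathrm{curry}$ is natural in the three variables: for all 1-cells $S:I'\rightsquigarrow I$, $R:K\rightsquigarrow K'$ and $T:J'\rightsquigarrow J$ there are isomorphisms, natural in $P:(I\sqcup J)\rightsquigarrow K$, $$\mathrm{curry}((S\times J)\cdot P)\cong S\cdot\mathrm{curry}\,P,\qquad \mathrm{curry}(P\cdot R)\cong \mathrm{curry}\,P\cdot[J,R],\qquad \mathrm{curry}((I\times T)\cdot P)\cong\mathrm{curry}\,P\cdot[T,K],$$ where $\cdot$ is composition in diagrammatic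 order, $[J,R]=\mathrm{curry}(\mathrm{ev}\cdot R)$ and $[T,K]=\mathrm{curry}(((\mathrm{Exp}\,J\times K)\times T)\cdot\mathrm{ev})$, the outer product in the last formula being the cartesian product (disjoint union) of the bicategory. -/

import Mathlib

open CategoryTheory

universe u

/-- A finite family of elements of `I`: a (small) finite set of indices `N` and a map `N → I`. -/
structure Fam (I : Type u) where
  N : Type u
  [fin : Finite N]
  col : N → I

namespace Fam

attribute [instance] Fam.fin

variable {I : Type u} [Groupoid.{u} I]

/-- A morphism of finite families in the groupoid `I`: a bijection of the index sets (written as a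
re-indexing `G.N → F.N`) and an arrow of `I` between colours of corresponding indices. -/
structure Hom (F G : Fam I) where
  e : G.N → F.N
  bij : Function.Bijective e
  iso : ∀ (x : F.N) (y : G.N), e y = x → (F.col x ⟶ G.col y)

theorem Hom.ext' {F G : Fam I} {f g : Hom F G} (he : ∀ y, f.e y = g.e y)
    (hi : ∀ x y h h', f.iso x y h = g.iso x y h') : f = g := by
  obtain ⟨e, b, i⟩ := f
  obtain ⟨e', b', i'⟩ := g
  obtain rfl : e = e' := funext he
  congr
  funext x y h
  exact hi x y h h

instance : Category.{u} (Fam I) where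
  Hom := Hom
  id F := ⟨id, Function.bijective_id, fun x y h => eqToHom (congrArg F.col (Eq.symm h))⟩
  comp f g := ⟨fun z => f.e (g.e z), f.bij.comp g.bij,
    fun x z h => f.iso x (g.e z) h ≫ g.iso (g.e z) z rfl⟩
  id_comp f := by
    refine Hom.ext' (fun _ => rfl) ?_
    rintro x y rfl h
    exact Category.id_comp _
  comp_id f := by
    refine Hom.ext' (fun _ => rfl) ?_
    rintro x y rfl h
    exact Category.comp_id _
  assoc f g h := by
    refine Hom.ext' (fun _ => rfl) ?_
    rintro x y rfl h
    exact Category.assoc _ _ _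

theorem hom_ext {F G : Fam I} {f g : F ⟶ G} (he : ∀ y, f.e y = g.e y)
    (hi : ∀ x y h h', f.iso x y h = g.iso x y h') : f = g := Hom.ext' he hi

@[simp] theorem id_e (F : Fam I) (x : F.N) : Hom.e (𝟙 F) x = x := rfl
@[simp] theorem id_iso (F : Fam I) (x y : F.N) (h) :
    Hom.iso (𝟙 F) x y h = eqToHom (congrArg F.col (Eq.symm h)) := rfl
@[simp] theorem comp_e {F G H : Fam I} (f : F ⟶ G) (g : G ⟶ H) (z : H.N) :
    Hom.e (f ≫ g) z = f.e (g.e z) := rfl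
theorem comp_iso {F G H : Fam I} (f : F ⟶ G) (g : G ⟶ H) (x : F.N) (z : H.N) (h) (y : G.N)
    (h₁ : f.e y = x) (h₂ : g.e z = y) :
    Hom.iso (f ≫ g) x z h = f.iso x y h₁ ≫ g.iso y z h₂ := by
  subst h₂; rfl

theorem e_congr {F G : Fam I} {f g : F ⟶ G} (h : f = g) (y : G.N) : f.e y = g.e y := by rw [h]
theorem iso_congr {F G : Fam I} {f g : F ⟶ G} (h : f = g) (x : F.N) (y : G.N) (hx) (hx') :
    f.iso x y hx = g.iso x y hx' := by subst h; rfl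
theorem iso_eqToHom {F G : Fam I} (f : F ⟶ G) {x x' : F.N} {y y' : G.N} (h : f.e y = x)
    (hx : x = x') (hy : y = y') (h' : f.e y' = x') :
    f.iso x' y' h' = eqToHom (congrArg F.col hx.symm) ≫ f.iso x y h ≫
      eqToHom (congrArg G.col hy) := by
  subst hx hy; simp

theorem iso_left {F G : Fam I} (f : F ⟶ G) {x : F.N} {y : G.N} (h : f.e y = x) :
    f.iso x y h = eqToHom (congrArg F.col h.symm) ≫ f.iso (f.e y) y rfl := by
  subst h; simp

/-- The index bijection of a morphism of families, as an equivalence. -/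
noncomputable def Hom.equiv {F G : Fam I} (f : Hom F G) : G.N ≃ F.N := Equiv.ofBijective f.e f.bij

@[simp] theorem Hom.e_symm {F G : Fam I} (f : Hom F G) (x : F.N) : f.e (f.equiv.symm x) = x :=
  f.equiv.apply_symm_apply x
@[simp] theorem Hom.symm_e {F G : Fam I} (f : Hom F G) (y : G.N) : f.equiv.symm (f.e y) = y :=
  f.equiv.symm_apply_apply y

noncomputable instance : Groupoid.{u} (Fam I) where
  inv f := ⟨f.equiv.symm, f.equiv.symm.bijective,
    fun y x h => Groupoid.inv (f.iso x y (by rw [← h, Hom.e_symm]))⟩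
  inv_comp f := by
    refine hom_ext (fun _ => by simp) ?_
    rintro x y h h'
    obtain rfl : y = x := h'
    rw [comp_iso _ _ _ _ _ (f.e y) (by simp) rfl]
    simp
  comp_inv f := by
    refine hom_ext (fun _ => by simp) ?_
    rintro x y h h'
    obtain rfl : y = x := h'
    rw [comp_iso _ _ _ _ _ (f.equiv.symm y) (by simp) rfl]
    simp

end Fam

/-- A finitary polynomial `I ↝ J` in groupoids: a groupoid `Op` of operations, the output colour
`tgt` of an operation, and the finite family `pm` of (input colours of) its parameters, all of them
functorial. In other words, it is a diagram `I ← E → Op → J` of groupoids in which the homotopy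
fibres of `E → Op` are finite sets: the fibre over `c` is the index set of `pm c`, and the map
`E → I` is the colouring of the families. -/
structure FinPoly (I J : Type u) [Groupoid.{u} I] [Groupoid.{u} J] where
  Op : Type u
  [grpd : Groupoid.{u} Op]
  pm : Op ⥤ Fam I
  tgt : Op ⥤ J

namespace FinPoly

attribute [instance] FinPoly.grpd

variable {I J K L : Type u} [Groupoid.{u} I] [Groupoid.{u} J] [Groupoid.{u} K] [Groupoid.{u} L]

/-- An equivalence of polynomials: an equivalence on operations, compatible up to natural
isomorphism with parameters and with output colours (the components of a natural transformation
between functors valued in a groupoid are automatically invertible). -/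
structure Eqv (P Q : FinPoly I J) where
  op : P.Op ⥤ Q.Op
  isEquivalence : op.IsEquivalence
  pm : ∀ c, P.pm.obj c ⟶ Q.pm.obj (op.obj c)
  pm_nat : ∀ {c c'} (f : c ⟶ c'), P.pm.map f ≫ pm c' = pm c ≫ Q.pm.map (op.map f)
  tgt : ∀ c, P.tgt.obj c ⟶ Q.tgt.obj (op.obj c)
  tgt_nat : ∀ {c c'} (f : c ⟶ c'), P.tgt.map f ≫ tgt c' = tgt c ≫ Q.tgt.map (op.map f)

namespace Eqv

variable {P Q R : FinPoly I J}

/-- Identifications between equivalences of polynomials. -/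
@[ext]
structure Hom (φ ψ : Eqv P Q) where
  app : φ.op ⟶ ψ.op
  pm : ∀ c, φ.pm c ≫ Q.pm.map (app.app c) = ψ.pm c
  tgt : ∀ c, φ.tgt c ≫ Q.tgt.map (app.app c) = ψ.tgt c

instance : Category (Eqv P Q) where
  Hom := Hom
  id φ := ⟨𝟙 _, by simp, by simp⟩
  comp f g := ⟨f.app ≫ g.app,
    fun c => by rw [NatTrans.comp_app, Functor.map_comp, reassoc_of% f.pm c, g.pm c],
    fun c => by rw [NatTrans.comp_app, Functor.map_comp, reassoc_of% f.tgt c, g.tgt c]⟩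
  id_comp f := Hom.ext (Category.id_comp _)
  comp_id f := Hom.ext (Category.comp_id _)
  assoc f g h := Hom.ext (Category.assoc _ _ _)

noncomputable instance : Groupoid (Eqv P Q) where
  inv {φ ψ} f :=
    { app :=
        { app := fun c => inv (f.app.app c)
          naturality := fun c c' g => by
            rw [IsIso.comp_inv_eq, Category.assoc, f.app.naturality, IsIso.inv_hom_id_assoc] }
      pm := fun c => by rw [Functor.map_inv, IsIso.comp_inv_eq, f.pm]
      tgt := fun c => by rw [Functor.map_inv, IsIso.comp_inv_eq, f.tgt] }
  inv_comp f := Hom.ext (by ext c; exact IsIso.inv_hom_id _)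
  comp_inv f := Hom.ext (by ext c; exact IsIso.hom_inv_id _)

/-- Two equivalences are identified when there is an identification between them. -/
instance setoid (P Q : FinPoly I J) : Setoid (Eqv P Q) where
  r φ ψ := Nonempty (φ ⟶ ψ)
  iseqv := ⟨fun φ => ⟨𝟙 φ⟩, fun ⟨f⟩ => ⟨Groupoid.inv f⟩, fun ⟨f⟩ ⟨g⟩ => ⟨f ≫ g⟩⟩

@[reducible] protected def refl (P : FinPoly I J) : Eqv P P where
  op := 𝟭 _
  isEquivalence := inferInstance
  pm c := 𝟙 (P.pm.obj c)
  pm_nat := by simp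
  tgt c := 𝟙 (P.tgt.obj c)
  tgt_nat := by simp

@[reducible] protected def trans (φ : Eqv P Q) (ψ : Eqv Q R) : Eqv P R where
  op :=
    { obj := fun c => ψ.op.obj (φ.op.obj c)
      map := fun f => ψ.op.map (φ.op.map f) }
  isEquivalence :=
    @Functor.isEquivalence_trans _ _ _ _ _ _ _ _ φ.isEquivalence ψ.isEquivalence
  pm c := φ.pm c ≫ ψ.pm (φ.op.obj c)
  pm_nat f := by rw [reassoc_of% φ.pm_nat f, Category.assoc, ψ.pm_nat]
  tgt c := φ.tgt c ≫ ψ.tgt (φ.op.obj c)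
  tgt_nat f := by rw [reassoc_of% φ.tgt_nat f, Category.assoc, ψ.tgt_nat]

theorem equiv_mk {φ ψ : Eqv P Q} (k : ∀ c, φ.op.obj c ⟶ ψ.op.obj c)
    (hn : ∀ c c' (f : c ⟶ c'), φ.op.map f ≫ k c' = k c ≫ ψ.op.map f)
    (hp : ∀ c, φ.pm c ≫ Q.pm.map (k c) = ψ.pm c)
    (ht : ∀ c, φ.tgt c ≫ Q.tgt.map (k c) = ψ.tgt c) : φ ≈ ψ :=
  ⟨⟨⟨k, fun c c' f => hn c c' f⟩, hp, ht⟩⟩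

@[simp] theorem refl_obj (c : P.Op) : (Eqv.refl P).op.obj c = c := rfl
@[simp] theorem refl_map {c c' : P.Op} (f : c ⟶ c') : (Eqv.refl P).op.map f = f := rfl
@[simp] theorem refl_pm (c : P.Op) : (Eqv.refl P).pm c = 𝟙 (P.pm.obj c) := rfl
@[simp] theorem refl_tgt (c : P.Op) : (Eqv.refl P).tgt c = 𝟙 (P.tgt.obj c) := rfl
@[simp] theorem trans_obj (φ : Eqv P Q) (ψ : Eqv Q R) (c : P.Op) :
    (φ.trans ψ).op.obj c = ψ.op.obj (φ.op.obj c) := rfl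
@[simp] theorem trans_map (φ : Eqv P Q) (ψ : Eqv Q R) {c c' : P.Op} (f : c ⟶ c') :
    (φ.trans ψ).op.map f = ψ.op.map (φ.op.map f) := rfl
@[simp] theorem trans_pm (φ : Eqv P Q) (ψ : Eqv Q R) (c : P.Op) :
    (φ.trans ψ).pm c = φ.pm c ≫ ψ.pm (φ.op.obj c) := rfl
@[simp] theorem trans_tgt (φ : Eqv P Q) (ψ : Eqv Q R) (c : P.Op) :
    (φ.trans ψ).tgt c = φ.tgt c ≫ ψ.tgt (φ.op.obj c) := rfl

end Eqv

/-- The groupoid of finitary polynomials `I ↝ J`: its morphisms are the equivalences of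
polynomials, up to identification. -/
instance : Category.{u} (FinPoly I J) where
  Hom P Q := Quotient (Eqv.setoid P Q)
  id P := ⟦Eqv.refl P⟧
  comp := Quotient.map₂ Eqv.trans (by
    rintro φ φ' ⟨f⟩ ψ ψ' ⟨g⟩
    refine Eqv.equiv_mk (fun c => (ψ.op.map (f.app.app c) ≫ g.app.app (φ'.op.obj c) :
      ψ.op.obj (φ.op.obj c) ⟶ ψ'.op.obj (φ'.op.obj c))) (fun c c' h => ?_) (fun c => ?_)
      (fun c => ?_)
    · change ψ.op.map (φ.op.map h) ≫ _ ≫ _ = (_ ≫ _) ≫ ψ'.op.map (φ'.op.map h)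
      rw [Category.assoc, ← g.app.naturality, ← ψ.op.map_comp_assoc, f.app.naturality,
        ψ.op.map_comp_assoc]
    · change (φ.pm c ≫ ψ.pm (φ.op.obj c)) ≫ _ = φ'.pm c ≫ ψ'.pm (φ'.op.obj c)
      rw [← f.pm, ← g.pm, Functor.map_comp]
      simp only [Category.assoc]
      rw [reassoc_of% ψ.pm_nat]
    · change (φ.tgt c ≫ ψ.tgt (φ.op.obj c)) ≫ _ = φ'.tgt c ≫ ψ'.tgt (φ'.op.obj c)
      rw [← f.tgt, ← g.tgt, Functor.map_comp]
      simp only [Category.assoc]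
      rw [reassoc_of% ψ.tgt_nat])
  id_comp := by
    rintro P Q ⟨φ⟩
    exact Quotient.sound (Eqv.equiv_mk (fun c => 𝟙 (φ.op.obj c))
      (by intros; simp) (by intros; simp) (by intros; simp))
  comp_id := by
    rintro P Q ⟨φ⟩
    exact Quotient.sound (Eqv.equiv_mk (fun c => 𝟙 (φ.op.obj c))
      (by intros; simp) (by intros; simp) (by intros; simp))
  assoc := by
    rintro P Q R S ⟨φ⟩ ⟨ψ⟩ ⟨χ⟩
    exact Quotient.sound (Eqv.equiv_mk (fun c => 𝟙 (χ.op.obj (ψ.op.obj (φ.op.obj c))))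
      (by intros; simp) (by intros; simp) (by intros; simp))


/-- The finite family `Σ x, A_{a x}` obtained by substitution. -/
@[reducible] def sigmaFam (N : Type u) [Finite N] (A : N → Fam I) : Fam I :=
  @Fam.mk I (Σ x : N, (A x).N) (by have := fun x => (A x).fin; infer_instance)
    (fun z => (A z.1).col z.2)

/-- An operation of the composite of `P : I ↝ J` and `Q : J ↝ K`: an operation of `Q`, together
with an operation of `P` for each of its parameters, of the right output colour. -/
structure CompOp (P : FinPoly I J) (Q : FinPoly J K) where
  op : Q.Op
  arg : (Q.pm.obj op).N → P.Op
  col : ∀ x, P.tgt.obj (arg x) ⟶ (Q.pm.obj op).col x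

namespace CompOp

variable {P : FinPoly I J} {Q : FinPoly J K}

/-- An arrow between operations of the composite: an arrow `base` of operations of `Q`, and arrows
between the operations of `P` at corresponding parameters, compatible with the output colours. -/
structure Hom (X Y : CompOp P Q) where
  base : X.op ⟶ Y.op
  arg : ∀ x y, (Q.pm.map base).e y = x → (X.arg x ⟶ Y.arg y)
  comm : ∀ x y h, X.col x ≫ (Q.pm.map base).iso x y h = P.tgt.map (arg x y h) ≫ Y.col y

theorem Hom.ext' {X Y : CompOp P Q} {f g : Hom X Y} (ho : f.base = g.base)
    (ha : ∀ x y h h', f.arg x y h = g.arg x y h') : f = g := by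
  obtain ⟨o, a, c⟩ := f
  obtain ⟨o', a', c'⟩ := g
  obtain rfl : o = o' := ho
  congr
  funext x y h
  exact ha x y h h

theorem map_id_e (c : Q.Op) (y) : (Q.pm.map (𝟙 c)).e y = y :=
  Fam.e_congr (Q.pm.map_id c) y

theorem map_comp_e {c c' c'' : Q.Op} (f : c ⟶ c') (g : c' ⟶ c'') (y) :
    (Q.pm.map (f ≫ g)).e y = (Q.pm.map f).e ((Q.pm.map g).e y) :=
  Fam.e_congr (Q.pm.map_comp f g) y

theorem map_id_iso (c : Q.Op) (x y h h') :
    (Q.pm.map (𝟙 c)).iso x y h = eqToHom (congrArg (Q.pm.obj c).col h') :=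
  (Fam.iso_congr (Q.pm.map_id c) x y h h'.symm)

theorem map_comp_iso {c c' c'' : Q.Op} (f : c ⟶ c') (g : c' ⟶ c'') (x y z h h₁ h₂) :
    (Q.pm.map (f ≫ g)).iso x z h = (Q.pm.map f).iso x y h₁ ≫ (Q.pm.map g).iso y z h₂ := by
  subst h₂
  exact Fam.iso_congr (Q.pm.map_comp f g) x z h h₁

theorem tgt_eqToHom (X : CompOp P Q) {x y} (h : x = y) :
    P.tgt.map (eqToHom (congrArg X.arg h)) ≫ X.col y =
      X.col x ≫ eqToHom (congrArg (Q.pm.obj X.op).col h) := by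
  subst h; simp

theorem Hom.arg_congr {X Y : CompOp P Q} (f : Hom X Y) {x x' y y'} (hx : x = x') (hy : y = y')
    (h h') : f.arg x y h = eqToHom (congrArg X.arg hx) ≫ f.arg x' y' h' ≫
      eqToHom (congrArg Y.arg hy.symm) := by
  subst hx hy; simp

/-- The arrow `a x ⟶ a y` induced by an equality of indices. -/
abbrev reindex (X : CompOp P Q) {x y} (h : x = y) : X.arg x ⟶ X.arg y :=
  eqToHom (congrArg X.arg h)

instance : Category (CompOp P Q) where
  Hom := Hom
  id X := ⟨𝟙 _, fun x y h => X.reindex ((map_id_e _ _).symm.trans h).symm,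
    fun x y h => by
      rw [X.tgt_eqToHom ((map_id_e _ _).symm.trans h).symm,
        map_id_iso _ _ _ _ ((map_id_e _ _).symm.trans h).symm]⟩
  comp {X Y Z} f g := ⟨f.base ≫ g.base, fun x z h =>
      f.arg x ((Q.pm.map g.base).e z) ((map_comp_e _ _ _).symm.trans h) ≫ g.arg _ z rfl,
    fun x z h => by
      rw [map_comp_iso f.base g.base x _ z h ((map_comp_e _ _ _).symm.trans h) rfl,
        P.tgt.map_comp, Category.assoc, ← g.comm, ← reassoc_of% f.comm]⟩
  id_comp f := by
    refine Hom.ext' (Category.id_comp _) ?_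
    intro x y h h'
    subst h'
    simp
  comp_id {X Y} f := by
    refine Hom.ext' (Category.comp_id _) ?_
    intro x y h h'
    rw [f.arg_congr (x' := x) (y' := (Q.pm.map (𝟙 Y.op)).e y) rfl (map_id_e _ _).symm h'
      ((map_comp_e _ _ _).symm.trans h)]
    simp
  assoc {X Y Z W} f g k := by
    refine Hom.ext' (Category.assoc _ _ _) ?_
    intro x y h h'
    dsimp only
    rw [f.arg_congr (x' := x) rfl (map_comp_e g.base k.base y) _
      ((map_comp_e _ _ _).symm.trans ((map_comp_e _ _ _).symm.trans h)),
      g.arg_congr (map_comp_e g.base k.base y) rfl _ rfl]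
    simp

theorem hom_ext {X Y : CompOp P Q} {f g : X ⟶ Y} (ho : f.base = g.base)
    (ha : ∀ x y h h', f.arg x y h = g.arg x y h') : f = g := Hom.ext' ho ha

@[simp] theorem id_base (X : CompOp P Q) : Hom.base (𝟙 X) = 𝟙 X.op := rfl
theorem id_arg (X : CompOp P Q) (x y h h') : Hom.arg (𝟙 X) x y h = X.reindex h' := rfl
@[simp] theorem comp_base {X Y Z : CompOp P Q} (f : X ⟶ Y) (g : Y ⟶ Z) :
    Hom.base (f ≫ g) = f.base ≫ g.base := rfl
theorem comp_arg {X Y Z : CompOp P Q} (f : X ⟶ Y) (g : Y ⟶ Z) (x y z h h₁ h₂) :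
    Hom.arg (f ≫ g) x z h = f.arg x y h₁ ≫ g.arg y z h₂ := by
  subst h₂; rfl

theorem inv_e {c c' : Q.Op} (f : c ⟶ c') {x y} (h : (Q.pm.map (inv f)).e y = x) :
    (Q.pm.map f).e x = y := by
  rw [← h, ← map_comp_e]
  exact (Fam.e_congr (congrArg Q.pm.map (IsIso.hom_inv_id f)) y).trans (map_id_e _ _)

noncomputable instance : Groupoid (CompOp P Q) where
  inv {X Y} f := ⟨inv f.base, fun y x h => inv (f.arg x y (inv_e _ h)), fun y x h => by
    rw [P.tgt.map_inv, IsIso.eq_inv_comp, ← reassoc_of% f.comm,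
      ← map_comp_iso f.base (inv f.base) x y x
        (by rw [IsIso.hom_inv_id]; exact map_id_e _ _) (inv_e _ h) h]
    rw [Fam.iso_congr (congrArg Q.pm.map (IsIso.hom_inv_id f.base)) x x _ (map_id_e _ _),
      map_id_iso _ _ _ _ rfl]
    simp⟩
  inv_comp {X Y} f := hom_ext (IsIso.inv_hom_id f.base) fun x y h h' => by
    obtain rfl := (map_id_e _ _).symm.trans h'
    rw [comp_arg _ _ _ ((Q.pm.map f.base).e y) _ _
      (by rw [← map_comp_e, IsIso.inv_hom_id, map_id_e]) rfl]
    simp [id_arg _ _ _ _ rfl]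
  comp_inv {X Y} f := hom_ext (IsIso.hom_inv_id f.base) fun x y h h' => by
    obtain rfl := (map_id_e _ _).symm.trans h'
    rw [comp_arg _ _ _ ((Q.pm.map (inv f.base)).e y) _ _
      (by rw [← map_comp_e, IsIso.hom_inv_id, map_id_e]) rfl]
    simp [id_arg _ _ _ _ rfl]

end CompOp


section sigmaHom

variable {N N' N'' : Type u} {A : N → Fam I} {A' : N' → Fam I} {A'' : N'' → Fam I}

theorem sigma_aux {e : N' → N} (g : ∀ x y, e y = x → (A x ⟶ A' y)) {x : N} {w : (A x).N}
    {y : N'} {z : (A' y).N} (h : (⟨e y, (g _ y rfl).e z⟩ : Σ x, (A x).N) = ⟨x, w⟩) :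
    ∃ hx : e y = x, (g x y hx).e z = w := by
  obtain ⟨rfl, h⟩ := Sigma.mk.inj_iff.1 h
  exact ⟨rfl, eq_of_heq h⟩

theorem sigma_aux' {e : N' → N} (g : ∀ x y, e y = x → (A x ⟶ A' y)) {x : N} {w : (A x).N}
    {y : N'} {z : (A' y).N} (hx : e y = x) (h : (g x y hx).e z = w) :
    (⟨e y, (g _ y rfl).e z⟩ : Σ x, (A x).N) = ⟨x, w⟩ := by
  subst hx; rw [h]

variable [Finite N] [Finite N'] [Finite N'']

/-- Morphisms between substituted families. -/
@[reducible] def sigmaHom (e : N' → N) (he : Function.Bijective e)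
    (g : ∀ x y, e y = x → (A x ⟶ A' y)) : sigmaFam N A ⟶ sigmaFam N' A' where
  e z := ⟨e z.1, (g _ z.1 rfl).e z.2⟩
  bij := by
    constructor
    · rintro ⟨y, z⟩ ⟨y', z'⟩ h
      obtain ⟨hx, hz⟩ := sigma_aux g h
      obtain rfl := he.1 hx
      exact congrArg _ ((g _ _ rfl).bij.1 hz)
    · rintro ⟨x, w⟩
      obtain ⟨y, rfl⟩ := he.2 x
      obtain ⟨z, rfl⟩ := (g _ _ rfl).bij.2 w
      exact ⟨⟨y, z⟩, rfl⟩
  iso x y h := (g x.1 y.1 (sigma_aux g h).1).iso x.2 y.2 (sigma_aux g h).2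

theorem sigmaHom_congr {e e' : N' → N} {he : Function.Bijective e} {he' : Function.Bijective e'}
    {g : ∀ x y, e y = x → (A x ⟶ A' y)} {g' : ∀ x y, e' y = x → (A x ⟶ A' y)}
    (h : ∀ y, e y = e' y) (hg : ∀ x y h h', g x y h = g' x y h') :
    sigmaHom e he g = sigmaHom e' he' g' := by
  obtain rfl : e = e' := funext h
  obtain rfl : g = g' := by funext x y h; exact hg x y h h
  rfl

theorem sigmaHom_id {e : N → N} {he : Function.Bijective e} {g : ∀ x y, e y = x → (A x ⟶ A y)}
    (h : ∀ y, e y = y) (hg : ∀ x y h h', g x y h = eqToHom (congrArg A h')) :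
    sigmaHom e he g = 𝟙 (sigmaFam N A) := by
  obtain rfl : e = id := funext h
  refine Fam.hom_ext ?_ ?_
  · rintro ⟨x, w⟩
    exact sigma_aux' g rfl (Fam.e_congr (hg x x rfl rfl) w)
  · rintro ⟨x, w⟩ ⟨y, z⟩ h h'
    obtain ⟨rfl, rfl⟩ := Sigma.mk.inj_iff.1 h'
    exact Fam.iso_congr (hg _ _ rfl rfl) _ _ (sigma_aux g h).2 rfl

theorem sigmaHom_comp {e : N' → N} {he : Function.Bijective e}
    {g : ∀ x y, e y = x → (A x ⟶ A' y)} {e' : N'' → N'} {he' : Function.Bijective e'}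
    {g' : ∀ x y, e' y = x → (A' x ⟶ A'' y)} :
    sigmaHom e he g ≫ sigmaHom e' he' g' =
      sigmaHom (fun z => e (e' z)) (he.comp he') (fun x z h => g x (e' z) h ≫ g' _ z rfl) := rfl

theorem sigmaHom_sq {M : Type u} [Finite M] {B : M → Fam I}
    {e : N' → N} {he : Function.Bijective e}
    {g : ∀ x y, e y = x → (A x ⟶ A' y)} {e' : N'' → N'} {he' : Function.Bijective e'}
    {g' : ∀ x y, e' y = x → (A' x ⟶ A'' y)} {k : M → N} {hk : Function.Bijective k}
    {l : ∀ x y, k y = x → (A x ⟶ B y)} {k' : N'' → M} {hk' : Function.Bijective k'}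
    {l' : ∀ x y, k' y = x → (B x ⟶ A'' y)} (h : ∀ z, e (e' z) = k (k' z))
    (hg : ∀ x z h h', g x (e' z) h ≫ g' _ z rfl = l x (k' z) h' ≫ l' _ z rfl) :
    sigmaHom e he g ≫ sigmaHom e' he' g' = sigmaHom k hk l ≫ sigmaHom k' hk' l' :=
  sigmaHom_congr (he := he.comp he') (he' := hk.comp hk') h hg

theorem sigmaHom_tri {e : N' → N} {he : Function.Bijective e}
    {g : ∀ x y, e y = x → (A x ⟶ A' y)} {e' : N'' → N'} {he' : Function.Bijective e'}
    {g' : ∀ x y, e' y = x → (A' x ⟶ A'' y)} {k : N'' → N} {hk : Function.Bijective k}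
    {l : ∀ x y, k y = x → (A x ⟶ A'' y)} (h : ∀ z, e (e' z) = k z)
    (hg : ∀ x z h h', g x (e' z) h ≫ g' _ z rfl = l x z h') :
    sigmaHom e he g ≫ sigmaHom e' he' g' = sigmaHom k hk l :=
  sigmaHom_congr (he := he.comp he') h hg

/-- Change of index set. -/
@[reducible] def sigmaReindex (A : N → Fam I) (e : N' → N) (he : Function.Bijective e) :
    sigmaFam N A ⟶ sigmaFam N' (fun y => A (e y)) where
  e z := ⟨e z.1, z.2⟩
  bij := by
    constructor
    · rintro ⟨y, z⟩ ⟨y', z'⟩ h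
      obtain rfl := he.1 (congrArg Sigma.fst h)
      cases h; rfl
    · rintro ⟨x, w⟩
      obtain ⟨y, rfl⟩ := he.2 x
      exact ⟨⟨y, w⟩, rfl⟩
  iso _ _ h := eqToHom (congrArg (sigmaFam N A).col h.symm)

theorem sigmaReindex_eq (A : N → Fam I) (e : N' → N) (he : Function.Bijective e) :
    sigmaReindex A e he = sigmaHom e he fun _ _ h => eqToHom (congrArg A h.symm) := by
  refine Fam.hom_ext (fun _ => rfl) fun w v h h' => ?_
  obtain rfl := h
  rfl

/-- Change of each member of a family of families. -/
@[reducible] def sigmaMap {B : N → Fam I} (g : ∀ x, A x ⟶ B x) :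
    sigmaFam N A ⟶ sigmaFam N B where
  e z := ⟨z.1, (g z.1).e z.2⟩
  bij := by
    constructor
    · rintro ⟨y, z⟩ ⟨y', z'⟩ h
      obtain rfl : y = y' := congrArg Sigma.fst h
      exact congrArg _ ((g y).bij.1 (eq_of_heq (Sigma.mk.inj_iff.1 h).2))
    · rintro ⟨x, w⟩
      obtain ⟨z, rfl⟩ := (g x).bij.2 w
      exact ⟨⟨x, z⟩, rfl⟩
  iso _ v h := eqToHom (congrArg (sigmaFam N A).col h.symm) ≫ (g v.1).iso _ v.2 rfl

theorem sigmaMap_eq {B : N → Fam I} (g : ∀ x, A x ⟶ B x) :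
    sigmaMap g = sigmaHom (fun x => x) Function.bijective_id
      fun x y h => eqToHom (congrArg A h.symm) ≫ g y := by
  refine Fam.hom_ext (fun _ => rfl) fun w v h h' => ?_
  obtain rfl := h
  rfl

end sigmaHom

/-- The composite `P · Q` of polynomials. -/
@[reducible] noncomputable def comp (P : FinPoly I J) (Q : FinPoly J K) : FinPoly I K where
  Op := CompOp P Q
  pm :=
    { obj := fun X => sigmaFam (Q.pm.obj X.op).N fun x => P.pm.obj (X.arg x)
      map := fun f => sigmaHom (Q.pm.map f.base).e (Q.pm.map f.base).bij
        fun x y h => P.pm.map (f.arg x y h)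
      map_id := fun X => sigmaHom_id (CompOp.map_id_e _) fun x y h h' => by
        rw [CompOp.id_arg X x y h h', eqToHom_map]
      map_comp := fun f g => by
        rw [sigmaHom_comp]
        refine sigmaHom_congr (CompOp.map_comp_e _ _) fun x y h h' => ?_
        rw [← P.pm.map_comp, ← CompOp.comp_arg f g] }
  tgt :=
    { obj := fun X => Q.tgt.obj X.op
      map := fun f => Q.tgt.map f.base
      map_id := fun X => Q.tgt.map_id _
      map_comp := fun f g => Q.tgt.map_comp _ _ }

theorem comp_map (P : FinPoly I J) (Q : FinPoly J K) {X Y : CompOp P Q} (f : X ⟶ Y) :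
    (comp P Q).pm.map f = sigmaHom (Q.pm.map f.base).e (Q.pm.map f.base).bij
        fun x y h => P.pm.map (f.arg x y h) := rfl

theorem comp_e_aux {P : FinPoly I J} {Q : FinPoly J K} {X Y : CompOp P Q} (f : X ⟶ Y) {z w}
    (h : ((comp P Q).pm.map f).e w = z) : ∃ hx : (Q.pm.map f.base).e w.1 = z.1,
      (P.pm.map (f.arg z.1 w.1 hx)).e w.2 = z.2 :=
  sigma_aux (fun x y h => P.pm.map (f.arg x y h)) h

theorem comp_e_aux' {P : FinPoly I J} {Q : FinPoly J K} {X Y : CompOp P Q} (f : X ⟶ Y) {x y w z}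
    (hx : (Q.pm.map f.base).e y = x) (h : (P.pm.map (f.arg x y hx)).e z = w) :
    ((comp P Q).pm.map f).e ⟨y, z⟩ = ⟨x, w⟩ :=
  sigma_aux' (fun x y h => P.pm.map (f.arg x y h)) hx h

/-- The one-element family at `i`. -/
@[reducible] def single (i : I) : Fam I := ⟨PUnit, fun _ => i⟩

/-- The polynomial `I ↝ A` induced by a functor `F : A ⥤ I`: it has one operation for each `a`,
with output colour `a` and one parameter, of colour `F a`. -/
@[reducible] def ofFunctor {A : Type u} [Groupoid.{u} A] (F : A ⥤ I) : FinPoly I A where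
  Op := A
  pm :=
    { obj := fun a => single (F.obj a)
      map := fun f => ⟨fun x => x, Function.bijective_id, fun _ _ _ => F.map f⟩
      map_id := fun a => Fam.hom_ext (fun _ => rfl) fun _ _ _ _ => F.map_id a
      map_comp := fun f g => Fam.hom_ext (fun _ => rfl) fun _ _ _ _ => F.map_comp f g }
  tgt := 𝟭 A

/-- The identity polynomial. -/
@[reducible] def idPoly (I : Type u) [Groupoid.{u} I] : FinPoly I I := ofFunctor (𝟭 I)


namespace CompOp

variable {P : FinPoly I J} {Q : FinPoly J K}

theorem reindex_arg {X Y : CompOp P Q} (f : X ⟶ Y) {x x' y y'} (hx : x' = x) (hy : y = y')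
    (h h') : X.reindex hx ≫ f.arg x y h ≫ Y.reindex hy = f.arg x' y' h' := by
  subst hx hy; simp

theorem reindex_arg_left {X Y : CompOp P Q} (f : X ⟶ Y) {x x' y} (hx : x' = x)
    (h h') : X.reindex hx ≫ f.arg x y h = f.arg x' y h' := by
  subst hx; simp

theorem arg_reindex {X Y : CompOp P Q} (f : X ⟶ Y) {x y y'} (hy : y = y')
    (h h') : f.arg x y h ≫ Y.reindex hy = f.arg x y' h' := by
  subst hy; simp

/-- Morphisms which are the identity on the underlying operation of `Q`. -/
@[reducible] def mkHom {c : Q.Op} {a a' : (Q.pm.obj c).N → P.Op}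
    {k : ∀ x, P.tgt.obj (a x) ⟶ (Q.pm.obj c).col x}
    {k' : ∀ x, P.tgt.obj (a' x) ⟶ (Q.pm.obj c).col x}
    (g : ∀ x, a x ⟶ a' x) (hg : ∀ x, k x = P.tgt.map (g x) ≫ k' x) :
    (⟨c, a, k⟩ : CompOp P Q) ⟶ ⟨c, a', k'⟩ where
  base := 𝟙 c
  arg x y h := (⟨c, a, k⟩ : CompOp P Q).reindex ((map_id_e _ _).symm.trans h).symm ≫ g y
  comm x y h := by
    rw [P.tgt.map_comp, Category.assoc, ← hg y,
      tgt_eqToHom (⟨c, a, k⟩ : CompOp P Q) ((map_id_e _ _).symm.trans h).symm,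
      map_id_iso _ _ _ _ ((map_id_e _ _).symm.trans h).symm]

end CompOp

theorem sigmaMap_eq' {P : FinPoly I J} {Q : FinPoly J K} (X : CompOp P Q)
    {B : (Q.pm.obj X.op).N → Fam I} (g : ∀ x, P.pm.obj (X.arg x) ⟶ B x) :
    sigmaMap g = sigmaHom (fun x => x) Function.bijective_id
      fun _ y h => P.pm.map (X.reindex h.symm) ≫ g y := by
  simpa only [eqToHom_map] using sigmaMap_eq g

theorem sigmaReindex_eq' {P : FinPoly I J} {Q : FinPoly J K} (X : CompOp P Q)
    {N : Type u} [Finite N] (e : N → (Q.pm.obj X.op).N) (he : Function.Bijective e) :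
    sigmaReindex (fun x => P.pm.obj (X.arg x)) e he =
      sigmaHom e he fun _ _ h => P.pm.map (X.reindex h.symm) := by
  simpa only [eqToHom_map] using sigmaReindex_eq (fun x => P.pm.obj (X.arg x)) e he

/-- Whiskering an equivalence `P ≃ P'` with `Q`. -/
@[reducible] noncomputable def whiskerRightOp {P P' : FinPoly I J} (φ : Eqv P P')
    (Q : FinPoly J K) : CompOp P Q ⥤ CompOp P' Q where
  obj X := ⟨X.op, fun x => φ.op.obj (X.arg x), fun x => inv (φ.tgt (X.arg x)) ≫ X.col x⟩
  map f := ⟨f.base, fun x y h => φ.op.map (f.arg x y h), fun x y h => by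
    rw [Category.assoc, f.comm, IsIso.inv_comp_eq, ← reassoc_of% φ.tgt_nat]
    simp⟩
  map_id X := CompOp.hom_ext rfl fun x y h h' => by
    obtain rfl := (CompOp.map_id_e _ _).symm.trans h'
    rw [CompOp.id_arg _ _ _ _ rfl]
    dsimp only
    rw [CompOp.id_arg _ _ _ _ rfl]
    simp
  map_comp f g := CompOp.hom_ext rfl fun x y h h' => by
    exact φ.op.map_comp _ _

@[reducible] noncomputable def whiskerRight {P P' : FinPoly I J} (φ : Eqv P P')
    (Q : FinPoly J K) : Eqv (comp P Q) (comp P' Q) where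
  op := whiskerRightOp φ Q
  isEquivalence := by
    have := φ.isEquivalence
    refine { faithful := ⟨?_⟩, full := ⟨?_⟩, essSurj := ⟨?_⟩ }
    · intro X Y f g h
      have hb : f.base = g.base := by have := congrArg CompOp.Hom.base h; exact this
      refine CompOp.hom_ext hb fun x y h₁ h₂ => φ.op.map_injective ?_
      have : ∀ (k k' : (whiskerRightOp φ Q).obj X ⟶ (whiskerRightOp φ Q).obj Y), k = k' →
          ∀ x y h₁ h₂, k.arg x y h₁ = k'.arg x y h₂ := by
        rintro k _ rfl x y h₁ h₂; rfl
      exact this _ _ h x y h₁ h₂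
    · intro X Y k
      refine ⟨⟨k.base, fun x y h => φ.op.preimage (k.arg x y h), fun x y h => ?_⟩, ?_⟩
      · have h₁ := k.comm x y h
        have h₂ := φ.tgt_nat (φ.op.preimage (k.arg x y h))
        rw [φ.op.map_preimage] at h₂
        dsimp only at h₁
        rw [Category.assoc, IsIso.inv_comp_eq, ← reassoc_of% h₂] at h₁
        simpa using h₁
      · exact CompOp.hom_ext rfl fun x y h h' => φ.op.map_preimage _
    · intro Z
      refine ⟨⟨Z.op, fun x => φ.op.objPreimage (Z.arg x), fun x =>
        φ.tgt _ ≫ P'.tgt.map (φ.op.objObjPreimageIso (Z.arg x)).hom ≫ Z.col x⟩,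
        ⟨(Groupoid.isoEquivHom _ _).symm
          (CompOp.mkHom (fun x => (φ.op.objObjPreimageIso (Z.arg x)).hom) fun x => ?_)⟩⟩
      simp
  pm X := sigmaMap fun x => φ.pm (X.arg x)
  pm_nat {X Y} f := by
    rw [comp_map, comp_map, sigmaMap_eq' X (fun x => φ.pm (X.arg x)), sigmaMap_eq' Y (fun x => φ.pm (Y.arg x))]
    refine sigmaHom_sq (fun _ => rfl) fun x y h h' => ?_
    rw [Category.assoc, ← φ.pm_nat, ← P.pm.map_comp_assoc, ← P.pm.map_comp_assoc,
      CompOp.reindex_arg_left f _ _ h, CompOp.arg_reindex f _ _ h]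
  tgt X := 𝟙 (Q.tgt.obj X.op)
  tgt_nat f := by simp

theorem CompOp.arg_congr {P : FinPoly I J} {Q : FinPoly J K} {X Y : CompOp P Q} {f g : X ⟶ Y}
    (h : f = g) (x y h₁ h₂) : f.arg x y h₁ = g.arg x y h₂ := by
  subst h; rfl

@[reducible] noncomputable def whiskerLeftOp (P : FinPoly I J) {Q Q' : FinPoly J K}
    (φ : Eqv Q Q') : CompOp P Q ⥤ CompOp P Q' where
  obj X := ⟨φ.op.obj X.op, fun y => X.arg ((φ.pm X.op).e y),
    fun y => X.col _ ≫ (φ.pm X.op).iso _ y rfl⟩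
  map {X Y} f := ⟨φ.op.map f.base, fun x y h =>
      f.arg ((φ.pm X.op).e x) ((φ.pm Y.op).e y)
        ((Fam.e_congr (φ.pm_nat f.base) y).trans (congrArg (φ.pm X.op).e h)),
    fun x y h => by
      rw [← reassoc_of% f.comm, Category.assoc]
      congr 1
      rw [← Fam.comp_iso (φ.pm X.op) (Q'.pm.map (φ.op.map f.base)) _ y
        (congrArg (φ.pm X.op).e h) x rfl h, ← Fam.comp_iso (Q.pm.map f.base) (φ.pm Y.op) _ y
        ((Fam.e_congr (φ.pm_nat f.base) y).trans (congrArg (φ.pm X.op).e h))]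
      exact (Fam.iso_congr (φ.pm_nat f.base) _ y _ _).symm⟩
  map_id X := CompOp.hom_ext (φ.op.map_id _) fun x y h h' =>
    CompOp.id_arg _ _ _ ((Fam.e_congr (φ.pm_nat (𝟙 X : X ⟶ X).base) y).trans (congrArg (φ.pm X.op).e h))
      (congrArg _ ((CompOp.map_id_e _ _).symm.trans h').symm)
  map_comp {X Y Z} f g := CompOp.hom_ext (φ.op.map_comp _ _) fun x y h h' => by
    rw [CompOp.comp_arg _ _ x _ y h' ((CompOp.map_comp_e _ _ _).symm.trans h') rfl]
    exact CompOp.comp_arg f g _ _ _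
      ((Fam.e_congr (φ.pm_nat (f ≫ g).base) y).trans (congrArg (φ.pm X.op).e h)) _ _

@[reducible] noncomputable def whiskerLeft (P : FinPoly I J) {Q Q' : FinPoly J K}
    (φ : Eqv Q Q') : Eqv (comp P Q) (comp P Q') where
  op := whiskerLeftOp P φ
  isEquivalence := by
    have := φ.isEquivalence
    refine { faithful := ⟨?_⟩, full := ⟨?_⟩, essSurj := ⟨?_⟩ }
    · intro X Y f g h
      have hb : f.base = g.base := φ.op.map_injective (by have := congrArg CompOp.Hom.base h; exact this)
      refine CompOp.hom_ext hb fun x y h₁ h₂ => ?_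
      obtain ⟨x, rfl⟩ := (φ.pm X.op).bij.2 x
      obtain ⟨y, rfl⟩ := (φ.pm Y.op).bij.2 y
      exact CompOp.arg_congr h x y ((φ.pm X.op).bij.1
        ((Fam.e_congr (φ.pm_nat f.base) y).symm.trans h₁)) ((φ.pm X.op).bij.1
        ((Fam.e_congr (φ.pm_nat g.base) y).symm.trans h₂))
    · intro X Y k
      let b := φ.op.preimage k.base
      have hb : φ.op.map b = k.base := φ.op.map_preimage _
      have nat : Q.pm.map b ≫ φ.pm Y.op = φ.pm X.op ≫ Q'.pm.map k.base := by
        rw [φ.pm_nat, hb]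
      have key : ∀ x y, (Q.pm.map b).e y = x → (Q'.pm.map k.base).e ((φ.pm Y.op).equiv.symm y) =
          (φ.pm X.op).equiv.symm x := fun x y h => by
        refine (φ.pm X.op).bij.1 ?_
        rw [Fam.Hom.e_symm, ← h]
        exact (Fam.e_congr nat _).symm.trans (congrArg _ (Fam.Hom.e_symm _ _))
      have harg : ∀ x y h h', X.reindex ((φ.pm X.op).e_symm ((φ.pm X.op).e x)).symm ≫
          k.arg ((φ.pm X.op).equiv.symm ((φ.pm X.op).e x))
            ((φ.pm Y.op).equiv.symm ((φ.pm Y.op).e y)) h ≫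
          Y.reindex ((φ.pm Y.op).e_symm ((φ.pm Y.op).e y)) = k.arg x y h' := fun x y h h' =>
        CompOp.reindex_arg k ((φ.pm X.op).symm_e x).symm ((φ.pm Y.op).symm_e y) _ _
      refine ⟨⟨b, fun x y h => X.reindex ((φ.pm X.op).e_symm x).symm ≫
        k.arg ((φ.pm X.op).equiv.symm x) ((φ.pm Y.op).equiv.symm y) (key x y h) ≫
          Y.reindex ((φ.pm Y.op).e_symm y), fun x y h => ?_⟩, ?_⟩
      · obtain ⟨x, rfl⟩ := (φ.pm X.op).bij.2 x
        obtain ⟨y, rfl⟩ := (φ.pm Y.op).bij.2 y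
        have h' : (Q'.pm.map k.base).e y = x :=
          (φ.pm X.op).bij.1 ((Fam.e_congr nat y).symm.trans h)
        rw [harg x y _ h', ← cancel_mono ((φ.pm Y.op).iso _ y rfl), Category.assoc, Category.assoc,
          ← k.comm x y h', Category.assoc, ← Fam.comp_iso (Q.pm.map b) (φ.pm Y.op) _ y h _ h rfl,
          ← Fam.comp_iso (φ.pm X.op) (Q'.pm.map k.base) _ y
            (congrArg (φ.pm X.op).e h') x rfl h']
        exact congrArg _ (Fam.iso_congr nat _ y _ _)
      · exact CompOp.hom_ext hb fun x y h h' => harg x y _ h'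
    · intro Z
      let c := φ.op.objPreimage Z.op
      let i : φ.op.obj c ≅ Z.op := φ.op.objObjPreimageIso Z.op
      let τ : Q.pm.obj c ⟶ Q'.pm.obj Z.op := φ.pm c ≫ Q'.pm.map i.hom
      let X : CompOp P Q := ⟨c, fun x => Z.arg (τ.equiv.symm x), fun x =>
        Z.col _ ≫ inv (τ.iso x (τ.equiv.symm x) (τ.e_symm x))⟩
      refine ⟨X, ⟨(Groupoid.isoEquivHom _ _).symm ⟨i.hom, fun x y h =>
        Z.reindex (x := τ.equiv.symm ((φ.pm c).e x)) (y := y) ?_, fun x y h => ?_⟩⟩⟩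
      · rw [← h]; exact τ.symm_e y
      · have hy : τ.equiv.symm ((φ.pm c).e x) = y := by rw [← h]; exact τ.symm_e y
        have ht : τ.e y = (φ.pm c).e x := congrArg (φ.pm c).e h
        rw [Z.tgt_eqToHom hy, Category.assoc, Category.assoc]
        congr 1
        rw [IsIso.inv_comp_eq, ← Fam.comp_iso (φ.pm c) (Q'.pm.map i.hom) _ y ht x rfl h]
        have := Fam.iso_eqToHom τ (τ.e_symm ((φ.pm c).e x)) rfl hy ht
        simpa using this
  pm X := sigmaReindex (fun x => P.pm.obj (X.arg x)) (φ.pm X.op).e (φ.pm X.op).bij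
  pm_nat {X Y} f := by
    rw [comp_map, comp_map, sigmaReindex_eq', sigmaReindex_eq']
    refine sigmaHom_sq (Fam.e_congr (φ.pm_nat f.base)) fun x y h h' => ?_
    rw [← P.pm.map_comp, ← P.pm.map_comp,
      CompOp.reindex_arg_left f _ _ ((Fam.e_congr (φ.pm_nat f.base) y).trans h'), CompOp.arg_reindex f _ _ h]
  tgt X := φ.tgt X.op
  tgt_nat f := φ.tgt_nat f.base

theorem whiskerRight_pm {P P' : FinPoly I J} (φ : Eqv P P') (Q : FinPoly J K) (X : CompOp P Q) :
    (whiskerRight φ Q).pm X = sigmaHom (fun x => x) Function.bijective_id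
      fun _ y h => P.pm.map (X.reindex h.symm) ≫ φ.pm (X.arg y) :=
  sigmaMap_eq' X (fun x => φ.pm (X.arg x))

theorem whiskerLeft_pm (P : FinPoly I J) {Q Q' : FinPoly J K} (φ : Eqv Q Q') (X : CompOp P Q) :
    (whiskerLeft P φ).pm X =
      sigmaHom (φ.pm X.op).e (φ.pm X.op).bij fun _ _ h => P.pm.map (X.reindex h.symm) :=
  sigmaReindex_eq' _ _ _

section symm

variable {P Q : FinPoly I J} (φ : Eqv P Q)

instance : φ.op.IsEquivalence := φ.isEquivalence

noncomputable abbrev Eqv.counit (c : Q.Op) : φ.op.obj (φ.op.inv.obj c) ⟶ c :=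
  φ.op.asEquivalence.counit.app c

noncomputable abbrev Eqv.unitInv (c : P.Op) : φ.op.inv.obj (φ.op.obj c) ⟶ c :=
  φ.op.asEquivalence.unitInv.app c

theorem Eqv.counit_nat {c c' : Q.Op} (f : c ⟶ c') :
    φ.op.map (φ.op.inv.map f) ≫ φ.counit c' = φ.counit c ≫ f :=
  φ.op.asEquivalence.counit.naturality f

theorem Eqv.unitInv_nat {c c' : P.Op} (f : c ⟶ c') :
    φ.op.inv.map (φ.op.map f) ≫ φ.unitInv c' = φ.unitInv c ≫ f :=
  φ.op.asEquivalence.unitInv.naturality f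

theorem Eqv.map_unitInv (c : P.Op) : φ.op.map (φ.unitInv c) = φ.counit (φ.op.obj c) := by
  let u : c ⟶ φ.op.inv.obj (φ.op.obj c) := φ.op.asEquivalence.unit.app c
  have h : φ.op.map u ≫ φ.counit (φ.op.obj c) = 𝟙 _ :=
    φ.op.asEquivalence.functor_unitIso_comp c
  have h' : φ.op.map u ≫ φ.op.map (φ.unitInv c) = 𝟙 _ := by
    rw [← φ.op.map_comp, ← φ.op.map_id]
    exact congrArg _ (φ.op.asEquivalence.unitIso.hom_inv_id_app c)
  exact (cancel_epi (φ.op.map u)).1 (h'.trans h.symm)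

/-- Every equivalence of polynomials has an inverse. -/
@[reducible] noncomputable def Eqv.symm : Eqv Q P where
  op := φ.op.inv
  isEquivalence := inferInstance
  pm c := inv (φ.pm (φ.op.inv.obj c) ≫ Q.pm.map (φ.counit c))
  pm_nat {c c'} f := by
    rw [IsIso.comp_inv_eq, Category.assoc, IsIso.eq_inv_comp, Category.assoc, ← Q.pm.map_comp,
      ← φ.counit_nat, reassoc_of% φ.pm_nat, Q.pm.map_comp]
  tgt c := inv (φ.tgt (φ.op.inv.obj c) ≫ Q.tgt.map (φ.counit c))
  tgt_nat {c c'} f := by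
    rw [IsIso.comp_inv_eq, Category.assoc, IsIso.eq_inv_comp, Category.assoc, ← Q.tgt.map_comp,
      ← φ.counit_nat, reassoc_of% φ.tgt_nat, Q.tgt.map_comp]

theorem Eqv.trans_symm : φ.trans φ.symm ≈ Eqv.refl P := by
  refine Eqv.equiv_mk (fun c => φ.unitInv c) (fun c c' f => φ.unitInv_nat f) (fun c => ?_)
    (fun c => ?_)
  · have h : φ.pm (φ.op.inv.obj (φ.op.obj c)) ≫ Q.pm.map (φ.counit (φ.op.obj c)) =
        P.pm.map (φ.unitInv c) ≫ φ.pm c := by rw [φ.pm_nat, φ.map_unitInv]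
    change (φ.pm c ≫ inv (φ.pm (φ.op.inv.obj (φ.op.obj c)) ≫
      Q.pm.map (φ.counit (φ.op.obj c)))) ≫ P.pm.map (φ.unitInv c) = 𝟙 _
    simp only [h, IsIso.inv_comp, Category.assoc, IsIso.inv_hom_id, IsIso.hom_inv_id,
      Category.comp_id]
  · have h : φ.tgt (φ.op.inv.obj (φ.op.obj c)) ≫ Q.tgt.map (φ.counit (φ.op.obj c)) =
        P.tgt.map (φ.unitInv c) ≫ φ.tgt c := by rw [φ.tgt_nat, φ.map_unitInv]
    change (φ.tgt c ≫ inv (φ.tgt (φ.op.inv.obj (φ.op.obj c)) ≫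
      Q.tgt.map (φ.counit (φ.op.obj c)))) ≫ P.tgt.map (φ.unitInv c) = 𝟙 _
    simp only [h, IsIso.inv_comp, Category.assoc, IsIso.inv_hom_id, IsIso.hom_inv_id,
      Category.comp_id]

theorem Eqv.symm_trans : φ.symm.trans φ ≈ Eqv.refl Q := by
  refine Eqv.equiv_mk (fun c => φ.counit c) (fun c c' f => φ.counit_nat f) (fun c => ?_)
    (fun c => ?_)
  · rw [Category.assoc]; exact IsIso.inv_hom_id _
  · rw [Category.assoc]; exact IsIso.inv_hom_id _

end symm

/-- The isomorphism of `FinPoly I J` given by an equivalence of polynomials. -/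
@[reducible] noncomputable def Eqv.toIso {P Q : FinPoly I J} (φ : Eqv P Q) : P ≅ Q where
  hom := ⟦φ⟧
  inv := ⟦φ.symm⟧
  hom_inv_id := Quotient.sound φ.trans_symm
  inv_hom_id := Quotient.sound φ.symm_trans

@[reducible] def assocBase {P : FinPoly I J} {Q : FinPoly J K} {R : FinPoly K L}
    {X Y : CompOp (comp P Q) R} (f : X ⟶ Y) :
    (⟨X.op, fun x => (X.arg x).op, X.col⟩ : CompOp Q R) ⟶ ⟨Y.op, fun x => (Y.arg x).op, Y.col⟩ :=
  ⟨f.base, fun x y h => (f.arg x y h).base, f.comm⟩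

@[reducible] noncomputable def assocOp (P : FinPoly I J) (Q : FinPoly J K) (R : FinPoly K L) :
    CompOp (comp P Q) R ⥤ CompOp P (comp Q R) where
  obj X := ⟨⟨X.op, fun x => (X.arg x).op, X.col⟩, fun z => (X.arg z.1).arg z.2,
    fun z => (X.arg z.1).col z.2⟩
  map f := ⟨assocBase f,
    fun z w h => (f.arg z.1 w.1 (comp_e_aux (assocBase f) h).1).arg z.2 w.2
      (comp_e_aux (assocBase f) h).2,
    fun z w h => (f.arg z.1 w.1 (comp_e_aux (assocBase f) h).1).comm z.2 w.2
      (comp_e_aux (assocBase f) h).2⟩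
  map_id X := by
    refine CompOp.hom_ext (CompOp.hom_ext rfl fun x y h h' => ?_) fun x y h h' => ?_
    · obtain rfl := (CompOp.map_id_e _ _).symm.trans h'
      rfl
    · obtain rfl := (CompOp.map_id_e (Q := comp Q R) _ _).symm.trans h'
      rfl
  map_comp f g := by
    refine CompOp.hom_ext (CompOp.hom_ext rfl fun x y h h' => ?_) fun x y h h' => ?_
    · rfl
    · rfl

@[reducible] noncomputable def assoc (P : FinPoly I J) (Q : FinPoly J K) (R : FinPoly K L) :
    Eqv (comp (comp P Q) R) (comp P (comp Q R)) where
  op := assocOp P Q R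
  isEquivalence := by
    refine { faithful := ⟨?_⟩, full := ⟨?_⟩, essSurj := ⟨?_⟩ }
    · intro X Y f g h
      have hb := congrArg CompOp.Hom.base h
      refine CompOp.hom_ext (by have := congrArg CompOp.Hom.base hb; exact this)
        fun x y h₁ h₂ => CompOp.hom_ext (CompOp.arg_congr hb x y h₁ h₂) fun a b h₃ h₄ => ?_
      exact CompOp.arg_congr h ⟨x, a⟩ ⟨y, b⟩ (sigma_aux' (fun x y h => Q.pm.map (f.arg x y h).base) h₁ h₃)
        (sigma_aux' (fun x y h => Q.pm.map (g.arg x y h).base) h₂ h₄)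
    · intro X Y k
      refine ⟨⟨k.base.base, fun x y h => ⟨k.base.arg x y h, fun a b h' => k.arg ⟨x, a⟩ ⟨y, b⟩
          (sigma_aux' (fun x y h => Q.pm.map (k.base.arg x y h)) h h'),
        fun a b h' => k.comm ⟨x, a⟩ ⟨y, b⟩
          (sigma_aux' (fun x y h => Q.pm.map (k.base.arg x y h)) h h')⟩, k.base.comm⟩, rfl⟩
    · intro Z
      exact ⟨⟨Z.op.op, fun x => ⟨Z.op.arg x, fun y => Z.arg ⟨x, y⟩, fun y => Z.col ⟨x, y⟩⟩, Z.op.col⟩,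
        ⟨Iso.refl Z⟩⟩
  pm X :=
    { e := fun v => ⟨v.1.1, v.1.2, v.2⟩
      bij := ⟨fun v w h => by
          obtain ⟨⟨x, y⟩, z⟩ := v
          obtain ⟨⟨x', y'⟩, z'⟩ := w
          cases h; rfl,
        fun w => ⟨⟨⟨w.1, w.2.1⟩, w.2.2⟩, rfl⟩⟩
      iso := fun w v h => eqToHom (congrArg ((comp (comp P Q) R).pm.obj X).col h.symm) }
  pm_nat {X Y} f := by
    refine Fam.hom_ext (fun _ => rfl) fun w v h h' => ?_
    obtain rfl := h
    exact (Category.comp_id _).trans (Category.id_comp _).symm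
  tgt X := 𝟙 (R.tgt.obj X.op)
  tgt_nat f := by simp


@[reducible] noncomputable def leftUnit (P : FinPoly I J) : Eqv (comp (idPoly I) P) P where
  op :=
    { obj := fun X => X.op
      map := fun f => f.base }
  isEquivalence := by
    refine { faithful := ⟨?_⟩, full := ⟨?_⟩, essSurj := ⟨?_⟩ }
    · intro X Y f g h
      have h : f.base = g.base := h
      refine CompOp.hom_ext h fun x y h₁ h₂ => (cancel_mono (Y.col y)).1 ?_
      refine (f.comm x y h₁).symm.trans (Eq.trans ?_ (g.comm x y h₂))
      exact congrArg _ (Fam.iso_congr (congrArg P.pm.map h) _ _ _ _)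
    · intro X Y k
      exact ⟨⟨k, fun x y h => X.col x ≫ (P.pm.map k).iso x y h ≫ inv (Y.col y), fun x y h => by
        simp⟩, rfl⟩
    · intro c
      exact ⟨⟨c, (P.pm.obj c).col, fun x => 𝟙 _⟩, ⟨Iso.refl c⟩⟩
  pm X :=
    { e := fun y => ⟨y, ⟨⟩⟩
      bij := ⟨fun y z h => congrArg Sigma.fst h, fun w => ⟨w.1, rfl⟩⟩
      iso := fun w y h => X.reindex (congrArg Sigma.fst h.symm) ≫ X.col y }
  pm_nat {X Y} f := by
    refine Fam.hom_ext (fun _ => rfl) fun w v h h' => ?_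
    obtain rfl := h'
    refine Eq.trans ?_ (Category.assoc _ _ _).symm
    refine Eq.trans ?_ (Category.id_comp _).symm
    refine Eq.trans ?_ (f.comm _ v rfl).symm
    exact congrArg _ (Category.id_comp _)
  tgt X := 𝟙 (P.tgt.obj X.op)
  tgt_nat f := by simp

@[reducible] noncomputable def rightUnit (P : FinPoly I J) : Eqv (comp P (idPoly J)) P where
  op :=
    { obj := fun X => X.arg ⟨⟩
      map := fun f => f.arg ⟨⟩ ⟨⟩ rfl }
  isEquivalence := by
    refine { faithful := ⟨?_⟩, full := ⟨?_⟩, essSurj := ⟨?_⟩ }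
    · intro X Y f g h
      have h : f.arg ⟨⟩ ⟨⟩ rfl = g.arg ⟨⟩ ⟨⟩ rfl := h
      refine CompOp.hom_ext ((cancel_epi (X.col ⟨⟩)).1 ?_) fun x y h₁ h₂ => h
      refine (f.comm ⟨⟩ ⟨⟩ rfl).trans (Eq.trans ?_ (g.comm ⟨⟩ ⟨⟩ rfl).symm)
      rw [h]
    · intro X Y k
      exact ⟨⟨inv (X.col ⟨⟩) ≫ P.tgt.map k ≫ Y.col ⟨⟩, fun x y h => k, fun x y h => by
        simp⟩, rfl⟩
    · intro c
      exact ⟨⟨P.tgt.obj c, fun _ => c, fun x => 𝟙 _⟩, ⟨Iso.refl c⟩⟩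
  pm X :=
    { e := fun y => ⟨⟨⟩, y⟩
      bij := ⟨fun y z h => by cases h; rfl, fun w => ⟨w.2, rfl⟩⟩
      iso := fun w y h => eqToHom (congrArg ((comp P (idPoly J)).pm.obj X).col h.symm) }
  pm_nat {X Y} f := by
    refine Fam.hom_ext (fun _ => rfl) fun w v h h' => ?_
    obtain rfl := h'
    exact (Category.comp_id _).trans (Category.id_comp _).symm
  tgt X := inv (X.col ⟨⟩)
  tgt_nat {X Y} f := by
    have := f.comm ⟨⟩ ⟨⟩ rfl
    rw [IsIso.comp_inv_eq, Category.assoc, ← this]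
    simp

namespace CompOp

variable {P : FinPoly I J} {Q : FinPoly J K}

theorem comp_mkHom {X : CompOp P Q} {c : Q.Op} {a a' : (Q.pm.obj c).N → P.Op}
    {k : ∀ x, P.tgt.obj (a x) ⟶ (Q.pm.obj c).col x}
    {k' : ∀ x, P.tgt.obj (a' x) ⟶ (Q.pm.obj c).col x}
    (f : X ⟶ ⟨c, a, k⟩) (g : ∀ x, a x ⟶ a' x) (hg : ∀ x, k x = P.tgt.map (g x) ≫ k' x)
    (x y h h') : Hom.arg (f ≫ mkHom g hg) x y h = f.arg x y h' ≫ g y := by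
  refine (comp_arg f (mkHom g hg) x y y h h' (map_id_e _ _)).trans ?_
  simp

theorem mkHom_comp {Y : CompOp P Q} {c : Q.Op} {a a' : (Q.pm.obj c).N → P.Op}
    {k : ∀ x, P.tgt.obj (a x) ⟶ (Q.pm.obj c).col x}
    {k' : ∀ x, P.tgt.obj (a' x) ⟶ (Q.pm.obj c).col x}
    (g : ∀ x, a x ⟶ a' x) (hg : ∀ x, k x = P.tgt.map (g x) ≫ k' x) (f : ⟨c, a', k'⟩ ⟶ Y)
    (x y h h') : Hom.arg (mkHom (k := k) g hg ≫ f) x y h = g x ≫ f.arg x y h' := by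
  refine (comp_arg (mkHom g hg) f x x y h (map_id_e _ _) h').trans ?_
  simp

/-- Equations between parallel families of arrows of operations of a composite. -/
theorem mkHom_nat {X Y : CompOp P Q} {a : (Q.pm.obj X.op).N → P.Op}
    {b : (Q.pm.obj Y.op).N → P.Op}
    {k : ∀ x, P.tgt.obj (a x) ⟶ (Q.pm.obj X.op).col x}
    {l : ∀ x, P.tgt.obj (b x) ⟶ (Q.pm.obj Y.op).col x}
    {f : X ⟶ Y} {f' : (⟨X.op, a, k⟩ : CompOp P Q) ⟶ ⟨Y.op, b, l⟩} (hf : f.base = f'.base)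
    {g : ∀ x, X.arg x ⟶ a x} {hg : ∀ x, X.col x = P.tgt.map (g x) ≫ k x}
    {g' : ∀ x, Y.arg x ⟶ b x} {hg' : ∀ x, Y.col x = P.tgt.map (g' x) ≫ l x}
    (H : ∀ x y h h', f.arg x y h ≫ g' y = g x ≫ f'.arg x y h') :
    f ≫ mkHom g' hg' = mkHom g hg ≫ f' := by
  have e₁ : ∀ y, (Q.pm.map (f ≫ mkHom g' hg').base).e y = (Q.pm.map f.base).e y := fun y =>
    Fam.e_congr (congrArg Q.pm.map (Category.comp_id f.base)) y
  have e₂ : ∀ y, (Q.pm.map (mkHom g hg ≫ f').base).e y = (Q.pm.map f'.base).e y := fun y =>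
    Fam.e_congr (congrArg Q.pm.map (Category.id_comp f'.base)) y
  refine hom_ext ?_ fun x y h h' => ?_
  · exact (Category.comp_id _).trans (hf.trans (Category.id_comp _).symm)
  · rw [comp_mkHom _ _ _ _ _ _ ((e₁ y).symm.trans h),
      mkHom_comp _ _ _ _ _ _ ((e₂ y).symm.trans h')]
    exact H _ _ _ _

end CompOp

theorem whiskerRight_congr {P P' : FinPoly I J} {φ ψ : Eqv P P'} (h : φ ≈ ψ) (Q : FinPoly J K) :
    whiskerRight φ Q ≈ whiskerRight ψ Q := by
  obtain ⟨θ⟩ := h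
  refine Eqv.equiv_mk (fun X => CompOp.mkHom (fun x => θ.app.app (X.arg x)) fun x => ?_)
    (fun X Y f => CompOp.mkHom_nat rfl fun x y h h' => θ.app.naturality _) (fun X => ?_)
    (fun X => ?_)
  · simp [← θ.tgt]
  · rw [comp_map, whiskerRight_pm, whiskerRight_pm]
    refine sigmaHom_tri ?_ fun x y h h' => ?_
    · exact fun y => CompOp.map_id_e _ _
    obtain rfl := h'
    have key : ∀ y' (hy : y' = y) (h₁ : y = y') (h₂ : φ.op.obj (X.arg y') = φ.op.obj (X.arg y)),
        P.pm.map (X.reindex h₁) ≫ φ.pm (X.arg y') ≫ P'.pm.map (eqToHom h₂) = φ.pm (X.arg y) := by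
      rintro _ rfl h₁ h₂; simp
    have key := key _ (CompOp.map_id_e X.op y) (CompOp.map_id_e X.op y).symm
      (congrArg (fun z => φ.op.obj (X.arg z)) (CompOp.map_id_e X.op y))
    rw [← θ.pm, ← reassoc_of% key]
    simp
  · exact (Category.id_comp _).trans (Q.tgt.map_id _)

theorem whiskerLeft_congr (P : FinPoly I J) {Q Q' : FinPoly J K} {φ ψ : Eqv Q Q'} (h : φ ≈ ψ) :
    whiskerLeft P φ ≈ whiskerLeft P ψ := by
  obtain ⟨θ⟩ := h
  have he : ∀ c x y, (Q'.pm.map (θ.app.app c)).e y = x → (φ.pm c).e x = (ψ.pm c).e y := by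
    rintro c x y rfl
    exact Fam.e_congr (θ.pm c) y
  refine Eqv.equiv_mk (fun X => ⟨θ.app.app X.op, fun x y h => X.reindex (he _ x y h),
    fun x y h => ?_⟩) (fun X Y f => ?_) (fun X => ?_) (fun X => ?_)
  · have hy : (φ.pm X.op).e x = (ψ.pm X.op).e y := he _ x y h
    refine (Category.assoc _ _ _).trans (Eq.trans ?_ (Category.assoc _ _ _))
    rw [X.tgt_eqToHom hy, Category.assoc]
    refine congrArg _ ?_
    rw [← Fam.comp_iso (φ.pm X.op) (Q'.pm.map (θ.app.app X.op)) _ y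
      (congrArg (φ.pm X.op).e h) x rfl h, Fam.iso_congr (θ.pm X.op) _ y _ hy.symm, Fam.iso_left]
  · refine CompOp.hom_ext (θ.app.naturality _) fun x z h h' => ?_
    have h₁ := (CompOp.map_comp_e _ _ _).symm.trans h
    have h₂ := (CompOp.map_comp_e _ _ _).symm.trans h'
    refine (CompOp.comp_arg _ _ x _ z h h₁ rfl).trans
      (Eq.trans ?_ (CompOp.comp_arg _ _ x _ z h' h₂ rfl).symm)
    have h₃ : (Q.pm.map f.base).e ((ψ.pm Y.op).e z) = (φ.pm X.op).e x := by
      rw [he _ _ _ h₂]; exact Fam.e_congr (ψ.pm_nat f.base) z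
    exact (CompOp.arg_reindex f (he _ _ z rfl) _ h₃).trans
      (CompOp.reindex_arg_left f (he _ _ _ h₂) _ h₃).symm
  · rw [comp_map, whiskerLeft_pm, whiskerLeft_pm]
    refine sigmaHom_tri ?_ fun x y h h' => ?_
    · exact fun y => Fam.e_congr (θ.pm X.op) y
    rw [← P.pm.map_comp, eqToHom_trans]
  · exact θ.tgt X.op


theorem Eqv.equiv_of_eq {P Q : FinPoly I J} {φ ψ : Eqv P Q}
    (h : ∀ c, φ.op.obj c = ψ.op.obj c)
    (hn : ∀ c c' (f : c ⟶ c'), φ.op.map f ≫ eqToHom (h c') = eqToHom (h c) ≫ ψ.op.map f)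
    (hp : ∀ c, φ.pm c ≫ Q.pm.map (eqToHom (h c)) = ψ.pm c)
    (ht : ∀ c, φ.tgt c ≫ Q.tgt.map (eqToHom (h c)) = ψ.tgt c) : φ ≈ ψ :=
  Eqv.equiv_mk (fun c => eqToHom (h c)) hn hp ht

namespace CompOp

variable {P : FinPoly I J} {Q : FinPoly J K} {R : FinPoly K L}

section

variable {c : Q.Op} {a : (Q.pm.obj c).N → P.Op}
  {k k' : ∀ x, P.tgt.obj (a x) ⟶ (Q.pm.obj c).col x}

theorem eq₁ (h : ∀ x, k x = k' x) : (⟨c, a, k⟩ : CompOp P Q) = ⟨c, a, k'⟩ := by rw [funext h]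

theorem pm₁ (h : ∀ x, k x = k' x) : (comp P Q).pm.map (eqToHom (eq₁ h)) =
    𝟙 (sigmaFam (Q.pm.obj c).N fun x => P.pm.obj (a x)) := by
  obtain rfl : k = k' := funext h
  exact (comp P Q).pm.map_id _

theorem pm₁' (h : ∀ x, k x = k' x) {F : Fam I} {p q : F ⟶ sigmaFam (Q.pm.obj c).N fun x => P.pm.obj (a x)} (e : p = q) :
    p ≫ (comp P Q).pm.map (eqToHom (eq₁ h)) = q := by
  rw [e]
  exact (congrArg _ (pm₁ h)).trans (Category.comp_id _)

theorem tgt₁ (h : ∀ x, k x = k' x) : (comp P Q).tgt.map (eqToHom (eq₁ h)) = 𝟙 (Q.tgt.obj c) := by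
  obtain rfl : k = k' := funext h
  exact (comp P Q).tgt.map_id _

theorem tgt₁' (h : ∀ x, k x = k' x) {z : K} {p q : z ⟶ Q.tgt.obj c} (e : p = q) :
    p ≫ (comp P Q).tgt.map (eqToHom (eq₁ h)) = q := by
  rw [e]
  exact (congrArg _ (tgt₁ h)).trans (Category.comp_id _)

theorem nat₁ (h : ∀ x, k x = k' x) {d : Q.Op} {b : (Q.pm.obj d).N → P.Op}
    {l l' : ∀ x, P.tgt.obj (b x) ⟶ (Q.pm.obj d).col x} (h' : ∀ x, l x = l' x)
    (f : (⟨c, a, k⟩ : CompOp P Q) ⟶ ⟨d, b, l⟩) (f' : (⟨c, a, k'⟩ : CompOp P Q) ⟶ ⟨d, b, l'⟩)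
    (hb : f.base = f'.base) (ha : ∀ x y h h', f.arg x y h = f'.arg x y h') :
    f ≫ eqToHom (eq₁ h') = eqToHom (eq₁ h) ≫ f' := by
  obtain rfl : k = k' := funext h
  obtain rfl : l = l' := funext h'
  simpa using hom_ext hb ha

end

end CompOp

theorem whiskerLeft_refl (P : FinPoly I J) (Q : FinPoly J K) :
    whiskerLeft P (Eqv.refl Q) ≈ Eqv.refl (comp P Q) := by
  have hk : ∀ (X : CompOp P Q) x, X.col x ≫ (Fam.Hom.iso (𝟙 (Q.pm.obj X.op)) x x rfl) = X.col x :=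
    fun X x => Category.comp_id _
  exact Eqv.equiv_of_eq (fun X => CompOp.eq₁ (hk X))
    (fun X Y f => CompOp.nat₁ (hk X) (hk Y) _ _ rfl fun x y h h' => rfl)
    (fun X => CompOp.pm₁' (hk X) rfl) (fun X => CompOp.tgt₁' (hk X) rfl)

theorem whiskerRight_refl (P : FinPoly I J) (Q : FinPoly J K) :
    whiskerRight (Eqv.refl P) Q ≈ Eqv.refl (comp P Q) := by
  have hk : ∀ (X : CompOp P Q) x, inv (𝟙 (P.tgt.obj (X.arg x))) ≫ X.col x = X.col x :=
    fun X x => by simp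
  refine Eqv.equiv_of_eq (fun X => CompOp.eq₁ (hk X))
    (fun X Y f => CompOp.nat₁ (hk X) (hk Y) _ _ rfl fun x y h h' => rfl)
    (fun X => CompOp.pm₁' (hk X) ?_) (fun X => CompOp.tgt₁' (hk X) rfl)
  refine Fam.hom_ext (fun _ => rfl) fun w v h h' => ?_
  obtain rfl := h
  exact Category.id_comp _

theorem whiskerLeft_trans (P : FinPoly I J) {Q Q' Q'' : FinPoly J K} (φ : Eqv Q Q')
    (ψ : Eqv Q' Q'') :
    whiskerLeft P (φ.trans ψ) ≈ (whiskerLeft P φ).trans (whiskerLeft P ψ) := by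
  have hk : ∀ (X : CompOp P Q) x, ((whiskerLeft P (φ.trans ψ)).op.obj X).col x =
      ((whiskerLeft P ψ).op.obj ((whiskerLeft P φ).op.obj X)).col x :=
    fun X x => (Category.assoc _ _ _).symm
  refine Eqv.equiv_of_eq (fun X => CompOp.eq₁ (hk X))
    (fun X Y f => CompOp.nat₁ (hk X) (hk Y) _ _ rfl fun x y h h' => rfl)
    (fun X => CompOp.pm₁' (hk X) ?_) (fun X => CompOp.tgt₁' (hk X) rfl)
  refine Fam.hom_ext (fun _ => rfl) fun w v h h' => ?_
  obtain rfl := h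
  exact (Category.id_comp _).symm

section

variable {C : Type u} [Category.{u} C] {a b c : C}

theorem iso_aux₁ (p : a ⟶ b) (q : b ⟶ c) : 𝟙 _ ≫ p ≫ q = (𝟙 _ ≫ p) ≫ 𝟙 _ ≫ q := by simp
theorem iso_aux₂ (p : a ⟶ b) (q : b ⟶ c) : 𝟙 _ ≫ 𝟙 _ ≫ p ≫ q = (𝟙 _ ≫ p) ≫ q := by simp
theorem iso_aux₃ (p : a ⟶ b) : (𝟙 _ ≫ p) ≫ 𝟙 _ = 𝟙 _ ≫ p := by simp
theorem iso_aux₄ (p : a ⟶ b) : 𝟙 _ ≫ 𝟙 _ ≫ p = (𝟙 _ ≫ p) ≫ 𝟙 _ := by simp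
theorem iso_aux₅ (p : a ⟶ b) : 𝟙 _ ≫ 𝟙 _ ≫ p = (𝟙 _ ≫ 𝟙 _ ≫ p) ≫ 𝟙 _ := by simp
theorem iso_aux₆ (a : C) : (𝟙 a ≫ 𝟙 a) ≫ 𝟙 a = 𝟙 a ≫ 𝟙 a := by simp
theorem iso_aux₇ (a : C) : ((𝟙 a ≫ 𝟙 a) ≫ 𝟙 a) ≫ 𝟙 a = 𝟙 a ≫ 𝟙 a := by simp

end

theorem whiskerRight_trans {P P' P'' : FinPoly I J} (φ : Eqv P P') (ψ : Eqv P' P'')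
    (Q : FinPoly J K) :
    whiskerRight (φ.trans ψ) Q ≈ (whiskerRight φ Q).trans (whiskerRight ψ Q) := by
  have hk : ∀ (X : CompOp P Q) x, ((whiskerRight (φ.trans ψ) Q).op.obj X).col x =
      ((whiskerRight ψ Q).op.obj ((whiskerRight φ Q).op.obj X)).col x :=
    fun X x => by simp
  refine Eqv.equiv_of_eq (fun X => CompOp.eq₁ (hk X))
    (fun X Y f => CompOp.nat₁ (hk X) (hk Y) _ _ rfl fun x y h h' => rfl)
    (fun X => CompOp.pm₁' (hk X) ?_) (fun X => CompOp.tgt₁' (hk X) ?_)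
  · refine Fam.hom_ext (fun _ => rfl) fun w v h h' => ?_
    obtain rfl := h
    exact iso_aux₁ _ _
  · exact (Category.id_comp _).symm

theorem id_whiskerLeft {P Q : FinPoly I J} (φ : Eqv P Q) :
    (whiskerLeft (idPoly I) φ).trans (leftUnit Q) ≈ (leftUnit P).trans φ := by
  refine Eqv.equiv_mk (fun X => 𝟙 (φ.op.obj X.op)) (fun X Y f => ?_) (fun X => ?_) (fun X => ?_)
  · exact (Category.comp_id _).trans (Category.id_comp _).symm
  · rw [Q.pm.map_id]
    refine (Category.comp_id _).trans ?_
    refine Fam.hom_ext (fun _ => rfl) fun w v h h' => ?_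
    obtain rfl := h
    exact iso_aux₂ _ _
  · rw [Q.tgt.map_id]
    exact (Category.comp_id _).trans ((Category.comp_id _).trans (Category.id_comp _).symm)

theorem whiskerRight_id {P Q : FinPoly I J} (φ : Eqv P Q) :
    (whiskerRight φ (idPoly J)).trans (rightUnit Q) ≈ (rightUnit P).trans φ := by
  refine Eqv.equiv_mk (fun X => 𝟙 (φ.op.obj (X.arg ⟨⟩))) (fun X Y f => ?_) (fun X => ?_)
    (fun X => ?_)
  · exact (Category.comp_id _).trans (Category.id_comp _).symm
  · rw [Q.pm.map_id]
    refine (Category.comp_id _).trans ?_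
    refine Fam.hom_ext (fun _ => rfl) fun w v h h' => ?_
    obtain rfl := h
    exact iso_aux₃ _
  · rw [Q.tgt.map_id]
    refine (Category.comp_id _).trans ((Category.id_comp _).trans ?_)
    simp

theorem whisker_exchange {P P' : FinPoly I J} {Q Q' : FinPoly J K} (φ : Eqv P P') (ψ : Eqv Q Q') :
    (whiskerLeft P ψ).trans (whiskerRight φ Q') ≈
      (whiskerRight φ Q).trans (whiskerLeft P' ψ) := by
  have hk : ∀ (X : CompOp P Q) x, ((whiskerRight φ Q').op.obj ((whiskerLeft P ψ).op.obj X)).col x =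
      ((whiskerLeft P' ψ).op.obj ((whiskerRight φ Q).op.obj X)).col x :=
    fun X x => (Category.assoc _ _ _).symm
  refine Eqv.equiv_of_eq (fun X => CompOp.eq₁ (hk X))
    (fun X Y f => CompOp.nat₁ (hk X) (hk Y) _ _ rfl fun x y h h' => rfl)
    (fun X => CompOp.pm₁' (hk X) ?_) (fun X => CompOp.tgt₁' (hk X) ?_)
  · refine Fam.hom_ext (fun _ => rfl) fun w v h h' => ?_
    obtain rfl := h
    exact iso_aux₄ _
  · exact (Category.comp_id _).trans (Category.id_comp _).symm

theorem triangle (P : FinPoly I J) (Q : FinPoly J K) :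
    (assoc P (idPoly J) Q).trans (whiskerLeft P (leftUnit Q)) ≈ whiskerRight (rightUnit P) Q := by
  have hk : ∀ (X : CompOp (comp P (idPoly J)) Q) x,
      ((whiskerLeft P (leftUnit Q)).op.obj ((assoc P (idPoly J) Q).op.obj X)).col x =
      ((whiskerRight (rightUnit P) Q).op.obj X).col x :=
    fun X x => by simp
  refine Eqv.equiv_of_eq (fun X => CompOp.eq₁ (hk X))
    (fun X Y f => CompOp.nat₁ (hk X) (hk Y) _ _ rfl fun x y h h' => rfl)
    (fun X => CompOp.pm₁' (hk X) ?_) (fun X => CompOp.tgt₁' (hk X) ?_)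
  · refine Fam.hom_ext (fun _ => rfl) fun w v h h' => ?_
    obtain rfl := h
    rfl
  · exact (Category.comp_id _)


namespace CompOp

variable {P : FinPoly I J} {Q : FinPoly J K} {R : FinPoly K L}
  {c : R.Op} {b : (R.pm.obj c).N → Q.Op}
  {m m' : ∀ x, Q.tgt.obj (b x) ⟶ (R.pm.obj c).col x}
  {a : (Σ x, (Q.pm.obj (b x)).N) → P.Op}
  {k k' : ∀ z, P.tgt.obj (a z) ⟶ (Q.pm.obj (b z.1)).col z.2}

theorem eq₂ (hm : ∀ x, m x = m' x) (hk : ∀ z, k z = k' z) :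
    (⟨⟨c, b, m⟩, a, k⟩ : CompOp P (comp Q R)) = ⟨⟨c, b, m'⟩, a, k'⟩ := by
  obtain rfl := funext hm
  obtain rfl := funext hk
  rfl

theorem pm₂ (hm : ∀ x, m x = m' x) (hk : ∀ z, k z = k' z) {F : Fam I}
    {p q : F ⟶ sigmaFam (Σ x, (Q.pm.obj (b x)).N) fun z => P.pm.obj (a z)} (e : p = q) :
    p ≫ (comp P (comp Q R)).pm.map (eqToHom (eq₂ hm hk)) = q := by
  obtain rfl := funext hm
  obtain rfl := funext hk
  rw [e]
  exact (congrArg _ ((comp P (comp Q R)).pm.map_id _)).trans (Category.comp_id _)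

theorem tgt₂ (hm : ∀ x, m x = m' x) (hk : ∀ z, k z = k' z) {z : L}
    {p q : z ⟶ R.tgt.obj c} (e : p = q) :
    p ≫ (comp P (comp Q R)).tgt.map (eqToHom (eq₂ hm hk)) = q := by
  obtain rfl := funext hm
  obtain rfl := funext hk
  rw [e]
  exact (congrArg _ ((comp P (comp Q R)).tgt.map_id _)).trans (Category.comp_id _)

theorem nat₂ (hm : ∀ x, m x = m' x) (hk : ∀ z, k z = k' z)
    {d : R.Op} {b' : (R.pm.obj d).N → Q.Op}
    {n n' : ∀ x, Q.tgt.obj (b' x) ⟶ (R.pm.obj d).col x}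
    {a' : (Σ x, (Q.pm.obj (b' x)).N) → P.Op}
    {l l' : ∀ z, P.tgt.obj (a' z) ⟶ (Q.pm.obj (b' z.1)).col z.2}
    (hn : ∀ x, n x = n' x) (hl : ∀ z, l z = l' z)
    (f : (⟨⟨c, b, m⟩, a, k⟩ : CompOp P (comp Q R)) ⟶ ⟨⟨d, b', n⟩, a', l⟩)
    (f' : (⟨⟨c, b, m'⟩, a, k'⟩ : CompOp P (comp Q R)) ⟶ ⟨⟨d, b', n'⟩, a', l'⟩)
    (hb : f.base.base = f'.base.base)
    (hg : ∀ x y h h', f.base.arg x y h = f'.base.arg x y h')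
    (ha : ∀ x y h h', f.arg x y h = f'.arg x y h') :
    f ≫ eqToHom (eq₂ hn hl) = eqToHom (eq₂ hm hk) ≫ f' := by
  obtain rfl := funext hm
  obtain rfl := funext hk
  obtain rfl := funext hn
  obtain rfl := funext hl
  simpa using hom_ext (hom_ext hb hg) ha

end CompOp

theorem comp_whiskerLeft (P : FinPoly I J) (Q : FinPoly J K) {R R' : FinPoly K L} (φ : Eqv R R') :
    (whiskerLeft (comp P Q) φ).trans (assoc P Q R') ≈
      (assoc P Q R).trans (whiskerLeft P (whiskerLeft Q φ)) := by
  have hk : ∀ (X : CompOp (comp P Q) R) z,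
      ((assoc P Q R').op.obj ((whiskerLeft (comp P Q) φ).op.obj X)).col z =
        ((whiskerLeft P (whiskerLeft Q φ)).op.obj ((assoc P Q R).op.obj X)).col z :=
    fun X z => by simp
  refine Eqv.equiv_of_eq (fun X => CompOp.eq₂ (fun _ => rfl) (hk X))
    (fun X Y f => CompOp.nat₂ (fun _ => rfl) (hk X) (fun _ => rfl) (hk Y) _ _ rfl
      (fun x y h h' => rfl) fun x y h h' => rfl)
    (fun X => CompOp.pm₂ (fun _ => rfl) (hk X) ?_)
    (fun X => CompOp.tgt₂ (fun _ => rfl) (hk X) ?_)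
  · refine Fam.hom_ext (fun _ => rfl) fun w v h h' => ?_
    obtain rfl := h
    rfl
  · exact (Category.comp_id _).trans (Category.id_comp _).symm

theorem whiskerRight_comp {P P' : FinPoly I J} (φ : Eqv P P') (Q : FinPoly J K)
    (R : FinPoly K L) :
    (assoc P Q R).trans (whiskerRight φ (comp Q R)) ≈
      (whiskerRight (whiskerRight φ Q) R).trans (assoc P' Q R) := by
  have hm : ∀ (X : CompOp (comp P Q) R) x,
      ((whiskerRight φ (comp Q R)).op.obj ((assoc P Q R).op.obj X)).op.col x =
        ((assoc P' Q R).op.obj ((whiskerRight (whiskerRight φ Q) R).op.obj X)).op.col x :=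
    fun X x => by simp
  refine Eqv.equiv_of_eq (fun X => CompOp.eq₂ (hm X) (fun _ => rfl))
    (fun X Y f => CompOp.nat₂ (hm X) (fun _ => rfl) (hm Y) (fun _ => rfl) _ _ rfl
      (fun x y h h' => rfl) fun x y h h' => rfl)
    (fun X => CompOp.pm₂ (hm X) (fun _ => rfl) ?_)
    (fun X => CompOp.tgt₂ (hm X) (fun _ => rfl) rfl)
  · refine Fam.hom_ext (fun _ => rfl) fun w v h h' => ?_
    obtain rfl := h
    exact iso_aux₅ _

theorem whisker_assoc (P : FinPoly I J) {Q Q' : FinPoly J K} (φ : Eqv Q Q')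
    (R : FinPoly K L) :
    (whiskerRight (whiskerLeft P φ) R).trans (assoc P Q' R) ≈
      (assoc P Q R).trans (whiskerLeft P (whiskerRight φ R)) := by
  have hk : ∀ (X : CompOp (comp P Q) R) z,
      ((assoc P Q' R).op.obj ((whiskerRight (whiskerLeft P φ) R).op.obj X)).col z =
        ((whiskerLeft P (whiskerRight φ R)).op.obj ((assoc P Q R).op.obj X)).col z :=
    fun X z => by simp
  refine Eqv.equiv_of_eq (fun X => CompOp.eq₂ (fun _ => rfl) (hk X))
    (fun X Y f => CompOp.nat₂ (fun _ => rfl) (hk X) (fun _ => rfl) (hk Y) _ _ rfl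
      (fun x y h h' => rfl) fun x y h h' => rfl)
    (fun X => CompOp.pm₂ (fun _ => rfl) (hk X) ?_)
    (fun X => CompOp.tgt₂ (fun _ => rfl) (hk X) rfl)
  · refine Fam.hom_ext (fun _ => rfl) fun w v h h' => ?_
    obtain rfl := h
    exact iso_aux₆ _

namespace CompOp

variable {M : Type u} [Groupoid.{u} M]
  {P : FinPoly I J} {Q : FinPoly J K} {R : FinPoly K L} {S : FinPoly L M}
  {d : S.Op} {c : (S.pm.obj d).N → R.Op}
  {l l' : ∀ x, R.tgt.obj (c x) ⟶ (S.pm.obj d).col x}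
  {b : (Σ x, (R.pm.obj (c x)).N) → Q.Op}
  {m m' : ∀ z, Q.tgt.obj (b z) ⟶ (R.pm.obj (c z.1)).col z.2}
  {a : (Σ z, (Q.pm.obj (b z)).N) → P.Op}
  {k k' : ∀ z, P.tgt.obj (a z) ⟶ (Q.pm.obj (b z.1)).col z.2}

theorem eq₃ (hl : ∀ x, l x = l' x) (hm : ∀ x, m x = m' x) (hk : ∀ z, k z = k' z) :
    (⟨⟨⟨d, c, l⟩, b, m⟩, a, k⟩ : CompOp P (comp Q (comp R S))) = ⟨⟨⟨d, c, l'⟩, b, m'⟩, a, k'⟩ := by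
  obtain rfl := funext hl
  obtain rfl := funext hm
  obtain rfl := funext hk
  rfl

theorem pm₃ (hl : ∀ x, l x = l' x) (hm : ∀ x, m x = m' x) (hk : ∀ z, k z = k' z) {F : Fam I}
    {p q : F ⟶ sigmaFam (Σ z, (Q.pm.obj (b z)).N) fun z => P.pm.obj (a z)} (e : p = q) :
    p ≫ (comp P (comp Q (comp R S))).pm.map (eqToHom (eq₃ hl hm hk)) = q := by
  obtain rfl := funext hl
  obtain rfl := funext hm
  obtain rfl := funext hk
  rw [e]
  exact (congrArg _ ((comp P (comp Q (comp R S))).pm.map_id _)).trans (Category.comp_id _)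

theorem tgt₃ (hl : ∀ x, l x = l' x) (hm : ∀ x, m x = m' x) (hk : ∀ z, k z = k' z) {z : M}
    {p q : z ⟶ S.tgt.obj d} (e : p = q) :
    p ≫ (comp P (comp Q (comp R S))).tgt.map (eqToHom (eq₃ hl hm hk)) = q := by
  obtain rfl := funext hl
  obtain rfl := funext hm
  obtain rfl := funext hk
  rw [e]
  exact (congrArg _ ((comp P (comp Q (comp R S))).tgt.map_id _)).trans (Category.comp_id _)

theorem nat₃ (hl : ∀ x, l x = l' x) (hm : ∀ x, m x = m' x) (hk : ∀ z, k z = k' z)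
    {D : S.Op} {C : (S.pm.obj D).N → R.Op}
    {n n' : ∀ x, R.tgt.obj (C x) ⟶ (S.pm.obj D).col x}
    {B : (Σ x, (R.pm.obj (C x)).N) → Q.Op}
    {o o' : ∀ z, Q.tgt.obj (B z) ⟶ (R.pm.obj (C z.1)).col z.2}
    {A : (Σ z, (Q.pm.obj (B z)).N) → P.Op}
    {p p' : ∀ z, P.tgt.obj (A z) ⟶ (Q.pm.obj (B z.1)).col z.2}
    (hn : ∀ x, n x = n' x) (ho : ∀ x, o x = o' x) (hp : ∀ z, p z = p' z)
    (f : (⟨⟨⟨d, c, l⟩, b, m⟩, a, k⟩ : CompOp P (comp Q (comp R S))) ⟶ ⟨⟨⟨D, C, n⟩, B, o⟩, A, p⟩)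
    (f' : (⟨⟨⟨d, c, l'⟩, b, m'⟩, a, k'⟩ : CompOp P (comp Q (comp R S))) ⟶
      ⟨⟨⟨D, C, n'⟩, B, o'⟩, A, p'⟩)
    (hb : f.base.base.base = f'.base.base.base)
    (he : ∀ x y h h', f.base.base.arg x y h = f'.base.base.arg x y h')
    (hg : ∀ x y h h', f.base.arg x y h = f'.base.arg x y h')
    (ha : ∀ x y h h', f.arg x y h = f'.arg x y h') :
    f ≫ eqToHom (eq₃ hn ho hp) = eqToHom (eq₃ hl hm hk) ≫ f' := by
  obtain rfl := funext hl
  obtain rfl := funext hm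
  obtain rfl := funext hk
  obtain rfl := funext hn
  obtain rfl := funext ho
  obtain rfl := funext hp
  simpa using hom_ext (hom_ext (hom_ext hb he) hg) ha

end CompOp

set_option maxHeartbeats 400000 in
theorem pentagon {M : Type u} [Groupoid.{u} M] (P : FinPoly I J) (Q : FinPoly J K)
    (R : FinPoly K L) (S : FinPoly L M) :
    ((whiskerRight (assoc P Q R) S).trans (assoc P (comp Q R) S)).trans
        (whiskerLeft P (assoc Q R S)) ≈
      (assoc (comp P Q) R S).trans (assoc P Q (comp R S)) := by
  have hl : ∀ (X : CompOp (comp (comp P Q) R) S) x,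
      inv (𝟙 (R.tgt.obj (X.arg x).op)) ≫ X.col x = X.col x := fun X x => by simp
  have hk : ∀ (X : CompOp (comp (comp P Q) R) S) (z : Σ z : (Σ x, (R.pm.obj (X.arg x).op).N),
        (Q.pm.obj ((X.arg z.1).arg z.2).op).N),
      ((X.arg z.1.1).arg z.1.2).col z.2 ≫ 𝟙 _ =
        ((X.arg z.1.1).arg z.1.2).col z.2 := fun X z => Category.comp_id _
  have H : ∀ X, (((whiskerRight (assoc P Q R) S).trans (assoc P (comp Q R) S)).trans
        (whiskerLeft P (assoc Q R S))).op.obj X =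
      ((assoc (comp P Q) R S).trans (assoc P Q (comp R S))).op.obj X :=
    fun X => CompOp.eq₃ (hl X) (fun _ => rfl) (hk X)
  refine Eqv.equiv_of_eq H ?_ ?_ ?_
  · intro X Y f
    refine CompOp.nat₃ (hl X) (fun _ => rfl) (hk X) (hl Y) (fun _ => rfl) (hk Y) _ _ ?_ ?_ ?_ ?_
    · rfl
    · intro x y h h'; rfl
    · intro x y h h'; rfl
    · intro x y h h'; rfl
  · intro X
    refine CompOp.pm₃ (hl X) (fun _ => rfl) (hk X) ?_
    refine Fam.hom_ext (fun _ => rfl) fun w v h h' => ?_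
    obtain rfl := h
    exact iso_aux₇ ((P.pm.obj (((X.arg v.1.1.1).arg v.1.1.2).arg v.1.2)).col v.2)
  · intro X
    refine CompOp.tgt₃ (hl X) (fun _ => rfl) (hk X) ?_
    simp

@[reducible] noncomputable def whiskerLeft₂ (P : FinPoly I J) {Q Q' : FinPoly J K} (η : Q ⟶ Q') :
    comp P Q ⟶ comp P Q' :=
  Quotient.map (whiskerLeft P) (fun _ _ h => whiskerLeft_congr P h) η

@[reducible] noncomputable def whiskerRight₂ {P P' : FinPoly I J} (η : P ⟶ P') (Q : FinPoly J K) :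
    comp P Q ⟶ comp P' Q :=
  Quotient.map (fun φ => whiskerRight φ Q) (fun _ _ h => whiskerRight_congr h Q) η

theorem eq_conj {P P' Q Q' : FinPoly I J} (i : P ≅ P') (j : Q ≅ Q') {f : P ⟶ Q} {g : P' ⟶ Q'}
    (h : f ≫ j.hom = i.hom ≫ g) : f = i.hom ≫ g ≫ j.inv := by
  rw [← Category.assoc, Iso.eq_comp_inv, h]

end FinPoly

/-- The objects of the bicategory of finitary polynomials: small groupoids. -/
structure PolyObj : Type (u + 1) where
  carrier : Type u
  [str : Groupoid.{u} carrier]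

attribute [instance] PolyObj.str

/-- The bicategory of finitary polynomials in groupoids: 1-cells are finitary polynomials, 2-cells
are equivalences of polynomials up to identification. -/
noncomputable instance : Bicategory.{u, u + 1} PolyObj.{u} where
  Hom I J := FinPoly I.carrier J.carrier
  id I := FinPoly.idPoly I.carrier
  comp P Q := FinPoly.comp P Q
  homCategory I J := inferInstanceAs (Category (FinPoly I.carrier J.carrier))
  whiskerLeft P _ _ η := FinPoly.whiskerLeft₂ P η
  whiskerRight η Q := FinPoly.whiskerRight₂ η Q
  associator P Q R := (FinPoly.assoc P Q R).toIso
  leftUnitor P := (FinPoly.leftUnit P).toIso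
  rightUnitor P := (FinPoly.rightUnit P).toIso
  whiskerLeft_id P Q := Quotient.sound (FinPoly.whiskerLeft_refl P Q)
  whiskerLeft_comp := by
    rintro I J K P Q Q' Q'' ⟨η⟩ ⟨θ⟩
    exact Quotient.sound (FinPoly.whiskerLeft_trans P η θ)
  id_whiskerLeft := by
    rintro I J P Q ⟨η⟩
    exact FinPoly.eq_conj _ _ (Quotient.sound (FinPoly.id_whiskerLeft η))
  comp_whiskerLeft := by
    rintro I J K L P Q R R' ⟨η⟩
    exact FinPoly.eq_conj _ _ (Quotient.sound (FinPoly.comp_whiskerLeft P Q η))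
  id_whiskerRight P Q := Quotient.sound (FinPoly.whiskerRight_refl P Q)
  comp_whiskerRight := by
    rintro I J K P Q Q' ⟨η⟩ ⟨θ⟩ R
    exact Quotient.sound (FinPoly.whiskerRight_trans η θ R)
  whiskerRight_id := by
    rintro I J P Q ⟨η⟩
    exact FinPoly.eq_conj _ _ (Quotient.sound (FinPoly.whiskerRight_id η))
  whiskerRight_comp := by
    rintro I J K L P P' ⟨η⟩ Q R
    exact (Iso.eq_inv_comp _).2 (Quotient.sound (FinPoly.whiskerRight_comp η Q R))
  whisker_assoc := by
    rintro I J K L P Q Q' ⟨η⟩ R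
    exact FinPoly.eq_conj _ _ (Quotient.sound (FinPoly.whisker_assoc P η R))
  whisker_exchange := by
    rintro I J K P P' Q Q' ⟨η⟩ ⟨θ⟩
    exact Quotient.sound (FinPoly.whisker_exchange η θ)
  pentagon P Q R S := (Category.assoc _ _ _).symm.trans
    (Quotient.sound (FinPoly.pentagon P Q R S))
  triangle P Q := Quotient.sound (FinPoly.triangle P Q)

/-- The groupoid `𝔹`: its objects are natural numbers, an arrow `m ⟶ n` is a bijection
`Fin m ≃ Fin n`. -/
structure 𝔹 : Type where
  n : ℕ

namespace 𝔹

/-- The realization of an element of `𝔹` as a finite type. -/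
@[reducible] def toFin (b : 𝔹) : Type := Fin b.n

instance : Groupoid.{0} 𝔹 where
  Hom b b' := b.toFin ≃ b'.toFin
  id b := Equiv.refl _
  comp f g := f.trans g
  inv f := f.symm
  inv_comp f := Equiv.symm_trans_self f
  comp_inv f := Equiv.self_trans_symm f

/-- The bijection of finite types realizing an arrow of `𝔹`. -/
@[reducible] def equiv {b b' : 𝔹} (f : b ⟶ b') : b.toFin ≃ b'.toFin := f

end 𝔹

section groupoids

variable {I J : Type u} [Groupoid.{u} I] [Groupoid.{u} J]

/-- The disjoint union of two groupoids. -/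
instance sumGroupoid : Groupoid.{u} (I ⊕ J) :=
  { CategoryTheory.sum I J with
    inv := fun {x y} f => match x, y, f with
      | .inl _, .inl _, f => ULift.up (Groupoid.inv f.down)
      | .inr _, .inr _, f => ULift.up (Groupoid.inv f.down)
    inv_comp := fun {x y} f => match x, y, f with
      | .inl _, .inl _, f => congrArg ULift.up (Groupoid.inv_comp f.down)
      | .inr _, .inr _, f => congrArg ULift.up (Groupoid.inv_comp f.down)
    comp_inv := fun {x y} f => match x, y, f with
      | .inl _, .inl _, f => congrArg ULift.up (Groupoid.comp_inv f.down)
      | .inr _, .inr _, f => congrArg ULift.up (Groupoid.comp_inv f.down) }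

/-- The exponential `Exp I = Σ (b : 𝔹), (b.toFin → I)`. -/
structure Exp (I : Type u) : Type u where
  card : 𝔹
  col : card.toFin → I

namespace Exp

/-- An arrow of `Exp I`: an arrow `perm` of `𝔹`, and an arrow of `I` between the colours of any
two elements which correspond to each other under `perm`. -/
structure Hom (X Y : Exp I) : Type u where
  perm : X.card ⟶ Y.card
  iso : ∀ x y, 𝔹.equiv perm x = y → (X.col x ⟶ Y.col y)

theorem Hom.ext' {X Y : Exp I} {f g : Hom X Y} (hp : ∀ x, 𝔹.equiv f.perm x = 𝔹.equiv g.perm x)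
    (hi : ∀ x y h h', f.iso x y h = g.iso x y h') : f = g := by
  obtain ⟨e, i⟩ := f
  obtain ⟨e', i'⟩ := g
  obtain rfl : e = e' := Equiv.ext hp
  congr
  funext x y h
  exact hi x y h h

instance : Groupoid.{u} (Exp I) where
  Hom := Hom
  id X := ⟨𝟙 X.card, fun _ _ h => eqToHom (congrArg X.col h)⟩
  comp f g := ⟨f.perm ≫ g.perm, fun x z h => f.iso x _ rfl ≫ g.iso _ z h⟩
  inv f := ⟨Groupoid.inv f.perm, fun y x h =>
    Groupoid.inv (f.iso x y ((Equiv.symm_apply_eq (𝔹.equiv f.perm)).1 h).symm)⟩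
  id_comp f := by
    refine Hom.ext' (fun _ => rfl) ?_
    rintro x y h h'
    exact Category.id_comp _
  comp_id f := by
    refine Hom.ext' (fun _ => rfl) ?_
    rintro x y rfl h
    exact Category.comp_id _
  assoc f g k := by
    refine Hom.ext' (fun _ => rfl) ?_
    rintro x y h h'
    exact Category.assoc _ _ _
  inv_comp {X Y} f := by
    refine Hom.ext' (fun x => (𝔹.equiv f.perm).apply_symm_apply x) ?_
    intro x y h h'
    obtain rfl : x = y := h'
    exact Groupoid.inv_comp _
  comp_inv {X Y} f := by
    refine Hom.ext' (fun x => (𝔹.equiv f.perm).symm_apply_apply x) ?_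
    intro x y h h'
    obtain rfl : x = y := h'
    exact Groupoid.comp_inv _

theorem comp_iso {X Y Z : Exp I} (f : X ⟶ Y) (g : Y ⟶ Z) (x y z h h₁ h₂) :
    Hom.iso (f ≫ g) x z h = f.iso x y h₁ ≫ g.iso y z h₂ := by
  subst h₁; rfl

/-- The finite family given by an element of `Exp I`. -/
def toFam : Exp I ⥤ Fam I where
  obj X := ⟨ULift.{u} X.card.toFin, fun x => X.col x.down⟩
  map f := ⟨fun y => ⟨(𝔹.equiv f.perm).symm y.down⟩,
    Equiv.ulift.symm.bijective.comp ((𝔹.equiv f.perm).symm.bijective.comp Equiv.ulift.bijective),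
    fun x y h => f.iso x.down y.down
      ((Equiv.symm_apply_eq (𝔹.equiv f.perm)).1 (congrArg ULift.down h)).symm⟩
  map_id X := by
    refine Fam.hom_ext (fun _ => rfl) ?_
    rintro x y h h'
    rfl
  map_comp {X Y Z} f g := by
    refine Fam.hom_ext (fun _ => rfl) ?_
    rintro x y h h'
    exact comp_iso _ _ _ _ _ _ _ _

end Exp

namespace Fam

/-- The element of `Exp I` given by a finite family, by counting its index set. -/
noncomputable def card : Fam I ⥤ Exp I where
  obj F := ⟨⟨Nat.card F.N⟩, fun x => F.col ((Finite.equivFin F.N).symm x)⟩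
  map {F G} f := ⟨(Finite.equivFin F.N).symm.trans (f.equiv.symm.trans (Finite.equivFin G.N)),
    fun x y h => f.iso _ _ (by rw [← h]; simp)⟩
  map_id F := by
    refine Exp.Hom.ext' (fun x => ?_) fun x y h h' => ?_
    · have := Hom.symm_e (𝟙 F) ((Finite.equivFin F.N).symm x)
      exact (congrArg (Finite.equivFin F.N) this).trans (Equiv.apply_symm_apply _ _)
    · obtain rfl : x = y := h'
      rfl
  map_comp {F G H} f g := by
    have key : ∀ x, (Hom.equiv (f ≫ g)).symm x = (Hom.equiv g).symm ((Hom.equiv f).symm x) :=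
      fun x => by
        rw [Equiv.symm_apply_eq]
        change x = f.e (g.e _)
        rw [Hom.e_symm, Hom.e_symm]
    refine Exp.Hom.ext' (fun x => ?_) fun x y h h' => ?_
    · change Finite.equivFin H.N ((Hom.equiv (f ≫ g)).symm _) =
        Finite.equivFin H.N ((Hom.equiv g).symm ((Finite.equivFin G.N).symm
          (Finite.equivFin G.N ((Hom.equiv f).symm _))))
      rw [key, Equiv.symm_apply_apply]
    · exact comp_iso f g _ _ _ _ _ _

/-- Arrows between elements of the left summand. -/
def homLeft : ∀ {a b : I ⊕ J} (_ : a ⟶ b) (ha : a.isLeft) (hb : b.isLeft),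
    a.getLeft ha ⟶ b.getLeft hb
  | .inl _, .inl _, f, _, _ => f.down

/-- Arrows between elements of the right summand. -/
def homRight : ∀ {a b : I ⊕ J} (_ : a ⟶ b) (ha : a.isRight) (hb : b.isRight),
    a.getRight ha ⟶ b.getRight hb
  | .inr _, .inr _, f, _, _ => f.down

theorem homLeft_id : ∀ (a : I ⊕ J) (ha hb), homLeft (𝟙 a) ha hb = 𝟙 (a.getLeft ha)
  | .inl _, _, _ => rfl

theorem homLeft_comp : ∀ {a b c : I ⊕ J} (f : a ⟶ b) (g : b ⟶ c) (ha hb hc),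
    homLeft (f ≫ g) ha hc = homLeft f ha hb ≫ homLeft g hb hc
  | .inl _, .inl _, .inl _, _, _, _, _, _ => rfl

theorem isLeft_congr : ∀ {a b : I ⊕ J} (_ : a ⟶ b), a.isLeft = b.isLeft
  | .inl _, .inl _, _ => rfl
  | .inr _, .inr _, _ => rfl

theorem homRight_id : ∀ (a : I ⊕ J) (ha hb), homRight (𝟙 a) ha hb = 𝟙 (a.getRight ha)
  | .inr _, _, _ => rfl

theorem homRight_comp : ∀ {a b c : I ⊕ J} (f : a ⟶ b) (g : b ⟶ c) (ha hb hc),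
    homRight (f ≫ g) ha hc = homRight f ha hb ≫ homRight g hb hc
  | .inr _, .inr _, .inr _, _, _, _, _, _ => rfl

theorem isRight_congr : ∀ {a b : I ⊕ J} (_ : a ⟶ b), a.isRight = b.isRight
  | .inl _, .inl _, _ => rfl
  | .inr _, .inr _, _ => rfl

/-- The subfamily of elements of `I` of a family of elements of `I ⊕ J`. -/
def left : Fam (I ⊕ J) ⥤ Fam I where
  obj F := ⟨{x : F.N // (F.col x).isLeft}, fun x => (F.col x.1).getLeft x.2⟩
  map f := ⟨fun y => ⟨f.e y.1, (isLeft_congr (f.iso _ y.1 rfl)).trans y.2⟩,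
    ⟨fun y z h => Subtype.ext (f.bij.1 (congrArg Subtype.val h)), fun x => by
      obtain ⟨x, hx⟩ := x
      obtain ⟨y, rfl⟩ := f.bij.2 x
      exact ⟨⟨y, (isLeft_congr (f.iso _ y rfl)).symm.trans hx⟩, rfl⟩⟩,
    fun x y h => homLeft (f.iso x.1 y.1 (congrArg Subtype.val h)) x.2 y.2⟩
  map_id F := by
    refine hom_ext (fun _ => rfl) fun x y h h' => ?_
    obtain rfl : y = x := h'
    exact homLeft_id _ _ _
  map_comp f g := by
    refine hom_ext (fun _ => rfl) fun x y h h' => ?_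
    obtain rfl := h'
    exact homLeft_comp _ _ _ _ _

/-- The subfamily of elements of `J` of a family of elements of `I ⊕ J`. -/
def right : Fam (I ⊕ J) ⥤ Fam J where
  obj F := ⟨{x : F.N // (F.col x).isRight}, fun x => (F.col x.1).getRight x.2⟩
  map f := ⟨fun y => ⟨f.e y.1, (isRight_congr (f.iso _ y.1 rfl)).trans y.2⟩,
    ⟨fun y z h => Subtype.ext (f.bij.1 (congrArg Subtype.val h)), fun x => by
      obtain ⟨x, hx⟩ := x
      obtain ⟨y, rfl⟩ := f.bij.2 x
      exact ⟨⟨y, (isRight_congr (f.iso _ y rfl)).symm.trans hx⟩, rfl⟩⟩,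
    fun x y h => homRight (f.iso x.1 y.1 (congrArg Subtype.val h)) x.2 y.2⟩
  map_id F := by
    refine hom_ext (fun _ => rfl) fun x y h h' => ?_
    obtain rfl : y = x := h'
    exact homRight_id _ _ _
  map_comp f g := by
    refine hom_ext (fun _ => rfl) fun x y h h' => ?_
    obtain rfl := h'
    exact homRight_comp _ _ _ _ _

/-- The disjoint union of two families. -/
def sum : Fam I × Fam J ⥤ Fam (I ⊕ J) where
  obj F := ⟨F.1.N ⊕ F.2.N, Sum.map F.1.col F.2.col⟩
  map {F G} f := ⟨Sum.map f.1.e f.2.e, f.1.bij.sumMap f.2.bij, fun x y h => match x, y, h with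
    | .inl x, .inl y, h => ULift.up (f.1.iso x y (Sum.inl.inj h))
    | .inr x, .inr y, h => ULift.up (f.2.iso x y (Sum.inr.inj h))⟩
  map_id F := by
    refine hom_ext (fun y => by cases y <;> rfl) ?_
    rintro (x | x) (y | y) h h' <;> cases h' <;> rfl
  map_comp f g := by
    refine hom_ext (fun y => by cases y <;> rfl) ?_
    rintro (x | x) (y | y) h h' <;> cases h' <;> rfl

/-- The family obtained from a family of elements of `I` by adjoining an element of `Exp J`. -/
@[reducible] def adjoin : Fam I × Exp J ⥤ Fam (I ⊕ J) := (𝟭 (Fam I)).prod Exp.toFam ⋙ sum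

end Fam

end groupoids

namespace FinPoly

variable {I J K : Type u} [Groupoid.{u} I] [Groupoid.{u} J] [Groupoid.{u} K]

theorem Eqv.equiv_congr {P Q : FinPoly I J} {o : P.Op ⥤ Q.Op} {i i' p p' pn pn' t t' tn tn'}
    (hp : ∀ c, p c = p' c) (ht : ∀ c, t c = t' c) :
    (⟨o, i, p, pn, t, tn⟩ : Eqv P Q) ≈ ⟨o, i', p', pn', t', tn'⟩ :=
  Eqv.equiv_mk (fun c => 𝟙 (o.obj c)) (by intros; simp) (by intros; simp [hp])
    (by intros; simp [ht])

/-- Currying: an operation keeps its parameters coloured in `I`, and the family of its parameters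
coloured in `J` is moved to the output colour. -/
@[reducible] noncomputable def curry (P : FinPoly (I ⊕ J) K) : FinPoly I (Exp J × K) where
  Op := P.Op
  pm := P.pm ⋙ Fam.left
  tgt := (P.pm ⋙ Fam.right ⋙ Fam.card).prod' P.tgt

/-- Uncurrying: the family of elements of `J` in the output colour of an operation is added to its
parameters. -/
@[reducible] def uncurry (P : FinPoly I (Exp J × K)) : FinPoly (I ⊕ J) K where
  Op := P.Op
  pm := P.pm.prod' (P.tgt ⋙ CategoryTheory.Prod.fst _ _) ⋙ Fam.adjoin
  tgt := P.tgt ⋙ CategoryTheory.Prod.snd _ _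

/-- The action of currying on equivalences of polynomials and their identifications. -/
@[reducible] noncomputable def curryEqv (P Q : FinPoly (I ⊕ J) K) :
    Eqv P Q ⥤ Eqv (curry P) (curry Q) where
  obj φ :=
    { op := φ.op
      isEquivalence := φ.isEquivalence
      pm := fun c => Fam.left.map (φ.pm c)
      pm_nat := fun f => by
        change Fam.left.map _ ≫ _ = _ ≫ Fam.left.map _
        rw [← Functor.map_comp, φ.pm_nat, Functor.map_comp]
      tgt := fun c => (Fam.card.map (Fam.right.map (φ.pm c)), φ.tgt c)
      tgt_nat := fun f => Prod.ext
        (by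
          change Fam.card.map (Fam.right.map _) ≫ _ = _ ≫ Fam.card.map (Fam.right.map _)
          rw [← Functor.map_comp, ← Functor.map_comp, φ.pm_nat, Functor.map_comp, Functor.map_comp])
        (φ.tgt_nat f) }
  map {φ ψ} θ :=
    { app := θ.app
      pm := fun c => by
        change Fam.left.map _ ≫ Fam.left.map _ = Fam.left.map _
        rw [← Functor.map_comp, θ.pm]
      tgt := fun c => Prod.ext
        (by
          change Fam.card.map (Fam.right.map _) ≫ Fam.card.map (Fam.right.map _) =
            Fam.card.map (Fam.right.map _)
          rw [← Functor.map_comp, ← Functor.map_comp, θ.pm])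
        (θ.tgt c) }
  map_id φ := rfl
  map_comp f g := rfl

/-- The action of uncurrying on equivalences of polynomials and their identifications. -/
@[reducible] def uncurryEqv (P Q : FinPoly I (Exp J × K)) :
    Eqv P Q ⥤ Eqv (uncurry P) (uncurry Q) where
  obj φ :=
    { op := φ.op
      isEquivalence := φ.isEquivalence
      pm := fun c => Fam.adjoin.map (CategoryTheory.Prod.mkHom (φ.pm c) (φ.tgt c).1)
      pm_nat := fun f => by
        change Fam.adjoin.map _ ≫ _ = _ ≫ Fam.adjoin.map _
        rw [← Functor.map_comp, ← Functor.map_comp]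
        exact congrArg Fam.adjoin.map (Prod.ext (φ.pm_nat f) (congrArg Prod.fst (φ.tgt_nat f)))
      tgt := fun c => (φ.tgt c).2
      tgt_nat := fun f => congrArg Prod.snd (φ.tgt_nat f) }
  map {φ ψ} θ :=
    { app := θ.app
      pm := fun c => by
        change Fam.adjoin.map _ ≫ Fam.adjoin.map _ = Fam.adjoin.map _
        rw [← Functor.map_comp]
        exact congrArg Fam.adjoin.map (Prod.ext (θ.pm c) (congrArg Prod.fst (θ.tgt c)))
      tgt := fun c => congrArg Prod.snd (θ.tgt c) }
  map_id φ := rfl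
  map_comp f g := rfl

/-- Currying, as a functor between groupoids of polynomials. -/
@[reducible] noncomputable def curryFunctor (I J K : Type u) [Groupoid.{u} I] [Groupoid.{u} J]
    [Groupoid.{u} K] : FinPoly (I ⊕ J) K ⥤ FinPoly I (Exp J × K) where
  obj := curry
  map {P Q} := Quotient.map (curryEqv P Q).obj fun _ _ ⟨θ⟩ => ⟨(curryEqv P Q).map θ⟩
  map_id P := Quotient.sound (Eqv.equiv_congr (fun c => Fam.left.map_id _) fun c =>
    Prod.ext ((congrArg Fam.card.map (Fam.right.map_id _)).trans (Fam.card.map_id _)) rfl)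
  map_comp {P Q R} := by
    rintro ⟨φ⟩ ⟨ψ⟩
    exact Quotient.sound (Eqv.equiv_congr (fun c => Fam.left.map_comp _ _) fun c =>
      Prod.ext ((congrArg Fam.card.map (Fam.right.map_comp _ _)).trans (Fam.card.map_comp _ _)) rfl)

/-- Uncurrying, as a functor between groupoids of polynomials. -/
@[reducible] def uncurryFunctor (I J K : Type u) [Groupoid.{u} I] [Groupoid.{u} J]
    [Groupoid.{u} K] : FinPoly I (Exp J × K) ⥤ FinPoly (I ⊕ J) K where
  obj := uncurry
  map {P Q} := Quotient.map (uncurryEqv P Q).obj fun _ _ ⟨θ⟩ => ⟨(uncurryEqv P Q).map θ⟩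
  map_id P := Quotient.sound (Eqv.equiv_congr (fun c => Fam.adjoin.map_id _) fun c => rfl)
  map_comp {P Q R} := by
    rintro ⟨φ⟩ ⟨ψ⟩
    exact Quotient.sound (Eqv.equiv_congr (fun c =>
      Fam.adjoin.map_comp (CategoryTheory.Prod.mkHom (φ.pm c) (φ.tgt c).1)
        (CategoryTheory.Prod.mkHom (ψ.pm (φ.op.obj c)) (ψ.tgt (φ.op.obj c)).1)) fun c => rfl)

/-- The pairing of two polynomials. -/
@[reducible] def pair (P : FinPoly I J) (Q : FinPoly I K) : FinPoly I (J ⊕ K) where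
  Op := P.Op ⊕ Q.Op
  pm := P.pm.sum' Q.pm
  tgt := P.tgt.sum Q.tgt

/-- The pairing of two equivalences of polynomials. -/
@[reducible] def pairEqv {P P' : FinPoly I J} {Q Q' : FinPoly I K} (φ : Eqv P P') (ψ : Eqv Q Q') :
    Eqv (pair P Q) (pair P' Q') where
  op := φ.op.sum ψ.op
  isEquivalence := by
    have := φ.isEquivalence
    have := ψ.isEquivalence
    refine { faithful := ⟨?_⟩, full := ⟨?_⟩, essSurj := ⟨?_⟩ }
    · intro X Y f g h
      exact match X, Y, f, g, h with
        | .inl _, .inl _, _, _, h => congrArg ULift.up (φ.op.map_injective (congrArg ULift.down h))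
        | .inr _, .inr _, _, _, h => congrArg ULift.up (ψ.op.map_injective (congrArg ULift.down h))
    · intro X Y f
      exact match X, Y, f with
        | .inl _, .inl _, f => ⟨ULift.up (φ.op.preimage f.down),
            congrArg ULift.up (φ.op.map_preimage f.down)⟩
        | .inr _, .inr _, f => ⟨ULift.up (ψ.op.preimage f.down),
            congrArg ULift.up (ψ.op.map_preimage f.down)⟩
    · rintro (X | X)
      · exact ⟨.inl (φ.op.objPreimage X), ⟨(Sum.inl_ _ _).mapIso (φ.op.objObjPreimageIso X)⟩⟩
      · exact ⟨.inr (ψ.op.objPreimage X), ⟨(Sum.inr_ _ _).mapIso (ψ.op.objObjPreimageIso X)⟩⟩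
  pm
    | .inl c => φ.pm c
    | .inr c => ψ.pm c
  pm_nat {c d} f := match c, d, f with
    | .inl _, .inl _, f => φ.pm_nat f.down
    | .inr _, .inr _, f => ψ.pm_nat f.down
  tgt
    | .inl c => ULift.up (φ.tgt c)
    | .inr c => ULift.up (ψ.tgt c)
  tgt_nat {c d} f := match c, d, f with
    | .inl _, .inl _, f => congrArg ULift.up (φ.tgt_nat f.down)
    | .inr _, .inr _, f => congrArg ULift.up (ψ.tgt_nat f.down)

/-- Pairing, as a functor. -/
@[reducible] def pairFunctor (I J K : Type u) [Groupoid.{u} I] [Groupoid.{u} J]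
    [Groupoid.{u} K] : FinPoly I J × FinPoly I K ⥤ FinPoly I (J ⊕ K) where
  obj P := pair P.1 P.2
  map f := Quotient.map₂ pairEqv (by
    rintro φ φ' ⟨θ⟩ ψ ψ' ⟨κ⟩
    refine ⟨⟨NatTrans.sum θ.app κ.app, ?_, ?_⟩⟩
    · rintro (c | c)
      · exact θ.pm c
      · exact κ.pm c
    · rintro (c | c)
      · exact congrArg ULift.up (θ.tgt c)
      · exact congrArg ULift.up (κ.tgt c)) f.1 f.2
  map_id P := Quotient.sound (Eqv.equiv_mk
    (fun c => match c with
      | .inl c => ULift.up (𝟙 c)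
      | .inr c => ULift.up (𝟙 c))
    (fun c d f => match c, d, f with
      | .inl _, .inl _, f => congrArg ULift.up
        ((Category.comp_id f.down).trans (Category.id_comp f.down).symm)
      | .inr _, .inr _, f => congrArg ULift.up
        ((Category.comp_id f.down).trans (Category.id_comp f.down).symm))
    (fun c => match c with
      | .inl c => (Category.id_comp _).trans (P.1.pm.map_id c)
      | .inr c => (Category.id_comp _).trans (P.2.pm.map_id c))
    (fun c => match c with
      | .inl c => congrArg ULift.up ((Category.id_comp _).trans (P.1.tgt.map_id c))
      | .inr c => congrArg ULift.up ((Category.id_comp _).trans (P.2.tgt.map_id c))))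
  map_comp := by
    rintro ⟨P, P'⟩ ⟨Q, Q'⟩ ⟨R, R'⟩ ⟨⟨φ⟩, ⟨φ'⟩⟩ ⟨⟨ψ⟩, ⟨ψ'⟩⟩
    exact Quotient.sound (Eqv.equiv_mk
      (fun c => match c with
        | .inl c => ULift.up (𝟙 (ψ.op.obj (φ.op.obj c)))
        | .inr c => ULift.up (𝟙 (ψ'.op.obj (φ'.op.obj c))))
      (fun c d f => match c, d, f with
        | .inl _, .inl _, _ => congrArg ULift.up
          ((Category.comp_id _).trans (Category.id_comp _).symm)
        | .inr _, .inr _, _ => congrArg ULift.up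
          ((Category.comp_id _).trans (Category.id_comp _).symm))
      (fun c => match c with
        | .inl c => (congrArg _ (R.pm.map_id _)).trans (Category.comp_id _)
        | .inr c => (congrArg _ (R'.pm.map_id _)).trans (Category.comp_id _))
      (fun c => match c with
        | .inl c => congrArg ULift.up ((congrArg _ (R.tgt.map_id _)).trans (Category.comp_id _))
        | .inr c => congrArg ULift.up ((congrArg _ (R'.tgt.map_id _)).trans (Category.comp_id _))))

end FinPoly

namespace PolyObj

/-- The terminal object: the empty groupoid. -/
def empty : PolyObj.{u} := ⟨Discrete PEmpty.{u + 1}⟩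

/-- The cartesian product of two objects: the disjoint union of groupoids. -/
def prod (I J : PolyObj.{u}) : PolyObj.{u} := ⟨I.carrier ⊕ J.carrier⟩

/-- The first projection. -/
def projl (I J : PolyObj.{u}) : prod I J ⟶ I :=
  FinPoly.ofFunctor (Sum.inl_ I.carrier J.carrier)

/-- The second projection. -/
def projr (I J : PolyObj.{u}) : prod I J ⟶ J :=
  FinPoly.ofFunctor (Sum.inr_ I.carrier J.carrier)

/-- Postcomposition with the two projections. -/
noncomputable def projections (I J K : PolyObj.{u}) :
    (I ⟶ prod J K) ⥤ (I ⟶ J) × (I ⟶ K) :=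
  (Bicategory.postcomp I (projl J K)).prod' (Bicategory.postcomp I (projr J K))

/-- Pairing of morphisms into a product. -/
def pairing (I J K : PolyObj.{u}) : (I ⟶ J) × (I ⟶ K) ⥤ (I ⟶ prod J K) :=
  FinPoly.pairFunctor I.carrier J.carrier K.carrier

/-- The action of the product on morphisms. -/
noncomputable def times (I I' J J' : PolyObj.{u}) :
    (I ⟶ I') × (J ⟶ J') ⥤ (prod I J ⟶ prod I' J') :=
  (Bicategory.precomp I' (projl I J)).prod (Bicategory.precomp J' (projr I J)) ⋙
    pairing (prod I J) I' J'

/-- The internal hom from `J` to `K`. -/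
def ihom (J K : PolyObj.{u}) : PolyObj.{u} := ⟨Exp J.carrier × K.carrier⟩

/-- Currying of polynomials. -/
noncomputable def currying (I J K : PolyObj.{u}) : (prod I J ⟶ K) ⥤ (I ⟶ ihom J K) :=
  FinPoly.curryFunctor I.carrier J.carrier K.carrier

/-- Uncurrying of polynomials. -/
def uncurrying (I J K : PolyObj.{u}) : (I ⟶ ihom J K) ⥤ (prod I J ⟶ K) :=
  FinPoly.uncurryFunctor I.carrier J.carrier K.carrier

/-- The evaluation morphism. -/
noncomputable def ev (J K : PolyObj.{u}) : prod (ihom J K) J ⟶ K :=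
  (uncurrying (ihom J K) J K).obj (𝟙 (ihom J K))

/-- The functor `P ↦ (P × J) ≫ ev`. -/
noncomputable def evaluation (I J K : PolyObj.{u}) : (I ⟶ ihom J K) ⥤ (prod I J ⟶ K) :=
  (𝟭 (I ⟶ ihom J K)).prod' ((Functor.const _).obj (𝟙 J)) ⋙ times I (ihom J K) J J ⋙
    Bicategory.postcomp (prod I J) (ev J K)

end PolyObj

/-!
Disjoint unions are products of finitary polynomials because an operation of a polynomial with
values in `J ⊔ K` has its output colour in exactly one of the summands: `PolyObj.pairingProjections`
and `PolyObj.projectionsPairing` say that pairing and projecting are mutually inverse.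

The exponential rests on the equivalence of groupoids `Fam.split`: a finite family of elements of
`I ⊔ J` is the same as a finite family of elements of `I` and an element of `Exp J`. As `curry` and
`uncurry` change neither the operations nor the equivalences between them, but only move a part of
the parameters to the output colour or back, they are mutually inverse
(`FinPoly.uncurryCurryIso`, `FinPoly.curryUncurryIso`) and locally equivalences
(`FinPoly.curryEqv_isEquivalence`).

That `uncurry P` is `(P × J) ≫ ev` is the one computation with composites
(`FinPoly.toEvaluation`). An operation of `ev` is a pair `(X, k)`, with one parameter of colour
`(X, k)` and one for each member of `X`; hence an operation of `(P × J) ≫ ev` consists of `(X, k)`,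
an operation of `P` of output colour `(X, k)`, and for each member of `X` an isomorphic object of
`J`. Up to isomorphism all of it is determined by the operation of `P`. Morphisms are determined in
the same way, which is the full faithfulness of `FinPoly.evOp`.

The remaining naturality statements are formal. The universal property of the product makes it
compatible with composition (`PolyObj.timesWithPostcomp`, `PolyObj.timesWithPrecomp`). Since
uncurrying is an equivalence, an isomorphism between functors into `I ⟶ ihom J K` may be constructed
after uncurrying both (`PolyObj.ihomExt`), where uncurrying is replaced by `P ↦ (P × J) ≫ ev`, and
the compatibility of `×` with composition applies.
-/

/-! ### Generalities on categories -/

theorem comp_id_eq_id_comp {C : Type*} [Category* C] {X Y : C} (f : X ⟶ Y) :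
    f ≫ 𝟙 Y = 𝟙 X ≫ f := by simp

theorem comp_map_id {C D : Type*} [Category* C] [Category* D] (F : C ⥤ D) {X : C} {Y : D}
    (f : Y ⟶ F.obj X) : f ≫ F.map (𝟙 X) = f := by simp

/-- In a groupoid, natural transformations are invertible. -/
noncomputable def groupoidIso {C D : Type*} [Category* C] [Groupoid D] {F G : C ⥤ D} (α : F ⟶ G) :
    F ≅ G :=
  NatIso.ofComponents (fun X => asIso (α.app X)) fun f => α.naturality f

instance inl_full (C D : Type*) [Category* C] [Category* D] : (Sum.inl_ C D).Full :=
  ⟨fun f => ⟨f.down, rfl⟩⟩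

instance inl_faithful (C D : Type*) [Category* C] [Category* D] : (Sum.inl_ C D).Faithful :=
  ⟨fun h => congrArg ULift.down h⟩

instance inr_full (C D : Type*) [Category* C] [Category* D] : (Sum.inr_ C D).Full :=
  ⟨fun f => ⟨f.down, rfl⟩⟩

instance inr_faithful (C D : Type*) [Category* C] [Category* D] : (Sum.inr_ C D).Faithful :=
  ⟨fun h => congrArg ULift.down h⟩

/-! ### Splitting a family of elements of a disjoint union -/

namespace Fam

variable {I J : Type u} [Groupoid.{u} I] [Groupoid.{u} J]

theorem comp_getLeft : ∀ {a b : I ⊕ J} (f : a ⟶ b) (ha hb),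
    f ≫ eqToHom (Sum.inl_getLeft b hb).symm =
      eqToHom (Sum.inl_getLeft a ha).symm ≫ (Sum.inl_ I J).map (homLeft f ha hb)
  | .inl _, .inl _, f, _, _ => (Category.comp_id f).trans (Category.id_comp f).symm

theorem comp_getRight : ∀ {a b : I ⊕ J} (f : a ⟶ b) (ha hb),
    f ≫ eqToHom (Sum.inr_getRight b hb).symm =
      eqToHom (Sum.inr_getRight a ha).symm ≫ (Sum.inr_ I J).map (homRight f ha hb)
  | .inr _, .inr _, f, _, _ => (Category.comp_id f).trans (Category.id_comp f).symm

/-- A family of elements of `I ⊕ J` is the disjoint union of its two parts. -/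
def toSumParts : 𝟭 (Fam (I ⊕ J)) ⟶ left.prod' right ⋙ sum where
  app F :=
    { e := Sum.elim Subtype.val Subtype.val
      bij := by
        constructor
        · rintro (⟨x, hx⟩ | ⟨x, hx⟩) (⟨y, hy⟩ | ⟨y, hy⟩) h <;> obtain rfl : x = y := h
          · rfl
          · rw [← Sum.not_isLeft] at hy
            simp [hx] at hy
          · rw [← Sum.not_isLeft] at hx
            simp [hy] at hx
          · rfl
        · intro x
          rcases h : F.col x with i | j
          · exact ⟨.inl ⟨x, by rw [h]; rfl⟩, rfl⟩
          · exact ⟨.inr ⟨x, by rw [h]; rfl⟩, rfl⟩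
      iso := fun x y h => eqToHom (by
        subst h
        rcases y with y | y
        · exact (Sum.inl_getLeft _ y.2).symm
        · exact (Sum.inr_getRight _ y.2).symm) }
  naturality F G f := by
    refine hom_ext (by rintro (y | y) <;> rfl) ?_
    rintro x (y | y) h h'
    · obtain rfl := h'
      exact (comp_iso f _ _ _ _ y.1 rfl rfl).trans (comp_getLeft _ _ _)
    · obtain rfl := h'
      exact (comp_iso f _ _ _ _ y.1 rfl rfl).trans (comp_getRight _ _ _)

/-- The left part of a disjoint union of families is the first of them. -/
def sumLeft : sum ⋙ left ⟶ CategoryTheory.Prod.fst (Fam I) (Fam J) where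
  app F :=
    { e := fun x => ⟨.inl x, rfl⟩
      bij := ⟨fun x y h => Sum.inl.inj (congrArg Subtype.val h), by
        rintro ⟨x | x, hx⟩
        · exact ⟨x, rfl⟩
        · exact absurd hx Bool.false_ne_true⟩
      iso := fun x y h => eqToHom (by subst h; rfl) }
  naturality F G f := by
    refine hom_ext (fun _ => rfl) ?_
    rintro x y h h'
    obtain rfl := h'
    exact comp_id_eq_id_comp _

/-- The right part of a disjoint union of families is the second of them. -/
def sumRight : sum ⋙ right ⟶ CategoryTheory.Prod.snd (Fam I) (Fam J) where
  app F :=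
    { e := fun x => ⟨.inr x, rfl⟩
      bij := ⟨fun x y h => Sum.inr.inj (congrArg Subtype.val h), by
        rintro ⟨x | x, hx⟩
        · exact absurd hx Bool.false_ne_true
        · exact ⟨x, rfl⟩⟩
      iso := fun x y h => eqToHom (by subst h; rfl) }
  naturality F G f := by
    refine hom_ext (fun _ => rfl) ?_
    rintro x y h h'
    obtain rfl := h'
    exact comp_id_eq_id_comp _

/-- A family is isomorphic to its enumeration. -/
noncomputable def toFamCard : 𝟭 (Fam J) ⟶ card ⋙ Exp.toFam where
  app F :=
    { e := fun x => (Finite.equivFin F.N).symm x.down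
      bij := (Finite.equivFin F.N).symm.bijective.comp Equiv.ulift.bijective
      iso := fun x y h => eqToHom (by subst h; rfl) }
  naturality F G f := by
    have key : ∀ y, f.e ((Finite.equivFin G.N).symm y) = (Finite.equivFin F.N).symm
        ((𝔹.equiv (card.map f).perm).symm y) := fun y => by
      refine Eq.trans ?_ ((Finite.equivFin F.N).symm_apply_apply _).symm
      rfl
    refine hom_ext (fun y => key y.down) ?_
    rintro x y h h'
    obtain rfl := h'
    refine (comp_iso f _ _ _ _ ((Finite.equivFin G.N).symm y.down) (key _) rfl).trans ?_
    exact comp_id_eq_id_comp _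

theorem exp_iso_eqToHom {X Y : Exp J} (f : X ⟶ Y) {x x' y y'} (hx : x = x') (hy : y = y')
    (h : 𝔹.equiv f.perm x = y) (h' : 𝔹.equiv f.perm x' = y') :
    f.iso x y h ≫ eqToHom (congrArg Y.col hy) = eqToHom (congrArg X.col hx) ≫ f.iso x' y' h' := by
  subst hx hy; simp

theorem down_equivFin_symm (X : Exp J) (x : X.card.toFin) :
    x = ((Finite.equivFin (Exp.toFam.obj X).N).symm
      (Finite.equivFin (Exp.toFam.obj X).N ⟨x⟩)).down :=
  (congrArg ULift.down ((Finite.equivFin (Exp.toFam.obj X).N).symm_apply_apply ⟨x⟩)).symm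

/-- Enumerating the underlying family of an element of `Exp J` gives an isomorphic element. -/
noncomputable def cardToFam : 𝟭 (Exp J) ⟶ Exp.toFam ⋙ card where
  app X :=
    { perm := Equiv.ulift.symm.trans (Finite.equivFin (Exp.toFam.obj X).N)
      iso := fun x y h => eqToHom (congrArg X.col (by
        subst h
        exact down_equivFin_symm X x)) }
  naturality X Y f := by
    have key : ∀ x, (Hom.equiv (Exp.toFam.map f)).symm ((Finite.equivFin (Exp.toFam.obj X).N).symm
        (Finite.equivFin (Exp.toFam.obj X).N ⟨x⟩)) = ⟨𝔹.equiv f.perm x⟩ := fun x => by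
      refine (congrArg _ (Equiv.symm_apply_apply _ _)).trans ((Equiv.symm_apply_eq _).2 ?_)
      exact congrArg ULift.up ((𝔹.equiv f.perm).symm_apply_apply x).symm
    refine Exp.Hom.ext' (fun x => congrArg (Finite.equivFin (Exp.toFam.obj Y).N) (key x).symm)
      fun x y h h' => ?_
    subst h
    exact exp_iso_eqToHom f (down_equivFin_symm X x) (down_equivFin_symm Y _) rfl _

/-- The part of a family coloured in `I`, and the enumeration of the part coloured in `J`. -/
noncomputable abbrev split : Fam (I ⊕ J) ⥤ Fam I × Exp J := left.prod' (right ⋙ card)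

/-- A family is isomorphic to the one obtained by splitting it and putting it together again. -/
noncomputable def toAdjoinSplit : 𝟭 (Fam (I ⊕ J)) ⟶ split ⋙ adjoin where
  app F := toSumParts.app F ≫
    sum.map (CategoryTheory.Prod.mkHom (𝟙 (left.obj F)) (toFamCard.app (right.obj F)))
  naturality F G f := by
    have h₁ := toSumParts.naturality f
    have h₂ := toFamCard.naturality (right.map f)
    refine ((reassoc_of% h₁) _).trans ?_
    rw [Category.assoc]
    refine congrArg _ ?_
    refine (sum.map_comp _ _).symm.trans (Eq.trans ?_ (sum.map_comp _ _))
    refine congrArg sum.map (Prod.ext ?_ h₂)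
    exact comp_id_eq_id_comp _

/-- Splitting the union of a family and an element of `Exp J` gives these two back. -/
noncomputable def splitAdjoin : adjoin ⋙ split ⟶ 𝟭 (Fam I × Exp J) where
  app X := CategoryTheory.Prod.mkHom (sumLeft.app (X.1, Exp.toFam.obj X.2))
    (card.map (sumRight.app (X.1, Exp.toFam.obj X.2)) ≫ inv (cardToFam.app X.2))
  naturality X Y f := by
    refine Prod.ext (sumLeft.naturality (X := (X.1, Exp.toFam.obj X.2))
      (Y := (Y.1, Exp.toFam.obj Y.2)) (CategoryTheory.Prod.mkHom f.1 (Exp.toFam.map f.2))) ?_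
    have h₁ := congrArg card.map (sumRight.naturality (X := (X.1, Exp.toFam.obj X.2))
      (Y := (Y.1, Exp.toFam.obj Y.2)) (CategoryTheory.Prod.mkHom f.1 (Exp.toFam.map f.2)))
    rw [card.map_comp, card.map_comp] at h₁
    have h₂ := cardToFam.naturality f.2
    refine ((reassoc_of% h₁) _).trans ?_
    refine Eq.trans ?_ (Category.assoc _ _ _).symm
    refine congrArg _ ?_
    rw [IsIso.comp_inv_eq, Category.assoc, IsIso.eq_inv_comp]
    exact h₂.symm

instance : (split : Fam (I ⊕ J) ⥤ Fam I × Exp J).IsEquivalence :=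
  Functor.IsEquivalence.mk' adjoin (groupoidIso toAdjoinSplit) (groupoidIso splitAdjoin)

end Fam

/-! ### Currying and uncurrying are mutually inverse -/

namespace FinPoly

variable {I J K : Type u} [Groupoid.{u} I] [Groupoid.{u} J] [Groupoid.{u} K]

/-- `P` and `uncurry (curry P)` have the same operations, and isomorphic families of parameters. -/
@[reducible] noncomputable def toUncurryCurry (P : FinPoly (I ⊕ J) K) :
    Eqv P (uncurry (curry P)) where
  op := 𝟭 P.Op
  isEquivalence := inferInstance
  pm c := Fam.toAdjoinSplit.app (P.pm.obj c)
  pm_nat f := Fam.toAdjoinSplit.naturality (P.pm.map f)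
  tgt c := 𝟙 (P.tgt.obj c)
  tgt_nat _ := comp_id_eq_id_comp _

/-- `curry (uncurry P)` and `P` have the same operations, and isomorphic parameters and output
colours. -/
@[reducible] noncomputable def curryUncurryTo (P : FinPoly I (Exp J × K)) :
    Eqv (curry (uncurry P)) P where
  op := 𝟭 P.Op
  isEquivalence := inferInstance
  pm c := (Fam.splitAdjoin.app (P.pm.obj c, (P.tgt.obj c).1)).1
  pm_nat f := congrArg Prod.fst
    (Fam.splitAdjoin.naturality (CategoryTheory.Prod.mkHom (P.pm.map f) (P.tgt.map f).1))
  tgt c := CategoryTheory.Prod.mkHom (Fam.splitAdjoin.app (P.pm.obj c, (P.tgt.obj c).1)).2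
    (𝟙 (P.tgt.obj c).2)
  tgt_nat f := Prod.ext (congrArg Prod.snd
    (Fam.splitAdjoin.naturality (CategoryTheory.Prod.mkHom (P.pm.map f) (P.tgt.map f).1)))
      (comp_id_eq_id_comp _)

/-- The equivalences `toUncurryCurry` are natural. -/
noncomputable def uncurryCurryIso (I J K : Type u) [Groupoid.{u} I] [Groupoid.{u} J]
    [Groupoid.{u} K] : 𝟭 _ ≅ curryFunctor I J K ⋙ uncurryFunctor I J K :=
  NatIso.ofComponents (fun P => (toUncurryCurry P).toIso) (by
    rintro P Q ⟨φ⟩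
    refine Quotient.sound (Eqv.equiv_mk (fun c => 𝟙 (φ.op.obj c)) (fun c d f => ?_) (fun c => ?_)
      fun c => ?_)
    · exact comp_id_eq_id_comp _
    · refine Eq.trans ?_ (Fam.toAdjoinSplit.naturality (φ.pm c))
      exact comp_map_id _ _
    · refine (comp_map_id _ _).trans ?_
      exact comp_id_eq_id_comp _)

/-- The equivalences `curryUncurryTo` are natural. -/
noncomputable def curryUncurryIso (I J K : Type u) [Groupoid.{u} I] [Groupoid.{u} J]
    [Groupoid.{u} K] : uncurryFunctor I J K ⋙ curryFunctor I J K ≅ 𝟭 _ :=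
  NatIso.ofComponents (fun P => (curryUncurryTo P).toIso) (by
    rintro P Q ⟨φ⟩
    refine Quotient.sound (Eqv.equiv_mk (fun c => 𝟙 (φ.op.obj c)) (fun c d f => ?_) (fun c => ?_)
      fun c => ?_)
    · exact comp_id_eq_id_comp _
    · refine Eq.trans ?_ (congrArg Prod.fst
        (Fam.splitAdjoin.naturality (CategoryTheory.Prod.mkHom (φ.pm c) (φ.tgt c).1)))
      exact comp_map_id _ _
    · refine (comp_map_id _ _).trans ?_
      exact Prod.ext (congrArg Prod.snd
        (Fam.splitAdjoin.naturality (CategoryTheory.Prod.mkHom (φ.pm c) (φ.tgt c).1)))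
          (comp_id_eq_id_comp _))

/-- Currying is fully faithful on identifications and essentially surjective on equivalences,
since a morphism of families of elements of `I ⊕ J` is the same as a morphism between their two
parts. -/
theorem curryEqv_isEquivalence (P Q : FinPoly (I ⊕ J) K) : (curryEqv P Q).IsEquivalence := by
  refine { faithful := ⟨?_⟩, full := ⟨?_⟩, essSurj := ⟨?_⟩ }
  · intro φ ψ f g h
    exact Eqv.Hom.ext (congrArg
      (fun k : Eqv.Hom ((curryEqv P Q).obj φ) ((curryEqv P Q).obj ψ) => k.app) h)
  · intro φ ψ k
    refine ⟨⟨k.app, fun c => Fam.split.map_injective ?_, fun c => congrArg Prod.snd (k.tgt c)⟩, rfl⟩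
    rw [Functor.map_comp]
    exact Prod.ext (k.pm c) (congrArg Prod.fst (k.tgt c))
  · intro φ
    let p : ∀ c, Fam.split.obj (P.pm.obj c) ⟶ Fam.split.obj (Q.pm.obj (φ.op.obj c)) :=
      fun c => CategoryTheory.Prod.mkHom (φ.pm c) (φ.tgt c).1
    have hp : ∀ c, Fam.split.map (Fam.split.preimage (p c)) = p c :=
      fun c => Fam.split.map_preimage _
    refine ⟨⟨φ.op, φ.isEquivalence, fun c => Fam.split.preimage (p c), fun f =>
      Fam.split.map_injective ?_, fun c => (φ.tgt c).2, fun f => congrArg Prod.snd (φ.tgt_nat f)⟩,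
      ⟨(Groupoid.isoEquivHom _ _).symm ⟨𝟙 φ.op, fun c => ?_, fun c => ?_⟩⟩⟩
    · rw [Functor.map_comp, Functor.map_comp, hp, hp]
      exact Prod.ext (φ.pm_nat f) (congrArg Prod.fst (φ.tgt_nat f))
    · refine (comp_map_id _ _).trans ?_
      exact congrArg Prod.fst (hp c)
    · refine (comp_map_id _ _).trans ?_
      exact Prod.ext (congrArg Prod.snd (hp c)) rfl

end FinPoly

/-! ### The cartesian product -/

namespace FinPoly

variable {I J K L : Type u} [Groupoid.{u} I] [Groupoid.{u} J] [Groupoid.{u} K] [Groupoid.{u} L]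

section restriction

variable (R : FinPoly I L) (G : J ⥤ L)

/-- The operation of `R` underlying an operation of the composite of `R` and a functor. -/
@[reducible] noncomputable def argOp : CompOp R (ofFunctor G) ⥤ R.Op where
  obj X := X.arg ⟨⟩
  map f := f.arg ⟨⟩ ⟨⟩ rfl

theorem comm_ofFunctor {R : FinPoly I L} {G : J ⥤ L} {X Y : CompOp R (ofFunctor G)} (f : X ⟶ Y) :
    X.col ⟨⟩ ≫ G.map f.base = R.tgt.map (f.arg ⟨⟩ ⟨⟩ rfl) ≫ Y.col ⟨⟩ := f.comm ⟨⟩ ⟨⟩ rfl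

/-- A morphism of operations of the composite is determined by its underlying morphism of operations
of `R`, as the one of output colours is its conjugate by the given isomorphisms. -/
instance [G.Faithful] : (argOp R G).Faithful := ⟨fun {X Y f g} h => by
  have h : f.arg ⟨⟩ ⟨⟩ rfl = g.arg ⟨⟩ ⟨⟩ rfl := h
  refine CompOp.hom_ext (G.map_injective ((cancel_epi (X.col ⟨⟩)).1 ?_)) fun x y h₁ h₂ => h
  exact (comm_ofFunctor f).trans ((congrArg (fun k => R.tgt.map k ≫ Y.col ⟨⟩) h).trans
    (comm_ofFunctor g).symm)⟩

instance [G.Full] : (argOp R G).Full := ⟨fun {X Y} k =>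
  ⟨⟨G.preimage (inv (X.col ⟨⟩) ≫ R.tgt.map k ≫ Y.col ⟨⟩), fun _ _ _ => k, fun x y h => by
    refine (congrArg _ (G.map_preimage _)).trans ?_
    exact IsIso.hom_inv_id_assoc _ _⟩, rfl⟩⟩

/-- The disjoint union of a single family is this family. It identifies the parameters of an
operation of the composite of `R` and a functor with those of the underlying operation of `R`. -/
@[reducible] def sigmaUnit (F : PUnit.{u + 1} → Fam I) : sigmaFam PUnit F ⟶ F ⟨⟩ where
  e y := ⟨⟨⟩, y⟩
  bij := ⟨fun y z h => by cases h; rfl, fun w => ⟨w.2, rfl⟩⟩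
  iso w y h := eqToHom (congrArg (sigmaFam PUnit F).col h.symm)

theorem sigmaUnit_nat {F F' : PUnit.{u + 1} → Fam I} (e : PUnit.{u + 1} → PUnit.{u + 1})
    (he : Function.Bijective e) (g : ∀ x y, e y = x → (F x ⟶ F' y)) :
    sigmaHom e he g ≫ sigmaUnit F' = sigmaUnit F ≫ g ⟨⟩ ⟨⟩ rfl := by
  refine Fam.hom_ext (fun _ => rfl) fun w v h h' => ?_
  obtain rfl := h
  exact comp_id_eq_id_comp _

/-- The inverse of `sigmaUnit`. -/
@[reducible] def sigmaUnitInv (F : PUnit.{u + 1} → Fam I) : F ⟨⟩ ⟶ sigmaFam PUnit F where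
  e z := z.2
  bij := ⟨fun _ _ h => Sigma.ext rfl (heq_of_eq h), fun w => ⟨⟨⟨⟩, w⟩, rfl⟩⟩
  iso w y h := eqToHom (by subst h; rfl)

theorem sigmaUnitInv_nat {F F' : PUnit.{u + 1} → Fam I} (e : PUnit.{u + 1} → PUnit.{u + 1})
    (he : Function.Bijective e) (g : ∀ x y, e y = x → (F x ⟶ F' y)) :
    sigmaUnitInv F ≫ sigmaHom e he g = g ⟨⟩ ⟨⟩ rfl ≫ sigmaUnitInv F' := by
  refine Fam.hom_ext (fun _ => rfl) fun w v h h' => ?_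
  obtain rfl := h
  exact (comp_id_eq_id_comp _).symm

theorem sigmaUnitInv_sigmaMap {F F' : PUnit.{u + 1} → Fam I} (g : ∀ x, F x ⟶ F' x) :
    sigmaUnitInv F ≫ sigmaMap g = g ⟨⟩ ≫ sigmaUnitInv F' := by
  rw [sigmaMap_eq, sigmaUnitInv_nat, eqToHom_refl, Category.id_comp]

theorem argOp_pm_nat {R : FinPoly I L} {G : J ⥤ L} {X Y : CompOp R (ofFunctor G)} (f : X ⟶ Y) :
    (comp R (ofFunctor G)).pm.map f ≫ sigmaUnit (fun x => R.pm.obj (Y.arg x)) =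
      sigmaUnit (fun x => R.pm.obj (X.arg x)) ≫ R.pm.map ((argOp R G).map f) :=
  sigmaUnit_nat (F := fun x => R.pm.obj (X.arg x)) (F' := fun x => R.pm.obj (Y.arg x))
    (fun x => x) Function.bijective_id fun x y h => R.pm.map (f.arg x y h)

/-- The inverse of the isomorphism, which is part of an operation of the composite of `R` with `G`,
from the output colour of the underlying operation of `R`. -/
@[reducible] noncomputable def invCol {R : FinPoly I L} {G : J ⥤ L} (X : CompOp R (ofFunctor G)) :
    G.obj X.op ⟶ R.tgt.obj (X.arg ⟨⟩) := inv (X.col ⟨⟩)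

theorem invCol_nat {R : FinPoly I L} {G : J ⥤ L} {X Y : CompOp R (ofFunctor G)} (f : X ⟶ Y) :
    G.map f.base ≫ invCol Y = invCol X ≫ R.tgt.map ((argOp R G).map f) := by
  rw [IsIso.comp_inv_eq, Category.assoc, IsIso.eq_inv_comp]
  exact comm_ofFunctor f

theorem whiskerRight_sigmaUnit {R S : FinPoly I L} {G : J ⥤ L} (φ : Eqv R S)
    (X : CompOp R (ofFunctor G)) :
    (whiskerRight φ (ofFunctor G)).pm X ≫ sigmaUnit (fun x => S.pm.obj (φ.op.obj (X.arg x))) =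
      sigmaUnit (fun x => R.pm.obj (X.arg x)) ≫ φ.pm (X.arg ⟨⟩) := by
  refine Fam.hom_ext (fun _ => rfl) fun w v h h' => ?_
  obtain rfl := h
  exact iso_aux₃ _

theorem whiskerRight_invCol {R S : FinPoly I L} {G : J ⥤ L} (φ : Eqv R S)
    (X : CompOp R (ofFunctor G)) :
    G.map (𝟙 X.op) ≫ invCol ((whiskerRight φ (ofFunctor G)).op.obj X) =
      invCol X ≫ φ.tgt (X.arg ⟨⟩) := by
  simp

end restriction

/-- A polynomial whose operations are those operations of `R` whose output colour comes from the
full subgroupoid `J` of `L` is the composite of `R` with the inclusion of `J`. -/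
@[reducible] noncomputable def toCompOfFunctor {P : FinPoly I J} {R : FinPoly I L} (G : J ⥤ L)
    [G.Full] [G.Faithful] (i : P.Op ⥤ R.Op) [i.Full] [i.Faithful] (α : P.pm ⟶ i ⋙ R.pm)
    (β : i ⋙ R.tgt ⟶ P.tgt ⋙ G)
    (hi : ∀ (c : R.Op) (j : J), (R.tgt.obj c ⟶ G.obj j) → ∃ b, Nonempty (i.obj b ⟶ c)) :
    Eqv P (comp R (ofFunctor G)) where
  op :=
    { obj := fun c => ⟨P.tgt.obj c, fun _ => i.obj c, fun _ => β.app c⟩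
      map := fun f => ⟨P.tgt.map f, fun _ _ _ => i.map f, fun _ _ _ => (β.naturality f).symm⟩
      map_id := fun c => CompOp.hom_ext (P.tgt.map_id c) fun _ _ _ _ => i.map_id c
      map_comp := fun f g => CompOp.hom_ext (P.tgt.map_comp f g) fun _ _ _ _ => i.map_comp f g }
  -- Composing with the fully faithful `argOp R G` gives `i`.
  isEquivalence := by
    refine { faithful := ⟨?_⟩, full := ⟨?_⟩, essSurj := ⟨?_⟩ }
    · intro X Y f g h
      exact i.map_injective (CompOp.arg_congr h ⟨⟩ ⟨⟩ rfl rfl)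
    · intro X Y k
      refine ⟨i.preimage (k.arg ⟨⟩ ⟨⟩ rfl), (argOp R G).map_injective ?_⟩
      exact i.map_preimage _
    · intro Z
      obtain ⟨b, ⟨e⟩⟩ := hi (Z.arg ⟨⟩) Z.op (Z.col ⟨⟩)
      refine ⟨b, ⟨(Groupoid.isoEquivHom _ _).symm ((argOp R G).preimage e)⟩⟩
  pm c := α.app c ≫ sigmaUnitInv fun _ => R.pm.obj (i.obj c)
  pm_nat {c c'} f := by
    rw [← Category.assoc, α.naturality, Category.assoc, Category.assoc]
    exact congrArg _ (sigmaUnitInv_nat (F := fun _ => R.pm.obj (i.obj c))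
      (F' := fun _ => R.pm.obj (i.obj c')) (fun x => x) Function.bijective_id
      fun _ _ _ => R.pm.map (i.map f)).symm
  tgt c := 𝟙 (P.tgt.obj c)
  tgt_nat f := comp_id_eq_id_comp _

/-- The equivalences `toCompOfFunctor` are natural with respect to equivalences `φ` and `ρ` which
agree on the common operations up to `θ`. -/
theorem toCompOfFunctor_nat {P P' : FinPoly I J} {R R' : FinPoly I L} {G : J ⥤ L} [G.Full]
    [G.Faithful] {i : P.Op ⥤ R.Op} [i.Full] [i.Faithful] {i' : P'.Op ⥤ R'.Op} [i'.Full]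
    [i'.Faithful] {α : P.pm ⟶ i ⋙ R.pm} {α' : P'.pm ⟶ i' ⋙ R'.pm} {β : i ⋙ R.tgt ⟶ P.tgt ⋙ G}
    {β' : i' ⋙ R'.tgt ⟶ P'.tgt ⋙ G} {hi hi'} (φ : Eqv P P') (ρ : Eqv R R')
    (θ : i ⋙ ρ.op ⟶ φ.op ⋙ i')
    (hp : ∀ c, α.app c ≫ ρ.pm (i.obj c) ≫ R'.pm.map (θ.app c) = φ.pm c ≫ α'.app (φ.op.obj c))
    (ht : ∀ c, β.app c ≫ G.map (φ.tgt c) =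
      ρ.tgt (i.obj c) ≫ R'.tgt.map (θ.app c) ≫ β'.app (φ.op.obj c)) :
    (toCompOfFunctor G i α β hi).trans (whiskerRight ρ (ofFunctor G)) ≈
      φ.trans (toCompOfFunctor G i' α' β' hi') := by
  refine Eqv.equiv_mk (fun c => ⟨φ.tgt c, fun _ _ _ => θ.app c, fun _ _ _ => ?_⟩)
    (fun c d f => ?_) (fun c => ?_) (fun c => ?_)
  · rw [Category.assoc, IsIso.inv_comp_eq]
    exact ht c
  · exact CompOp.hom_ext (φ.tgt_nat f) fun _ _ _ _ => θ.naturality f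
  · have h₁ := sigmaUnitInv_sigmaMap (F := fun _ => R.pm.obj (i.obj c))
      (F' := fun _ => R'.pm.obj (ρ.op.obj (i.obj c))) fun _ => ρ.pm (i.obj c)
    have h₂ := sigmaUnitInv_nat (F := fun _ => R'.pm.obj (ρ.op.obj (i.obj c)))
      (F' := fun _ => R'.pm.obj (i'.obj (φ.op.obj c))) (fun x => x) Function.bijective_id
      fun _ _ _ => R'.pm.map (θ.app c)
    have h₃ := congrArg (fun k => k ≫ sigmaUnitInv fun _ => R'.pm.obj (i'.obj (φ.op.obj c))) (hp c)
    simp only [Category.assoc] at h₃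
    refine Eq.trans ?_ h₃
    rw [← h₂, ← reassoc_of% h₁]
    exact (Category.assoc _ _ _).trans (Category.assoc _ _ _)
  · change (𝟙 (P.tgt.obj c) ≫ 𝟙 (P.tgt.obj c)) ≫ φ.tgt c = φ.tgt c ≫ 𝟙 _
    simp

/-- The operations of `pair P Q` with output colour in `J` are those of `P`. -/
@[reducible] noncomputable def toPairInl (P : FinPoly I J) (Q : FinPoly I K) :
    Eqv P (comp (pair P Q) (ofFunctor (Sum.inl_ J K))) :=
  toCompOfFunctor (R := pair P Q) (Sum.inl_ J K) (Sum.inl_ P.Op Q.Op)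
    { app := fun c => 𝟙 (P.pm.obj c), naturality := fun _ _ f => comp_id_eq_id_comp _ }
    { app := fun c => 𝟙 (Sum.inl (P.tgt.obj c)), naturality := fun _ _ f => comp_id_eq_id_comp _ }
    (by
      rintro (c | c) j f
      · exact ⟨c, ⟨𝟙 _⟩⟩
      · exact (hom_inr_inl_false _ _ f).elim)

/-- The operations of `pair P Q` with output colour in `K` are those of `Q`. -/
@[reducible] noncomputable def toPairInr (P : FinPoly I J) (Q : FinPoly I K) :
    Eqv Q (comp (pair P Q) (ofFunctor (Sum.inr_ J K))) :=
  toCompOfFunctor (R := pair P Q) (Sum.inr_ J K) (Sum.inr_ P.Op Q.Op)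
    { app := fun c => 𝟙 (Q.pm.obj c), naturality := fun _ _ f => comp_id_eq_id_comp _ }
    { app := fun c => 𝟙 (Sum.inr (Q.tgt.obj c)), naturality := fun _ _ f => comp_id_eq_id_comp _ }
    (by
      rintro (c | c) j f
      · exact (hom_inl_inr_false _ _ f).elim
      · exact ⟨c, ⟨𝟙 _⟩⟩)

/-- `R` is the pairing of its projections, as every operation of `R` has its output colour in one of
the two summands. -/
@[reducible] noncomputable def pairProjections (R : FinPoly I (J ⊕ K)) :
    Eqv (pair (comp R (ofFunctor (Sum.inl_ J K))) (comp R (ofFunctor (Sum.inr_ J K)))) R where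
  op := (argOp R (Sum.inl_ J K)).sum' (argOp R (Sum.inr_ J K))
  isEquivalence := by
    refine { faithful := ⟨?_⟩, full := ⟨?_⟩, essSurj := ⟨?_⟩ }
    · rintro (X | X) (Y | Y) f g h
      · exact congrArg ULift.up ((argOp R (Sum.inl_ J K)).map_injective h)
      · exact (hom_inl_inr_false _ _ f).elim
      · exact (hom_inr_inl_false _ _ f).elim
      · exact congrArg ULift.up ((argOp R (Sum.inr_ J K)).map_injective h)
    · rintro (X | X) (Y | Y) k
      · exact ⟨ULift.up ((argOp R (Sum.inl_ J K)).preimage k),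
          (argOp R (Sum.inl_ J K)).map_preimage k⟩
      · exact (hom_inl_inr_false _ _ (invCol X ≫ R.tgt.map k ≫ Y.col ⟨⟩)).elim
      · exact (hom_inr_inl_false _ _ (invCol X ≫ R.tgt.map k ≫ Y.col ⟨⟩)).elim
      · exact ⟨ULift.up ((argOp R (Sum.inr_ J K)).preimage k),
          (argOp R (Sum.inr_ J K)).map_preimage k⟩
    · intro c
      rcases h : R.tgt.obj c with j | k
      · exact ⟨.inl ⟨j, fun _ => c, fun _ => eqToHom h⟩, ⟨Iso.refl c⟩⟩
      · exact ⟨.inr ⟨k, fun _ => c, fun _ => eqToHom h⟩, ⟨Iso.refl c⟩⟩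
  pm
    | .inl X => sigmaUnit fun x => R.pm.obj (X.arg x)
    | .inr X => sigmaUnit fun x => R.pm.obj (X.arg x)
  pm_nat {c d} f := match c, d, f with
    | .inl _, .inl _, f => argOp_pm_nat f.down
    | .inr _, .inr _, f => argOp_pm_nat f.down
  tgt
    | .inl X => invCol X
    | .inr X => invCol X
  tgt_nat {c d} f := match c, d, f with
    | .inl _, .inl _, f => invCol_nat f.down
    | .inr _, .inr _, f => invCol_nat f.down

end FinPoly

namespace PolyObj

open FinPoly

/-- Pairing and then projecting gives back the two polynomials. -/
noncomputable def pairingProjections (I J K : PolyObj.{u}) :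
    𝟭 _ ≅ pairing I J K ⋙ projections I J K :=
  NatIso.ofComponents (fun P => Iso.prod (toPairInl P.1 P.2).toIso (toPairInr P.1 P.2).toIso) (by
    rintro ⟨P, P'⟩ ⟨Q, Q'⟩ ⟨⟨φ⟩, ⟨ψ⟩⟩
    refine Prod.ext (Quotient.sound (Setoid.symm ?_)) (Quotient.sound (Setoid.symm ?_))
    · refine toCompOfFunctor_nat φ (pairEqv φ ψ)
        { app := fun c => 𝟙 (Sum.inl (φ.op.obj c)),
          naturality := fun _ _ f => comp_id_eq_id_comp _ } (fun c => ?_) (fun c => ?_)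
      · refine (Category.id_comp _).trans ((comp_map_id _ _).trans (Category.comp_id _).symm)
      · refine (Category.id_comp _).trans (Eq.trans ?_ (congrArg _ (Category.comp_id _)).symm)
        exact (comp_map_id (pair Q Q').tgt (X := Sum.inl (φ.op.obj c))
          ((Sum.inl_ _ _).map (φ.tgt c))).symm
    · refine toCompOfFunctor_nat ψ (pairEqv φ ψ)
        { app := fun c => 𝟙 (Sum.inr (ψ.op.obj c)),
          naturality := fun _ _ f => comp_id_eq_id_comp _ } (fun c => ?_) (fun c => ?_)
      · refine (Category.id_comp _).trans ((comp_map_id _ _).trans (Category.comp_id _).symm)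
      · refine (Category.id_comp _).trans (Eq.trans ?_ (congrArg _ (Category.comp_id _)).symm)
        exact (comp_map_id (pair Q Q').tgt (X := Sum.inr (ψ.op.obj c))
          ((Sum.inr_ _ _).map (ψ.tgt c))).symm)

/-- A polynomial with values in a disjoint union is the pairing of its projections. -/
noncomputable def projectionsPairing (I J K : PolyObj.{u}) :
    projections I J K ⋙ pairing I J K ≅ 𝟭 _ :=
  NatIso.ofComponents (fun R => (pairProjections R).toIso) (by
    rintro R S ⟨φ⟩
    refine Quotient.sound (Eqv.equiv_mk
      (fun c => match c with
        | .inl X => 𝟙 (φ.op.obj (X.arg ⟨⟩))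
        | .inr X => 𝟙 (φ.op.obj (X.arg ⟨⟩))) ?_ ?_ ?_)
    · rintro (X | X) (Y | Y) f
      · exact comp_id_eq_id_comp _
      · exact (hom_inl_inr_false _ _ f).elim
      · exact (hom_inr_inl_false _ _ f).elim
      · exact comp_id_eq_id_comp _
    · rintro (X | X)
      · exact (comp_map_id _ _).trans (whiskerRight_sigmaUnit φ X)
      · exact (comp_map_id _ _).trans (whiskerRight_sigmaUnit φ X)
    · rintro (X | X)
      · exact (comp_map_id _ _).trans (whiskerRight_invCol φ X)
      · exact (comp_map_id _ _).trans (whiskerRight_invCol φ X))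

theorem projections_isEquivalence (I J K : PolyObj.{u}) : (projections I J K).IsEquivalence :=
  Functor.IsEquivalence.mk' (pairing I J K) (projectionsPairing I J K).symm
    (pairingProjections I J K).symm

end PolyObj

/-! ### Precomposition with a functor -/

namespace Fam

/-- Recolouring a family along a functor. -/
@[reducible] def recolour {A I : Type u} [Groupoid.{u} A] [Groupoid.{u} I] (F : A ⥤ I) :
    Fam A ⥤ Fam I where
  obj X := ⟨X.N, fun x => F.obj (X.col x)⟩
  map f := ⟨f.e, f.bij, fun x y h => F.map (f.iso x y h)⟩
  map_id X := hom_ext (fun _ => rfl) fun x y h h' => by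
    obtain rfl := h'
    exact F.map_id _
  map_comp f g := hom_ext (fun _ => rfl) fun x y h h' => F.map_comp _ _

end Fam

namespace FinPoly

variable {A I K : Type u} [Groupoid.{u} A] [Groupoid.{u} I] [Groupoid.{u} K]

/-- Recolouring the parameters of a polynomial along a functor. -/
@[reducible] def recolour (F : A ⥤ I) (P : FinPoly A K) : FinPoly I K where
  Op := P.Op
  pm := P.pm ⋙ Fam.recolour F
  tgt := P.tgt

/-- The action of recolouring on equivalences of polynomials. -/
@[reducible] def recolourEqv (F : A ⥤ I) {P Q : FinPoly A K} (φ : Eqv P Q) :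
    Eqv (recolour F P) (recolour F Q) where
  op := φ.op
  isEquivalence := φ.isEquivalence
  pm c := (Fam.recolour F).map (φ.pm c)
  pm_nat f := by
    refine ((Fam.recolour F).map_comp _ _).symm.trans (Eq.trans ?_ ((Fam.recolour F).map_comp _ _))
    exact congrArg _ (φ.pm_nat f)
  tgt := φ.tgt
  tgt_nat := φ.tgt_nat

/-- Recolouring, as a functor between groupoids of polynomials. -/
@[reducible] def recolourFunctor (F : A ⥤ I) (K : Type u) [Groupoid.{u} K] :
    FinPoly A K ⥤ FinPoly I K where
  obj := recolour F
  map {P Q} := Quotient.map (recolourEqv F) fun φ ψ ⟨θ⟩ => ⟨θ.app, fun c => by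
    refine ((Fam.recolour F).map_comp _ _).symm.trans ?_
    exact congrArg _ (θ.pm c), θ.tgt⟩
  map_id P := Quotient.sound (Eqv.equiv_congr (fun c => (Fam.recolour F).map_id _) fun c => rfl)
  map_comp {P Q R} := by
    rintro ⟨φ⟩ ⟨ψ⟩
    exact Quotient.sound (Eqv.equiv_congr (fun c => (Fam.recolour F).map_comp _ _) fun c => rfl)

/-- Precomposing a polynomial with a functor recolours its parameters. -/
@[reducible] noncomputable def ofFunctorComp (F : A ⥤ I) (P : FinPoly A K) :
    Eqv (comp (ofFunctor F) P) (recolour F P) where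
  op :=
    { obj := fun X => X.op
      map := fun f => f.base }
  isEquivalence := by
    refine { faithful := ⟨?_⟩, full := ⟨?_⟩, essSurj := ⟨?_⟩ }
    · intro X Y f g h
      have h : f.base = g.base := h
      refine CompOp.hom_ext h fun x y h₁ h₂ => (cancel_mono (Y.col y)).1 ?_
      refine (f.comm x y h₁).symm.trans (Eq.trans ?_ (g.comm x y h₂))
      exact congrArg _ (Fam.iso_congr (congrArg P.pm.map h) _ _ _ _)
    · intro X Y k
      exact ⟨⟨k, fun x y h => X.col x ≫ (P.pm.map k).iso x y h ≫ inv (Y.col y), fun x y h => by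
        simp⟩, rfl⟩
    · intro c
      exact ⟨⟨c, (P.pm.obj c).col, fun x => 𝟙 _⟩, ⟨Iso.refl c⟩⟩
  pm X :=
    { e := fun y => ⟨y, ⟨⟩⟩
      bij := ⟨fun y z h => congrArg Sigma.fst h, fun w => ⟨w.1, rfl⟩⟩
      iso := fun w y h => F.map (X.reindex (congrArg Sigma.fst h.symm) ≫ X.col y) }
  pm_nat {X Y} f := by
    refine Fam.hom_ext (fun _ => rfl) fun w v h h' => ?_
    obtain rfl := h'
    refine (F.map_comp _ _).symm.trans (Eq.trans ?_ (F.map_comp _ _))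
    refine congrArg F.map ?_
    refine Eq.trans ?_ (Category.assoc _ _ _).symm
    refine Eq.trans ?_ (Category.id_comp _).symm
    refine Eq.trans ?_ (f.comm _ v rfl).symm
    exact congrArg _ (Category.id_comp _)
  tgt X := 𝟙 (P.tgt.obj X.op)
  tgt_nat f := by simp

end FinPoly

namespace PolyObj

open FinPoly

/-- Precomposition with a functor is recolouring. -/
noncomputable def precompOfFunctor (A I K : PolyObj.{u}) (F : A.carrier ⥤ I.carrier) :
    Bicategory.precomp K (show I ⟶ A from ofFunctor F) ≅
      (show (A ⟶ K) ⥤ (I ⟶ K) from recolourFunctor F K.carrier) :=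
  NatIso.ofComponents (fun P => (ofFunctorComp F P).toIso) (by
    rintro P Q ⟨φ⟩
    refine Quotient.sound (Eqv.equiv_mk (fun X => 𝟙 (φ.op.obj X.op)) (fun X Y f => ?_)
      (fun X => ?_) (fun X => ?_))
    · exact comp_id_eq_id_comp _
    · refine (comp_map_id _ _).trans ?_
      refine Fam.hom_ext (fun _ => rfl) fun w v h h' => ?_
      obtain rfl := h
      refine (Category.id_comp _).trans (Eq.trans ?_ (F.map_comp _ _))
      exact congrArg F.map (Category.assoc _ _ _).symm
    · refine (comp_map_id _ _).trans ?_
      exact comp_id_eq_id_comp _)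

end PolyObj

/-! ### Uncurrying is evaluation -/

namespace FinPoly

variable {I J K : Type u} [Groupoid.{u} I] [Groupoid.{u} J] [Groupoid.{u} K]

/-- The product of `P` and the identity of `J`, in a form which is equivalent to the definition by
composites with projections: its operations are those of `P` and the objects of `J`. -/
@[reducible] def timesId (P : FinPoly I K) (J : Type u) [Groupoid.{u} J] :
    FinPoly (I ⊕ J) (K ⊕ J) :=
  pair (recolour (Sum.inl_ I J) P) (recolour (Sum.inr_ I J) (idPoly J))

/-- On operations with output colour in `J`, the output colour of `timesId P J` is the identity of
`J`, hence faithful. -/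
theorem timesId_tgt_injective {P : FinPoly I K} {a b : P.Op ⊕ J} {j : J}
    (k : (timesId P J).tgt.obj b ⟶ Sum.inr j) {f g : a ⟶ b}
    (h : (timesId P J).tgt.map f = (timesId P J).tgt.map g) : f = g := by
  rcases a with a | a <;> rcases b with b | b
  · exact (hom_inl_inr_false _ _ k).elim
  · exact (hom_inl_inr_false _ _ f).elim
  · exact (hom_inr_inl_false _ _ f).elim
  · exact h

/-- On operations with output colour in `J`, the output colour of `timesId P J` is the identity of
`J`, hence full. -/
theorem timesId_tgt_surjective {P : FinPoly I K} {a b : P.Op ⊕ J} {j : J}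
    (k : (timesId P J).tgt.obj b ⟶ Sum.inr j)
    (f : (timesId P J).tgt.obj a ⟶ (timesId P J).tgt.obj b) :
    ∃ g : a ⟶ b, (timesId P J).tgt.map g = f := by
  rcases a with a | a <;> rcases b with b | b
  · exact (hom_inl_inr_false _ _ k).elim
  · exact (hom_inl_inr_false _ _ f).elim
  · exact (hom_inr_inl_false _ _ f).elim
  · exact ⟨f, rfl⟩

/-- The evaluation polynomial, for groupoids. -/
@[reducible] def evPoly (J K : Type u) [Groupoid.{u} J] [Groupoid.{u} K] :
    FinPoly ((Exp J × K) ⊕ J) K := uncurry (idPoly (Exp J × K))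

/-- An operation of `(P × J) · ev` consists of an operation `(X, k)` of `ev`, an operation of `P`
of output colour `(X, k)`, and objects of `J` isomorphic to the members of `X`. This functor retains
the operation of `P`, which is an operation of `P × J` as nothing but its output colour places it in
the left summand. -/
@[reducible] noncomputable def evOp (P : FinPoly I (Exp J × K)) :
    CompOp (timesId P J) (evPoly J K) ⥤ (timesId P J).Op where
  obj X := X.arg (.inl ⟨⟩)
  map f := f.arg (.inl ⟨⟩) (.inl ⟨⟩) rfl
  map_id X := CompOp.id_arg X _ _ _ rfl

/-- The isomorphism, which is part of an operation of `(P × J) · ev`, between the output colour of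
the operation of `P` and the operation of `ev`. -/
@[reducible] def evCol {P : FinPoly I (Exp J × K)} (X : CompOp (timesId P J) (evPoly J K)) :
    (timesId P J).tgt.obj (X.arg (.inl ⟨⟩)) ⟶ (Sum.inl_ (Exp J × K) J).obj X.op := X.col (.inl ⟨⟩)

theorem evCol_nat {P : FinPoly I (Exp J × K)} {X Y : CompOp (timesId P J) (evPoly J K)}
    (f : X ⟶ Y) : evCol X ≫ (Sum.inl_ (Exp J × K) J).map f.base =
      (timesId P J).tgt.map ((evOp P).map f) ≫ evCol Y := f.comm (.inl ⟨⟩) (.inl ⟨⟩) rfl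

/-- A morphism is determined by the underlying morphism of operations of `P`: its component at the
operation of `ev` because `evCol` is invertible, those at the members of `X` by
`timesId_tgt_injective`. -/
instance (P : FinPoly I (Exp J × K)) : (evOp P).Faithful := ⟨fun {X Y f g} h => by
  have hb : f.base = g.base := (Sum.inl_ (Exp J × K) J).map_injective
    ((cancel_epi (evCol X)).1 (by rw [evCol_nat, evCol_nat, h]))
  -- The arrows at the members of `X` are determined by compatibility with output colours.
  refine CompOp.hom_ext hb ?_
  rintro (x | x) (y | y) h₁ h₂
  · exact h
  · cases h₁
  · cases h₁
  · refine timesId_tgt_injective (Y.col (.inr y)) ((cancel_mono (Y.col (.inr y))).1 ?_)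
    refine (f.comm _ _ h₁).symm.trans (Eq.trans ?_ (g.comm _ _ h₂))
    exact congrArg _ (Fam.iso_congr (congrArg (evPoly J K).pm.map hb) _ _ _ _)⟩

/-- The component at the operation of `ev` is the output colour of the given morphism, conjugated by
`evCol`, and those at the members of `X` are obtained from `timesId_tgt_surjective`. -/
instance (P : FinPoly I (Exp J × K)) : (evOp P).Full := ⟨fun {X Y} k => by
  obtain ⟨b, hb⟩ := (Sum.inl_ (Exp J × K) J).map_surjective
    (inv (evCol X) ≫ (timesId P J).tgt.map k ≫ evCol Y)
  have H : ∀ x y h, ∃ g : X.arg (.inr x) ⟶ Y.arg (.inr y),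
      X.col (.inr x) ≫ ((evPoly J K).pm.map b).iso (.inr x) (.inr y) h =
        (timesId P J).tgt.map g ≫ Y.col (.inr y) := fun x y h => by
    obtain ⟨g, hg⟩ := timesId_tgt_surjective (Y.col (.inr y))
      (X.col (.inr x) ≫ ((evPoly J K).pm.map b).iso _ _ h ≫ inv (Y.col (.inr y)))
    exact ⟨g, by rw [hg, Category.assoc, Category.assoc, IsIso.inv_hom_id, Category.comp_id]⟩
  choose g hg using H
  exact ⟨⟨b, fun x y h => match x, y, h with
      | .inl _, .inl _, _ => k
      | .inr x, .inr y, h => g x y h,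
    fun x y h => match x, y, h with
      | .inl _, .inl _, _ => (congrArg _ hb).trans (IsIso.hom_inv_id_assoc _ _)
      | .inr x, .inr y, h => hg x y h⟩, rfl⟩⟩

/-- An operation of `P`, with the members of the family in its output colour. -/
@[reducible] def evaluationArg (P : FinPoly I (Exp J × K)) (c : P.Op) :
    PUnit.{u + 1} ⊕ ULift.{u} (P.tgt.obj c).1.card.toFin → P.Op ⊕ J
  | .inl _ => .inl c
  | .inr x => .inr ((P.tgt.obj c).1.col x.down)

/-- An operation `c` of `P` with output colour `(X, k)`, as the operation of `(P × J) · ev` given by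
`(X, k)`, `c` and the members of `X`, with identities as isomorphisms of colours. -/
@[reducible] noncomputable def evaluationOp (P : FinPoly I (Exp J × K)) :
    P.Op ⥤ CompOp (timesId P J) (evPoly J K) where
  obj c := ⟨P.tgt.obj c, evaluationArg P c, fun x => match x with
    | .inl _ => 𝟙 (Sum.inl (P.tgt.obj c))
    | .inr x => 𝟙 (Sum.inr ((P.tgt.obj c).1.col x.down))⟩
  map f := ⟨P.tgt.map f,
    fun x y h => match x, y, h with
      | .inl _, .inl _, _ => ULift.up f
      | .inr x, .inr y, h => ULift.up ((Exp.toFam.map (P.tgt.map f).1).iso x y (Sum.inr.inj h)),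
    fun x y h => match x, y, h with
      | .inl _, .inl _, _ => (comp_id_eq_id_comp _).symm
      | .inr _, .inr _, _ => (comp_id_eq_id_comp _).symm⟩
  map_id _ := (evOp P).map_injective rfl
  map_comp _ _ := (evOp P).map_injective rfl

/-- Composing `evaluationOp P` with the fully faithful `evOp P` gives the inclusion of the left
summand of `P.Op ⊕ J`. -/
instance (P : FinPoly I (Exp J × K)) : (evaluationOp P).IsEquivalence := by
  refine { faithful := ⟨?_⟩, full := ⟨?_⟩, essSurj := ⟨?_⟩ }
  · intro X Y f g h
    exact congrArg ULift.down (congrArg (evOp P).map h)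
  · intro X Y k
    exact ⟨((evOp P).map k).down, (evOp P).map_injective rfl⟩
  · intro Z
    -- The output colour of `(evOp P).obj Z` lies in the left summand, so it is an operation of `P`.
    obtain ⟨c, ⟨e⟩⟩ : ∃ c, Nonempty (Sum.inl c ⟶ (evOp P).obj Z) := by
      have f := evCol Z
      change (timesId P J).tgt.obj ((evOp P).obj Z) ⟶ _ at f
      revert f
      rcases (evOp P).obj Z with c | j
      · exact fun _ => ⟨c, ⟨𝟙 _⟩⟩
      · exact fun f => (hom_inr_inl_false _ _ f).elim
    exact ⟨c, ⟨(Groupoid.isoEquivHom _ _).symm ((evOp P).preimage e)⟩⟩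

/-- The parameters of `evaluationOp P` at `c` are those of `c` and the members of the family in its
output colour. -/
@[reducible] def evaluationIndex (P : FinPoly I (Exp J × K)) (c : P.Op) :
    ∀ x : PUnit.{u + 1} ⊕ ULift.{u} (P.tgt.obj c).1.card.toFin,
      ((timesId P J).pm.obj (evaluationArg P c x)).N →
      (P.pm.obj c).N ⊕ ULift.{u} (P.tgt.obj c).1.card.toFin
  | .inl _ => fun n => Sum.inl n
  | .inr x => fun _ => Sum.inr x

/-- The isomorphism of families given by `evaluationIndex`. -/
@[reducible] noncomputable def evaluationPm (P : FinPoly I (Exp J × K)) (c : P.Op) :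
    (uncurry P).pm.obj c ⟶ (comp (timesId P J) (evPoly J K)).pm.obj ((evaluationOp P).obj c) where
  e w := evaluationIndex P c w.1 w.2
  bij := by
    constructor
    · rintro ⟨_ | x, n⟩ ⟨_ | y, m⟩ h <;> cases h <;> rfl
    · rintro (n | x)
      · exact ⟨⟨.inl ⟨⟩, n⟩, rfl⟩
      · exact ⟨⟨.inr x, ⟨⟩⟩, rfl⟩
  iso v w h := eqToHom (by subst h; rcases w with ⟨_ | x, n⟩ <;> rfl)

theorem evaluationPm_nat (P : FinPoly I (Exp J × K)) {c d : P.Op} (f : c ⟶ d) :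
    (uncurry P).pm.map f ≫ evaluationPm P d =
      evaluationPm P c ≫ (comp (timesId P J) (evPoly J K)).pm.map ((evaluationOp P).map f) := by
  refine Fam.hom_ext ?_ ?_
  · rintro ⟨_ | x, n⟩ <;> rfl
  · rintro v ⟨_ | x, n⟩ h h'
    · obtain rfl := h
      exact comp_id_eq_id_comp _
    · obtain rfl := h
      exact comp_id_eq_id_comp _

/-- `uncurry P` is equivalent to `(P × J) · ev`. -/
@[reducible] noncomputable def toEvaluation (P : FinPoly I (Exp J × K)) :
    Eqv (uncurry P) (comp (timesId P J) (evPoly J K)) where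
  op := evaluationOp P
  isEquivalence := inferInstance
  pm := evaluationPm P
  pm_nat := evaluationPm_nat P
  tgt c := 𝟙 (P.tgt.obj c).2
  tgt_nat _ := comp_id_eq_id_comp _

/-- The action of `timesId` on equivalences of polynomials. -/
@[reducible] noncomputable def timesIdEqv {P Q : FinPoly I K} (φ : Eqv P Q) (J : Type u)
    [Groupoid.{u} J] : Eqv (timesId P J) (timesId Q J) :=
  pairEqv (recolourEqv (Sum.inl_ I J) φ) (Eqv.refl _)

section

variable {C : Type u} [Groupoid.{u} C] {x y : C}

theorem inv_id_comp (a : x ⟶ y) {k : y ⟶ y} (hk : k = 𝟙 y) :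
    (inv a ≫ 𝟙 x) ≫ a = k ≫ 𝟙 y := by simp [hk]

theorem inv_id_id_comp (b : x ⟶ y) : (inv (𝟙 x) ≫ 𝟙 x) ≫ b = b ≫ 𝟙 y := by simp

theorem id_id_comp (a : x ⟶ y) {k : y ⟶ y} (hk : k = 𝟙 y) :
    (𝟙 x ≫ 𝟙 x ≫ a) ≫ k = a ≫ 𝟙 y := by simp [hk]

theorem id_id_id_comp (b : x ⟶ y) : (𝟙 x ≫ 𝟙 x ≫ 𝟙 x) ≫ b = b ≫ 𝟙 y := by simp

end

/-- The arrows at the parameters of `ev` in `evaluationNat`. -/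
@[reducible] noncomputable def evaluationNatArg {P Q : FinPoly I (Exp J × K)} (φ : Eqv P Q)
    (c : P.Op) : ∀ (x : PUnit.{u + 1} ⊕ ULift.{u} (P.tgt.obj c).1.card.toFin)
    (y : PUnit.{u + 1} ⊕ ULift.{u} (Q.tgt.obj (φ.op.obj c)).1.card.toFin),
    ((evPoly J K).pm.map (φ.tgt c)).e y = x →
    ((timesIdEqv φ J).op.obj (evaluationArg P c x) ⟶ evaluationArg Q (φ.op.obj c) y)
  | .inl _, .inl _, _ => 𝟙 (Sum.inl (φ.op.obj c))
  | .inr x, .inr y, h => ULift.up ((Exp.toFam.map (φ.tgt c).1).iso x y (Sum.inr.inj h))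

theorem evaluationNatArg_comm {P Q : FinPoly I (Exp J × K)} (φ : Eqv P Q) (c : P.Op) :
    ∀ x y h, ((whiskerRight (timesIdEqv φ J) (evPoly J K)).op.obj ((evaluationOp P).obj c)).col x ≫
      ((evPoly J K).pm.map (φ.tgt c)).iso x y h =
    (timesId Q J).tgt.map (evaluationNatArg φ c x y h) ≫
      ((evaluationOp Q).obj (φ.op.obj c)).col y
  | .inl _, .inl _, _ => inv_id_comp (C := (Exp J × K) ⊕ J) (x := Sum.inl (P.tgt.obj c))
      (y := Sum.inl (Q.tgt.obj (φ.op.obj c))) (ULift.up (φ.tgt c))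
      ((timesId Q J).tgt.map_id (Sum.inl (φ.op.obj c)))
  | .inr x, .inr y, h => inv_id_id_comp (C := (Exp J × K) ⊕ J)
      (x := Sum.inr ((P.tgt.obj c).1.col x.down))
      (y := Sum.inr ((Q.tgt.obj (φ.op.obj c)).1.col y.down))
      (ULift.up ((Exp.toFam.map (φ.tgt c).1).iso x y (Sum.inr.inj h)))

/-- The isomorphism which makes `evaluationOp` natural with respect to an equivalence `φ`. Its
component at the operation of `ev` is `φ.tgt c`, as the members of `X` come
from the output colour of `c` on one side and from that of `φ c` on the other. -/
@[reducible] noncomputable def evaluationNat {P Q : FinPoly I (Exp J × K)} (φ : Eqv P Q)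
    (c : P.Op) :
    (whiskerRight (timesIdEqv φ J) (evPoly J K)).op.obj ((evaluationOp P).obj c) ⟶
      (evaluationOp Q).obj (φ.op.obj c) where
  base := φ.tgt c
  arg := evaluationNatArg φ c
  comm := evaluationNatArg_comm φ c

theorem evaluationNat_pm_inl {P Q : FinPoly I (Exp J × K)} (φ : Eqv P Q) (c : P.Op)
    (n : (Q.pm.obj (φ.op.obj c)).N) :
    ((comp (timesId Q J) (evPoly J K)).pm.map (evaluationNat φ c)).e ⟨.inl ⟨⟩, n⟩ =
      ⟨.inl ⟨⟩, n⟩ :=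
  congrArg (Sigma.mk (Sum.inl PUnit.unit))
    (CompOp.map_id_e (Q := timesId Q J) (Sum.inl (φ.op.obj c)) n)

theorem toEvaluation_nat_pm {P Q : FinPoly I (Exp J × K)} (φ : Eqv P Q) (c : P.Op) :
    ((toEvaluation P).trans (whiskerRight (timesIdEqv φ J) (evPoly J K))).pm c ≫
      (comp (timesId Q J) (evPoly J K)).pm.map (evaluationNat φ c) =
      (((uncurryEqv P Q).obj φ).trans (toEvaluation Q)).pm c := by
  refine Fam.hom_ext ?_ ?_
  · rintro ⟨_ | x, n⟩
    · exact congrArg (((toEvaluation P).trans (whiskerRight (timesIdEqv φ J) (evPoly J K))).pm c).e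
        (evaluationNat_pm_inl φ c n)
    · rfl
  · rintro v ⟨_ | x, n⟩ h h'
    · obtain rfl := h'
      refine (Fam.comp_iso _ _ _ _ _ _ rfl (evaluationNat_pm_inl φ c n)).trans ?_
      refine id_id_comp (C := I ⊕ J) (x := Sum.inl ((P.pm.obj c).col ((φ.pm c).e n)))
        (y := Sum.inl ((Q.pm.obj (φ.op.obj c)).col n)) (ULift.up ((φ.pm c).iso _ n rfl)) ?_
      exact CompOp.map_id_iso (Q := timesId Q J) (Sum.inl (φ.op.obj c)) n n
        (CompOp.map_id_e (Q := timesId Q J) (Sum.inl (φ.op.obj c)) n) rfl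
    · obtain rfl := h'
      exact id_id_id_comp (C := I ⊕ J) (x := Sum.inr ((P.tgt.obj c).1.col
        ((Exp.toFam.map (φ.tgt c).1).e x).down))
        (y := Sum.inr ((Q.tgt.obj (φ.op.obj c)).1.col x.down))
        (ULift.up ((Exp.toFam.map (φ.tgt c).1).iso _ x rfl))

/-- The equivalences `toEvaluation` are natural. -/
theorem toEvaluation_nat {P Q : FinPoly I (Exp J × K)} (φ : Eqv P Q) :
    (toEvaluation P).trans (whiskerRight (timesIdEqv φ J) (evPoly J K)) ≈
      ((uncurryEqv P Q).obj φ).trans (toEvaluation Q) := by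
  refine Eqv.equiv_mk (evaluationNat φ) (fun c d f => ?_) (toEvaluation_nat_pm φ) (fun c => ?_)
  · refine (evOp Q).map_injective ?_
    exact comp_id_eq_id_comp _
  · change (𝟙 (P.tgt.obj c).2 ≫ 𝟙 (P.tgt.obj c).2) ≫ (φ.tgt c).2 = (φ.tgt c).2 ≫ 𝟙 _
    simp

end FinPoly

namespace PolyObj

open FinPoly

/-- The functor `P ↦ (P × J) ≫ ev`, with the product in the form `timesId`. -/
noncomputable def timesIdEvaluation (I J K : PolyObj.{u}) :
    (I ⟶ ihom J K) ⥤ (prod I J ⟶ K) :=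
  Functor.prod' (show (I ⟶ ihom J K) ⥤ (prod I J ⟶ ihom J K) from
      recolourFunctor (Sum.inl_ I.carrier J.carrier) _)
    ((Functor.const _).obj (show prod I J ⟶ J from
      recolour (Sum.inr_ I.carrier J.carrier) (idPoly J.carrier))) ⋙
    pairing (prod I J) (ihom J K) J ⋙ Bicategory.postcomp (prod I J) (ev J K)

/-- Precomposition with the projections of a product is recolouring along the inclusions. -/
noncomputable def precompProjections (I J K : PolyObj.{u}) :
    (𝟭 (I ⟶ ihom J K)).prod' ((Functor.const _).obj (𝟙 J)) ⋙
      (Bicategory.precomp (ihom J K) (projl I J)).prod (Bicategory.precomp J (projr I J)) ≅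
    Functor.prod' (show (I ⟶ ihom J K) ⥤ (prod I J ⟶ ihom J K) from
      recolourFunctor (Sum.inl_ I.carrier J.carrier) _)
    ((Functor.const _).obj (show prod I J ⟶ J from
      recolour (Sum.inr_ I.carrier J.carrier) (idPoly J.carrier))) :=
  NatIso.ofComponents (fun P => Iso.prod
      ((precompOfFunctor I (prod I J) (ihom J K) (Sum.inl_ I.carrier J.carrier)).app P)
      ((precompOfFunctor J (prod I J) J (Sum.inr_ I.carrier J.carrier)).app (𝟙 J)))
      fun f => Prod.ext
        ((precompOfFunctor I (prod I J) (ihom J K) (Sum.inl_ I.carrier J.carrier)).hom.naturality f)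
        ((precompOfFunctor J (prod I J) J (Sum.inr_ I.carrier J.carrier)).hom.naturality (𝟙 (𝟙 J))
          |>.trans (congrArg _ (CategoryTheory.Functor.map_id _ _)))

/-- The two forms of the product `P × J` give isomorphic functors `P ↦ (P × J) ≫ ev`. -/
noncomputable def evaluationIso (I J K : PolyObj.{u}) :
    evaluation I J K ≅ timesIdEvaluation I J K :=
  Functor.isoWhiskerRight (precompProjections I J K)
    (pairing (prod I J) (ihom J K) J ⋙ Bicategory.postcomp (prod I J) (ev J K))

/-- Uncurrying is `P ↦ (P × J) ≫ ev`, with the product in the form `timesId`. -/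
noncomputable def uncurryingIsoTimesIdEvaluation (I J K : PolyObj.{u}) :
    uncurrying I J K ≅ timesIdEvaluation I J K :=
  NatIso.ofComponents (fun P => (toEvaluation P).toIso) (by
    rintro P Q ⟨φ⟩
    exact Quotient.sound (Setoid.symm (toEvaluation_nat φ)))

/-- Uncurrying is `P ↦ (P × J) ≫ ev`. -/
noncomputable def uncurryingIso (I J K : PolyObj.{u}) :
    uncurrying I J K ≅ evaluation I J K :=
  uncurryingIsoTimesIdEvaluation I J K ≪≫ (evaluationIso I J K).symm

/-- `uncurryCurryIso` in terms of the functors between categories of morphisms. -/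
noncomputable def curryingUncurrying (I J K : PolyObj.{u}) :
    currying I J K ⋙ uncurrying I J K ≅ 𝟭 _ :=
  (uncurryCurryIso I.carrier J.carrier K.carrier).symm

/-- `curryUncurryIso` in terms of the functors between categories of morphisms. -/
noncomputable def uncurryingCurrying (I J K : PolyObj.{u}) :
    uncurrying I J K ⋙ currying I J K ≅ 𝟭 _ :=
  curryUncurryIso I.carrier J.carrier K.carrier

instance (I J K : PolyObj.{u}) : (projections I J K).IsEquivalence :=
  projections_isEquivalence I J K

instance uncurrying_isEquivalence (I J K : PolyObj.{u}) : (uncurrying I J K).IsEquivalence :=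
  Functor.IsEquivalence.mk' (currying I J K) (uncurryingCurrying I J K).symm
    (curryingUncurrying I J K)

instance evaluation_isEquivalence (I J K : PolyObj.{u}) : (evaluation I J K).IsEquivalence :=
  Functor.isEquivalence_of_iso (uncurryingIso I J K)

/-- A morphism of polynomials is represented by an equivalence, so it is invertible. -/
instance isIso_hom {I J : PolyObj.{u}} {P Q : I ⟶ J} (f : P ⟶ Q) : IsIso f := by
  induction f using Quotient.ind with
  | _ φ => exact (Eqv.toIso φ).isIso_hom

/-! ### The terminal object -/

/-- Polynomials with values in the empty groupoid have no operations, so that they are equivalent in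
a unique way. -/
noncomputable def homEmpty (I : PolyObj.{u}) : (I ⟶ empty.{u}) ≌ Discrete PUnit.{1} := by
  let F : (I ⟶ empty.{u}) ⥤ Discrete PUnit.{1} := (Functor.const _).obj ⟨⟨⟩⟩
  have h : ∀ (P : FinPoly I.carrier (Discrete PEmpty.{u + 1})), IsEmpty P.Op :=
    fun P => ⟨fun c => (P.tgt.obj c).as.elim⟩
  have hF : F.IsEquivalence :=
    { faithful := ⟨by
        rintro P Q ⟨φ⟩ ⟨ψ⟩ _
        exact Quotient.sound (Eqv.equiv_mk (fun c => ((h P).false c).elim)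
          (fun c => ((h P).false c).elim) (fun c => ((h P).false c).elim)
          (fun c => ((h P).false c).elim))⟩
      full := ⟨fun {P Q} f => ⟨⟦{
        op :=
          { obj := fun c => ((h P).false c).elim
            map := fun {c} => ((h P).false c).elim
            map_id := fun c => ((h P).false c).elim
            map_comp := fun {c} => ((h P).false c).elim }
        isEquivalence :=
          { faithful := ⟨fun {c} => ((h P).false c).elim⟩
            full := ⟨fun {c} => ((h P).false c).elim⟩
            essSurj := ⟨fun c => ((h Q).false c).elim⟩ }
        pm := fun c => ((h P).false c).elim
        pm_nat := fun {c} => ((h P).false c).elim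
        tgt := fun c => ((h P).false c).elim
        tgt_nat := fun {c} => ((h P).false c).elim }⟧, Subsingleton.elim _ _⟩⟩
      essSurj := ⟨fun _ => ⟨(⟨Discrete PEmpty.{u + 1}, Discrete.functor fun x => x.elim, 𝟭 _⟩ :
        FinPoly I.carrier (Discrete PEmpty.{u + 1})), ⟨Discrete.eqToIso rfl⟩⟩⟩ }
  exact F.asEquivalence

end PolyObj

/-! ### Naturality of currying -/

namespace PolyObj

open Functor Bicategory

section bicategory

variable {B : Type*} [Bicategory B] {a b c d : B}

/-- `associatorNatIsoLeft` in terms of the functors `postcomp`. -/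
def postcompComp (a : B) (g : b ⟶ c) (h : c ⟶ d) :
    postcomp a g ⋙ postcomp a h ≅ postcomp a (g ≫ h) := associatorNatIsoLeft a g h

/-- `associatorNatIsoMiddle` in terms of the functors `precomp` and `postcomp`. -/
def precompPostcomp (f : a ⟶ b) (h : c ⟶ d) :
    precomp c f ⋙ postcomp a h ≅ postcomp b h ⋙ precomp d f := associatorNatIsoMiddle f h

/-- `associatorNatIsoRight` in terms of the functors `precomp`. -/
def precompComp (f : a ⟶ b) (g : b ⟶ c) (d : B) :
    precomp d (f ≫ g) ≅ precomp d g ⋙ precomp d f := associatorNatIsoRight f g d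

/-- Precomposition with isomorphic morphisms. -/
def precompCongr (c : B) {f g : a ⟶ b} (e : f ≅ g) : precomp c f ≅ precomp c g :=
  (precomposing a b c).mapIso e

/-- Postcomposition with isomorphic morphisms. -/
def postcompCongr (a : B) {f g : b ⟶ c} (e : f ≅ g) : postcomp a f ≅ postcomp a g :=
  (postcomposing a b c).mapIso e

end bicategory

variable {I J K L M : PolyObj.{u}} {C : Type*} [Category* C]

/-- Functors into morphisms to a product are isomorphic if their projections are. -/
noncomputable def prodExt {F G : C ⥤ (I ⟶ prod J K)}
    (α : F ⋙ postcomp I (projl J K) ≅ G ⋙ postcomp I (projl J K))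
    (β : F ⋙ postcomp I (projr J K) ≅ G ⋙ postcomp I (projr J K)) : F ≅ G :=
  fullyFaithfulCancelRight (projections I J K)
    (NatIso.ofComponents (fun X => Iso.prod (α.app X) (β.app X)) fun f =>
      Prod.ext (α.hom.naturality f) (β.hom.naturality f))

/-- The functor `P ↦ P × Q`. -/
noncomputable abbrev timesWith (I L : PolyObj.{u}) (Q : J ⟶ K) :
    (I ⟶ L) ⥤ (prod I J ⟶ prod L K) :=
  (𝟭 (I ⟶ L)).prod' ((Functor.const _).obj Q) ⋙ times I L J K

/-- The functor `P ↦ P × Q` depends on `Q` only up to isomorphism. -/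
noncomputable def timesWithCongr (I L : PolyObj.{u}) {Q Q' : J ⟶ K} (e : Q ≅ Q') :
    timesWith I L Q ≅ timesWith I L Q' :=
  isoWhiskerRight (NatIso.ofComponents (fun P => Iso.prod (Iso.refl P) e) fun f =>
    Prod.ext (comp_id_eq_id_comp f) (comp_id_eq_id_comp e.hom).symm) (times I L J K)

/-- The first projection of `P × Q` is `P` on the first factor, naturally in `P`. -/
noncomputable def timesWithProjl (I L : PolyObj.{u}) (Q : J ⟶ K) :
    timesWith I L Q ⋙ postcomp (prod I J) (projl L K) ≅ precomp L (projl I J) :=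
  isoWhiskerLeft ((𝟭 (I ⟶ L)).prod' ((Functor.const _).obj Q) ⋙
      (precomp L (projl I J)).prod (precomp K (projr I J)))
    (isoWhiskerRight (pairingProjections (prod I J) L K).symm (CategoryTheory.Prod.fst _ _))

/-- The second projection of `P × Q` is `Q` on the second factor, naturally in `P`. -/
noncomputable def timesWithProjr (I L : PolyObj.{u}) (Q : J ⟶ K) :
    timesWith I L Q ⋙ postcomp (prod I J) (projr L K) ≅
      (Functor.const _).obj (projr I J ≫ Q) :=
  isoWhiskerLeft ((𝟭 (I ⟶ L)).prod' ((Functor.const _).obj Q) ⋙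
      (precomp L (projl I J)).prod (precomp K (projr I J)))
    (isoWhiskerRight (pairingProjections (prod I J) L K).symm (CategoryTheory.Prod.snd _ _)) ≪≫
    NatIso.ofComponents (fun _ => Iso.refl _) fun f => by
      refine (Category.comp_id _).trans (Eq.trans ?_ (Category.id_comp _).symm)
      exact (precomp K (projr I J)).map_id Q

/-- `timesWithProjl` for a single `P`. -/
noncomputable def timesProjl (P : I ⟶ L) (Q : J ⟶ K) :
    (times I L J K).obj (P, Q) ≫ projl L K ≅ projl I J ≫ P := (timesWithProjl I L Q).app P

/-- `timesWithProjr` for a single `P`. -/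
noncomputable def timesProjr (P : I ⟶ L) (Q : J ⟶ K) :
    (times I L J K).obj (P, Q) ≫ projr L K ≅ projr I J ≫ Q := (timesWithProjr I L Q).app P

variable {J' J'' : PolyObj.{u}}

/-- The product preserves composition, naturally in the first of two morphisms. -/
noncomputable def timesWithPostcomp (I : PolyObj.{u}) (P : L ⟶ M) (Q : J ⟶ J') (Q' : J' ⟶ J'') :
    timesWith I L Q ⋙ postcomp (prod I J) ((times L M J' J'').obj (P, Q')) ≅
      postcomp I P ⋙ timesWith I M (Q ≫ Q') :=
  prodExt
    (isoWhiskerLeft (timesWith I L Q) (postcompComp _ _ _ ≪≫ postcompCongr _ (timesProjl P Q') ≪≫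
        (postcompComp _ _ _).symm) ≪≫
      isoWhiskerRight (timesWithProjl I L Q) (postcomp _ P) ≪≫ precompPostcomp _ _ ≪≫
      isoWhiskerLeft (postcomp I P) (timesWithProjl I M (Q ≫ Q')).symm)
    (isoWhiskerLeft (timesWith I L Q) (postcompComp _ _ _ ≪≫ postcompCongr _ (timesProjr P Q') ≪≫
        (postcompComp _ _ _).symm) ≪≫
      isoWhiskerRight (timesWithProjr I L Q) (postcomp _ Q') ≪≫
      Functor.constComp _ _ _ ≪≫ (Functor.const _).mapIso (α_ _ _ _) ≪≫
      isoWhiskerLeft (postcomp I P) (timesWithProjr I M (Q ≫ Q')).symm)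

/-- The product preserves composition, naturally in the second of two morphisms. -/
noncomputable def timesWithPrecomp (M : PolyObj.{u}) (P : I ⟶ L) (Q : J ⟶ J') (Q' : J' ⟶ J'') :
    timesWith L M Q' ⋙ precomp (prod M J'') ((times I L J J').obj (P, Q)) ≅
      precomp M P ⋙ timesWith I M (Q ≫ Q') :=
  prodExt
    (isoWhiskerLeft (timesWith L M Q') (precompPostcomp _ _) ≪≫
      isoWhiskerRight (timesWithProjl L M Q') (precomp _ _) ≪≫ (precompComp _ _ _).symm ≪≫
      precompCongr _ (timesProjl P Q) ≪≫ precompComp _ _ _ ≪≫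
      isoWhiskerLeft (precomp M P) (timesWithProjl I M (Q ≫ Q')).symm)
    (isoWhiskerLeft (timesWith L M Q') (precompPostcomp _ _) ≪≫
      isoWhiskerRight (timesWithProjr L M Q') (precomp _ _) ≪≫
      Functor.constComp _ _ _ ≪≫ (Functor.const _).mapIso ((α_ _ _ _).symm ≪≫
        whiskerRightIso (timesProjr P Q) Q' ≪≫ α_ _ _ _) ≪≫
      isoWhiskerLeft (precomp M P) (timesWithProjr I M (Q ≫ Q')).symm)

/-- Evaluation is natural in the source. -/
noncomputable def precompEvaluation (J K : PolyObj.{u}) (P : I ⟶ L) :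
    precomp (ihom J K) P ⋙ evaluation I J K ≅
      evaluation L J K ⋙ precomp K ((times I L J J).obj (P, 𝟙 J)) :=
  isoWhiskerRight (isoWhiskerLeft (precomp (ihom J K) P) (timesWithCongr I _ (λ_ (𝟙 J)).symm) ≪≫
    (timesWithPrecomp (ihom J K) P (𝟙 J) (𝟙 J)).symm) (postcomp _ (ev J K)) ≪≫
  isoWhiskerLeft (timesWith L (ihom J K) (𝟙 J)) (precompPostcomp _ (ev J K))

/-- The evaluation of `P ≫ W` is `(P × J)` followed by the uncurrying of `W`. -/
noncomputable def postcompEvaluation (I : PolyObj.{u}) (W : L ⟶ ihom J K) :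
    postcomp I W ⋙ evaluation I J K ≅
      timesWith I L (𝟙 J) ⋙ postcomp (prod I J) ((uncurrying L J K).obj W) :=
  isoWhiskerRight (isoWhiskerLeft (postcomp I W) (timesWithCongr I _ (λ_ (𝟙 J)).symm) ≪≫
    (timesWithPostcomp I W (𝟙 J) (𝟙 J)).symm) (postcomp _ (ev J K)) ≪≫
  isoWhiskerLeft (timesWith I L (𝟙 J)) (postcompComp _ _ _ ≪≫
    postcompCongr _ ((uncurryingIso L J K).symm.app W))

/-- Functors into morphisms to an internal hom are isomorphic if their uncurryings are. -/
noncomputable def ihomExt {F G : C ⥤ (I ⟶ ihom J K)}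
    (α : F ⋙ uncurrying I J K ≅ G ⋙ uncurrying I J K) : F ≅ G :=
  fullyFaithfulCancelRight (uncurrying I J K) α

/-- Evaluation is left inverse to currying. -/
noncomputable def curryingEvaluation (I J K : PolyObj.{u}) :
    currying I J K ⋙ evaluation I J K ≅ 𝟭 _ :=
  isoWhiskerLeft (currying I J K) (uncurryingIso I J K).symm ≪≫ curryingUncurrying I J K

/-- Currying is natural in the source. -/
noncomputable def precompCurrying (J K : PolyObj.{u}) (P : L ⟶ I) :
    precomp K ((times L I J J).obj (P, 𝟙 J)) ⋙ currying L J K ≅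
      currying I J K ⋙ precomp (ihom J K) P :=
  ihomExt (isoWhiskerLeft (precomp K ((times L I J J).obj (P, 𝟙 J))) (curryingUncurrying L J K) ≪≫
    isoWhiskerRight (curryingEvaluation I J K).symm
      (precomp K ((times L I J J).obj (P, 𝟙 J))) ≪≫
    isoWhiskerLeft (currying I J K) ((precompEvaluation J K P).symm ≪≫
      isoWhiskerLeft (precomp (ihom J K) P) (uncurryingIso L J K).symm))

/-- If under evaluation a functor `F` corresponds to `P ↦ (P × J') ≫ U`, then under currying it
corresponds to postcomposition with the currying of `U`. -/
noncomputable def postcompCurrying {I J J' K K' : PolyObj.{u}}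
    (F : (prod I J ⟶ K) ⥤ (prod I J' ⟶ K')) (U : prod (ihom J K) J' ⟶ K')
    (α : evaluation I J K ⋙ F ≅ timesWith I (ihom J K) (𝟙 J') ⋙ postcomp _ U) :
    F ⋙ currying I J' K' ≅
      currying I J K ⋙ postcomp I ((currying (ihom J K) J' K').obj U) :=
  ihomExt (isoWhiskerLeft F (curryingUncurrying I J' K') ≪≫
    isoWhiskerRight (curryingEvaluation I J K).symm F ≪≫
    isoWhiskerLeft (currying I J K) (α ≪≫
      isoWhiskerLeft (timesWith I (ihom J K) (𝟙 J'))
        (postcompCongr _ ((curryingUncurrying (ihom J K) J' K').symm.app U)) ≪≫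
      (postcompEvaluation I ((currying (ihom J K) J' K').obj U)).symm ≪≫
      isoWhiskerLeft (postcomp I ((currying (ihom J K) J' K').obj U))
        (uncurryingIso I J' K').symm))

/-- The interchange `(1 × Q) ≫ (P × 1) ≅ (P × 1) ≫ (1 × Q)`, natural in `P`. -/
noncomputable def timesWithInterchange (I L : PolyObj.{u}) (Q : J ⟶ K) :
    timesWith I L (𝟙 K) ⋙ precomp (prod L K) ((times I I J K).obj (𝟙 I, Q)) ≅
      timesWith I L (𝟙 J) ⋙ postcomp (prod I J) ((times L L J K).obj (𝟙 L, Q)) :=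
  timesWithPrecomp L (𝟙 I) Q (𝟙 K) ≪≫
    isoWhiskerRight (leftUnitorNatIso I L) (timesWith I L (Q ≫ 𝟙 K)) ≪≫
    timesWithCongr I L (ρ_ Q ≪≫ (λ_ Q).symm) ≪≫
    isoWhiskerRight (rightUnitorNatIso I L).symm (timesWith I L (𝟙 J ≫ Q)) ≪≫
    (timesWithPostcomp I (𝟙 L) (𝟙 J) Q).symm

/-- Postcomposition with `R` corresponds under evaluation to `ev ≫ R`, as `postcompCurrying`
requires. -/
noncomputable def evaluationPostcomp (I J : PolyObj.{u}) {K K' : PolyObj.{u}} (R : K ⟶ K') :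
    evaluation I J K ⋙ postcomp (prod I J) R ≅
      timesWith I (ihom J K) (𝟙 J) ⋙ postcomp (prod I J) (ev J K ≫ R) :=
  isoWhiskerLeft (timesWith I (ihom J K) (𝟙 J)) (postcompComp _ _ _)

/-- Precomposition with `1 × Q` corresponds under evaluation to `(1 × Q) ≫ ev`, as
`postcompCurrying` requires. This is the interchange of `P × 1` and `1 × Q`. -/
noncomputable def evaluationPrecomp (I K : PolyObj.{u}) {J J' : PolyObj.{u}} (Q : J' ⟶ J) :
    evaluation I J K ⋙ precomp K ((times I I J' J).obj (𝟙 I, Q)) ≅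
      timesWith I (ihom J K) (𝟙 J') ⋙ postcomp (prod I J')
        ((times (ihom J K) (ihom J K) J' J).obj (𝟙 _, Q) ≫ ev J K) :=
  isoWhiskerLeft (timesWith I (ihom J K) (𝟙 J)) (precompPostcomp _ (ev J K)).symm ≪≫
    isoWhiskerRight (timesWithInterchange I (ihom J K) Q) (postcomp _ (ev J K)) ≪≫
    isoWhiskerLeft (timesWith I (ihom J K) (𝟙 J')) (postcompComp _ _ _)

end PolyObj

theorem mainTheorem1 :
    (∀ (I J : PolyObj.{u}) (P Q : I ⟶ J) (f : P ⟶ Q), IsIso f) ∧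
    (∀ I : PolyObj.{u}, Nonempty ((I ⟶ PolyObj.empty.{u}) ≌ Discrete PUnit.{1})) ∧
    (∀ I J K : PolyObj.{u}, (PolyObj.projections I J K).IsEquivalence ∧
      Nonempty (PolyObj.pairing I J K ⋙ PolyObj.projections I J K ≅ 𝟭 _)) ∧
    (∀ I J K : PolyObj.{u}, (PolyObj.evaluation I J K).IsEquivalence ∧
      Nonempty (PolyObj.uncurrying I J K ≅ PolyObj.evaluation I J K)) ∧
    (∀ I J K : PolyObj.{u},
      Nonempty (PolyObj.currying I J K ⋙ PolyObj.uncurrying I J K ≅ 𝟭 _) ∧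
      Nonempty (PolyObj.uncurrying I J K ⋙ PolyObj.currying I J K ≅ 𝟭 _)) ∧
    (∀ (I J K : Type u) [Groupoid.{u} I] [Groupoid.{u} J] [Groupoid.{u} K]
      (P Q : FinPoly (I ⊕ J) K), (FinPoly.curryEqv P Q).IsEquivalence) ∧
    (∀ (I I' J K : PolyObj.{u}) (P : I' ⟶ I),
      Nonempty (Bicategory.precomp K ((PolyObj.times I' I J J).obj (P, 𝟙 J)) ⋙
          PolyObj.currying I' J K ≅
        PolyObj.currying I J K ⋙ Bicategory.precomp (PolyObj.ihom J K) P)) ∧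
    (∀ (I J K K' : PolyObj.{u}) (R : K ⟶ K'),
      Nonempty (Bicategory.postcomp (PolyObj.prod I J) R ⋙ PolyObj.currying I J K' ≅
        PolyObj.currying I J K ⋙ Bicategory.postcomp I
          ((PolyObj.currying (PolyObj.ihom J K) J K').obj (PolyObj.ev J K ≫ R)))) ∧
    (∀ (I J J' K : PolyObj.{u}) (Q : J' ⟶ J),
      Nonempty (Bicategory.precomp K ((PolyObj.times I I J' J).obj (𝟙 I, Q)) ⋙
          PolyObj.currying I J' K ≅
        PolyObj.currying I J K ⋙ Bicategory.postcomp I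
          ((PolyObj.currying (PolyObj.ihom J K) J' K).obj
            ((PolyObj.times (PolyObj.ihom J K) (PolyObj.ihom J K) J' J).obj (𝟙 _, Q) ≫
              PolyObj.ev J K)))) := by
  refine ⟨fun I J P Q f => PolyObj.isIso_hom f, fun I => ⟨PolyObj.homEmpty I⟩, fun I J K =>
    ⟨inferInstance, ⟨(PolyObj.pairingProjections I J K).symm⟩⟩, fun I J K =>
    ⟨inferInstance, ⟨PolyObj.uncurryingIso I J K⟩⟩, fun I J K =>
    ⟨⟨PolyObj.curryingUncurrying I J K⟩, ⟨PolyObj.uncurryingCurrying I J K⟩⟩,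
    fun I J K _ _ _ P Q => FinPoly.curryEqv_isEquivalence P Q,
    fun I I' J K P => ⟨PolyObj.precompCurrying J K P⟩,
    fun I J K K' R => ⟨PolyObj.postcompCurrying _ _ (PolyObj.evaluationPostcomp I J R)⟩,
    fun I J J' K Q => ⟨PolyObj.postcompCurrying _ _ (PolyObj.evaluationPrecomp I K Q)⟩⟩
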